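/- Let $S^1=\mathbb R/\mathbb Z$, and fix a smoothness class $C^k$, $k\in\mathbb Z\cup\{\infty\}$, or $W^{k,p}$, $k\in\mathbb Z$, $1\le p<\infty$. Let $L\mathbb C$ denote the space $C^k(S^1)$, resp. $W^{k,p}(S^1)$, and $L^-\mathbb C$ the space $C^{k-1}(S^1)$, resp. $W^{k-1,p}(S^1)$, of complex valued functions or distributions ($\infty-1=\infty$); for negative $k$ the elements of $C^k(S^1)$, $W^{k,p}(S^1)$ are the distributions on $S^1$ that are locally equal to the $(-k)$'th derivative of functions in $C(S^1)$, resp. $L^p(S^1)$. All these spaces carry their usual Banach space topology (Fréchet if $k=\infty$); for $k=-n<0$ it is given by the norm $\inf\{\sum_{j=0}^n\|f_j\| : x=\sum_{j=0}^n f_j^{(j)}\}$, with $f_j$ in $C(S^1)$, resp. $L^p(S^1)$. For functions $F$ on $\mathbb C\times L\mathbb C$ or on $\mathbb C\times L^-\mathbb C$ consider the conditions (1) for all $\zeta,y$: $F(\zeta/\lambda,\lambda^2y)=O(\lambda^2)$ as $\mathbb C\setminus\{0\}\ni\lambda\to0$; (2) $F(\zeta,x+y)=F(\zeta,x)+F(\zeta,y)$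 whenever $\operatorname{supp}x\cap\operatorname{supp}y=\emptyset$; (3) $F(\zeta,y+\mathrm{const})=F(\zeta,y)$. Let $\mathfrak F$ be the space of holomorphic functions $F:\mathbb C\times L\mathbb C\to\mathbb C$ satisfying (1), (2) and (3), and $\tilde{\mathfrak F}$ the space of holomorphic functions $\tilde F:\mathbb C\times L^-\mathbb C\to\mathbb C$ satisfying (1) and (2), both with the compact--open topology. A function $F$ in either space is posthomogeneous of degree $m$ if $F(\zeta,cy)=c^mF(\zeta,y)$ for all $\zeta,c\in\mathbb C$ and all $y$; a linear map between these spaces is graded if it maps posthomogeneous functions of degree $m$ to posthomogeneous functions of degree $m$, for every $m=0,1,2,\dots$. Theorem. The formula $F(\zeta,y)=\tilde F(\zeta,\dot y)$ defines a continuous graded linear map $\tilde{\mathfrak F}\to\mathfrak F$, $\tilde F\mapsto F$. This map has a continuous graded linear right inverse $\mathfrak F\to\tilde{\mathfrak F}$, and its kernel consists exactly of the functions $\tilde F(\zeta,x)=c\int_{S^1}x$, $c\in\mathbb C$, where $\int_{S^1}x$ is the value of the distribution $x$ on the constant function $1$. -/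

import Mathlib

open MeasureTheory Filter Topology Asymptotics Set
open scoped ContDiff

noncomputable section

namespace LoopSpaces

/-! ### Distributions on the circle `S¹ = ℝ / ℤ` -/

/-- Smooth functions `S¹ → ℂ`, i.e. functions whose pull-back to `ℝ` is `C^∞`. -/
def testSubmodule : Submodule ℂ (UnitAddCircle → ℂ) where
  carrier := {φ | ContDiff ℝ ∞ fun t : ℝ => φ (t : UnitAddCircle)}
  zero_mem' := by
    rw [mem_ofPred_eq]
    exact contDiff_const
  add_mem' := by
    intro φ ψ hφ hψ
    rw [mem_ofPred_eq] at *
    exact hφ.add hψ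
  smul_mem' := by
    intro c φ hφ
    rw [mem_ofPred_eq] at *
    exact contDiff_const.mul hφ

/-- The space `C^∞(S¹)` of test functions. -/
def TestFn : Type := testSubmodule

instance : AddCommGroup TestFn := inferInstanceAs (AddCommGroup testSubmodule)
instance : Module ℂ TestFn := inferInstanceAs (Module ℂ testSubmodule)
instance : FunLike TestFn UnitAddCircle ℂ where
  coe φ := φ.1
  coe_injective := Subtype.val_injective

namespace TestFn

theorem contDiff (φ : TestFn) : ContDiff ℝ ∞ fun t : ℝ => φ (t : UnitAddCircle) := φ.2

@[simp] theorem add_apply (φ ψ : TestFn) (t : UnitAddCircle) : (φ + ψ) t = φ t + ψ t := rfl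

@[simp] theorem smul_apply (c : ℂ) (φ : TestFn) (t : UnitAddCircle) : (c • φ) t = c * φ t := rfl

theorem continuous (φ : TestFn) : Continuous φ := by
  refine (QuotientAddGroup.isQuotientMap_mk
    (N := AddSubgroup.zmultiples (1 : ℝ))).continuous_iff.2 ?_
  exact φ.contDiff.continuous

theorem deriv_lift (φ : UnitAddCircle → ℂ) (t : ℝ) :
    deriv (fun s : ℝ => φ ((t : UnitAddCircle) + s)) 0 =
      deriv (fun s : ℝ => φ (s : UnitAddCircle)) t := by
  have := deriv_comp_const_add (f := fun s : ℝ => φ (s : UnitAddCircle)) t 0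
  simpa using this

/-- The derivative of a test function. -/
def deriv : TestFn →ₗ[ℂ] TestFn where
  toFun φ := ⟨fun t => _root_.deriv (fun s : ℝ => φ (t + s)) 0, by
    have h : (fun t : ℝ => _root_.deriv (fun s : ℝ => φ ((t : UnitAddCircle) + s)) 0) =
        _root_.deriv fun s : ℝ => φ (s : UnitAddCircle) := funext fun t => deriv_lift φ t
    change ContDiff ℝ ∞
      (fun t : ℝ => _root_.deriv (fun s : ℝ => φ ((t : UnitAddCircle) + s)) 0)
    rw [h]
    exact (contDiff_infty_iff_deriv.1 φ.contDiff).2⟩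
  map_add' φ ψ := by
    apply DFunLike.ext
    intro t
    obtain ⟨t, rfl⟩ := QuotientAddGroup.mk_surjective t
    refine (deriv_lift (φ + ψ) t).trans ?_
    refine Eq.trans ?_ (congrArg₂ (· + ·) (deriv_lift φ t) (deriv_lift ψ t)).symm
    exact deriv_add (φ.contDiff.differentiable (by simp) t) (ψ.contDiff.differentiable (by simp) t)
  map_smul' c φ := by
    apply DFunLike.ext
    intro t
    obtain ⟨t, rfl⟩ := QuotientAddGroup.mk_surjective t
    refine (deriv_lift (c • φ) t).trans ?_
    refine Eq.trans ?_ (congrArg (c * ·) (deriv_lift φ t)).symm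
    exact deriv_const_mul c (φ.contDiff.differentiable (by simp) t)

/-- The constant function `1`. -/
def one : TestFn := ⟨fun _ => 1, contDiff_const (𝕜 := ℝ) (n := ∞) (E := ℝ) (c := (1 : ℂ))⟩

end TestFn

/-- Distributions on `S¹`: linear functionals `u` on `C^∞(S¹)` that are continuous, i.e. that
satisfy `|u(φ)| ≤ C max_{j ≤ N} sup |φ^{(j)}|` for some `N` and `C`. -/
def Distr : Submodule ℂ (TestFn →ₗ[ℂ] ℂ) where
  carrier := {u | ∃ (N : ℕ) (C : ℝ), 0 ≤ C ∧ ∀ (φ : TestFn) (M : ℝ),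
    (∀ j ≤ N, ∀ t, ‖(TestFn.deriv ^ j) φ t‖ ≤ M) → ‖u φ‖ ≤ C * M}
  zero_mem' := ⟨0, 0, le_rfl, fun φ M _ => by simp⟩
  add_mem' := by
    rintro u v ⟨N, C, hC, h⟩ ⟨N', C', hC', h'⟩
    refine ⟨max N N', C + C', add_nonneg hC hC', fun φ M hM => ?_⟩
    have h1 := h φ M fun j hj => hM j (hj.trans (le_max_left _ _))
    have h2 := h' φ M fun j hj => hM j (hj.trans (le_max_right _ _))
    calc ‖u φ + v φ‖ ≤ ‖u φ‖ + ‖v φ‖ := norm_add_le _ _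
      _ ≤ (C + C') * M := by linarith
  smul_mem' := by
    rintro c u ⟨N, C, hC, h⟩
    refine ⟨N, ‖c‖ * C, mul_nonneg (norm_nonneg _) hC, fun φ M hM => ?_⟩
    change ‖c * u φ‖ ≤ _
    rw [norm_mul, mul_assoc]
    exact mul_le_mul_of_nonneg_left (h φ M hM) (norm_nonneg _)

namespace Distr

/-- The derivative of a distribution, `(Du)(φ) = -u(φ')`. -/
def deriv : Distr →ₗ[ℂ] Distr where
  toFun u := ⟨-(u.1.comp TestFn.deriv), by
    obtain ⟨N, C, hC, h⟩ := u.2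
    refine ⟨N + 1, C, hC, fun φ M hM => ?_⟩
    change ‖-(u.1 (TestFn.deriv φ))‖ ≤ _
    rw [norm_neg]
    refine h _ M fun j hj t => ?_
    have := hM (j + 1) (by omega) t
    rwa [pow_succ] at this⟩
  map_add' u v := by
    apply Subtype.ext
    apply LinearMap.ext
    intro φ
    change -(u.1 _ + v.1 _) = -u.1 _ + -v.1 _
    ring
  map_smul' c u := by
    apply Subtype.ext
    apply LinearMap.ext
    intro φ
    change -(c * u.1 _) = c * -u.1 _
    ring

theorem integrable_mul (f : UnitAddCircle → ℂ) (hf : Integrable f) (φ : TestFn) :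
    Integrable fun t => f t * φ t := by
  obtain ⟨c, hc⟩ := (isCompact_range φ.continuous).isBounded.exists_norm_le
  exact hf.mul_bdd φ.continuous.aestronglyMeasurable
    (Eventually.of_forall fun t => hc _ (mem_range_self t))

/-- The distribution `φ ↦ ∫ f φ` given by an integrable function `f` on `S¹`. -/
def ofIntegrable (f : UnitAddCircle → ℂ) (hf : Integrable f) : Distr :=
  ⟨{  toFun := fun φ => ∫ t, f t * φ t
      map_add' := fun φ ψ => by
        rw [← integral_add (integrable_mul f hf φ) (integrable_mul f hf ψ)]
        simp only [TestFn.add_apply, mul_add]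
      map_smul' := fun c φ => by
        rw [RingHom.id_apply, smul_eq_mul, ← integral_const_mul]
        simp only [TestFn.smul_apply, mul_left_comm] },
    0, ∫ t, ‖f t‖, integral_nonneg fun _ => norm_nonneg _, fun φ M hM => by
      change ‖∫ t, f t * φ t‖ ≤ _
      rw [← integral_mul_const]
      refine norm_integral_le_of_norm_le (hf.norm.mul_const M) (Eventually.of_forall fun t => ?_)
      rw [norm_mul]
      exact mul_le_mul_of_nonneg_left (hM 0 le_rfl t) (norm_nonneg _)⟩

theorem ofIntegrable_add (f g k : UnitAddCircle → ℂ) (hf : Integrable f) (hg : Integrable g)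
    (hk : Integrable k) (h : k =ᵐ[volume] f + g) :
    ofIntegrable k hk = ofIntegrable f hf + ofIntegrable g hg := by
  apply Subtype.ext
  apply LinearMap.ext
  intro φ
  change ∫ t, k t * φ t = (∫ t, f t * φ t) + ∫ t, g t * φ t
  rw [← integral_add (integrable_mul f hf φ) (integrable_mul g hg φ)]
  refine integral_congr_ae (h.mono fun t ht => ?_)
  simp only [ht, Pi.add_apply, add_mul]

theorem ofIntegrable_smul (c : ℂ) (f k : UnitAddCircle → ℂ) (hf : Integrable f)
    (hk : Integrable k) (h : k =ᵐ[volume] c • f) :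
    ofIntegrable k hk = c • ofIntegrable f hf := by
  apply Subtype.ext
  apply LinearMap.ext
  intro φ
  change ∫ t, k t * φ t = c * ∫ t, f t * φ t
  rw [← integral_const_mul]
  refine integral_congr_ae (h.mono fun t ht => ?_)
  simp only [ht, Pi.smul_apply, smul_eq_mul, mul_assoc]

/-- The constant function `c`, as a distribution. -/
def const (c : ℂ) : Distr := ofIntegrable (fun _ => c) (integrable_const c)

/-- The integral `∫_{S¹} u`, i.e. the value of `u` on the constant function `1`. -/
def integral (u : Distr) : ℂ := u.1 TestFn.one

/-- The support of a distribution. -/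
def supp (u : Distr) : Set UnitAddCircle := Distribution.dsupport fun φ : TestFn => u.1 φ

end Distr

/-! ### The spaces `C^k(S¹)` and `W^{k,p}(S¹)` for arbitrary integers `k` -/

/-- The Banach spaces that the scales are built on: `C(S¹)` and `L^p(S¹)`, `1 ≤ p < ∞`. -/
inductive Base : Type
  | cont : Base
  | leb (p : ℝ) (hp : 1 ≤ p) : Base

namespace Base

theorem fact_one_le {p : ℝ} (hp : 1 ≤ p) : Fact (1 ≤ ENNReal.ofReal p) :=
  ⟨ENNReal.one_le_ofReal.2 hp⟩

/-- `C(S¹)`, resp. `L^p(S¹)`. -/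
def Fn : Base → Type
  | cont => C(UnitAddCircle, ℂ)
  | leb p _ => Lp ℂ (ENNReal.ofReal p) (volume : Measure UnitAddCircle)

instance (b : Base) : NormedAddCommGroup b.Fn :=
  match b with
  | cont => inferInstanceAs (NormedAddCommGroup C(UnitAddCircle, ℂ))
  | leb p hp =>
    haveI := fact_one_le hp
    inferInstanceAs (NormedAddCommGroup (Lp ℂ (ENNReal.ofReal p) (volume : Measure UnitAddCircle)))

instance (b : Base) : NormedSpace ℂ b.Fn :=
  match b with
  | cont => inferInstanceAs (NormedSpace ℂ C(UnitAddCircle, ℂ))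
  | leb p hp =>
    haveI := fact_one_le hp
    inferInstanceAs (NormedSpace ℂ (Lp ℂ (ENNReal.ofReal p) (volume : Measure UnitAddCircle)))

theorem integrable_cont (f : C(UnitAddCircle, ℂ)) : Integrable f :=
  f.continuous.integrable_of_hasCompactSupport (HasCompactSupport.of_compactSpace f)

theorem integrable_leb {p : ℝ} (hp : 1 ≤ p)
    (f : Lp ℂ (ENNReal.ofReal p) (volume : Measure UnitAddCircle)) : Integrable f :=
  (Lp.memLp f).integrable (ENNReal.one_le_ofReal.2 hp)

/-- A continuous, resp. `L^p`, function regarded as a distribution. -/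
def toDistr : (b : Base) → b.Fn →ₗ[ℂ] Distr
  | cont =>
    { toFun := fun f : C(UnitAddCircle, ℂ) => Distr.ofIntegrable f (integrable_cont f)
      map_add' := fun f g : C(UnitAddCircle, ℂ) => Distr.ofIntegrable_add _ _ _
        (integrable_cont f) (integrable_cont g) _ (Eventually.of_forall fun _ => rfl)
      map_smul' := fun c (f : C(UnitAddCircle, ℂ)) => Distr.ofIntegrable_smul c _ _
        (integrable_cont f) _ (Eventually.of_forall fun _ => rfl) }
  | leb p hp =>
    { toFun := fun f : Lp ℂ (ENNReal.ofReal p) (volume : Measure UnitAddCircle) =>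
        Distr.ofIntegrable f (integrable_leb hp f)
      map_add' := fun f g : Lp ℂ (ENNReal.ofReal p) (volume : Measure UnitAddCircle) =>
        Distr.ofIntegrable_add _ _ _ (integrable_leb hp f) (integrable_leb hp g) _
          (Lp.coeFn_add f g)
      map_smul' := fun c (f : Lp ℂ (ENNReal.ofReal p) (volume : Measure UnitAddCircle)) =>
        Distr.ofIntegrable_smul c _ _ (integrable_leb hp f) _ (Lp.coeFn_smul c f) }

end Base

/-- `u` is locally equal to the `n`'th derivative of functions in `C(S¹)`, resp. `L^p(S¹)`. -/
def IsLocallyDeriv (b : Base) (n : ℕ) (u : Distr) : Prop :=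
  ∀ t : UnitAddCircle, ∃ U : Set UnitAddCircle, IsOpen U ∧ t ∈ U ∧ ∃ f : b.Fn,
    ∀ φ : TestFn, tsupport φ ⊆ U → u.1 φ = ((Distr.deriv ^ n) (b.toDistr f)).1 φ

/-- The space of distributions of regularity `k` on the scale of `b`. If `0 ≤ k ≤ ∞`, these are the
`u` such that `u` and its derivatives of order `≤ k` are functions in `C(S¹)`, resp. `L^p(S¹)`;
if `k = -n < 0`, the `u` that are locally the `n`'th derivative of such functions. -/
def regular (b : Base) (k : WithTop ℤ) : Submodule ℂ Distr where
  carrier := {u |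
    (∀ j : ℕ, ((j : ℤ) : WithTop ℤ) ≤ k → (Distr.deriv ^ j) u ∈ LinearMap.range b.toDistr) ∧
    (∀ n : ℕ, 0 < n → k = ((-n : ℤ) : WithTop ℤ) → IsLocallyDeriv b n u)}
  zero_mem' := by
    rw [mem_ofPred_eq]
    refine ⟨fun j _ => by rw [map_zero]; exact Submodule.zero_mem _, fun n _ _ t => ?_⟩
    refine ⟨univ, isOpen_univ, mem_univ t, 0, fun φ _ => ?_⟩
    rw [map_zero, map_zero]
  add_mem' := by
    intro u v hu hv
    rw [mem_ofPred_eq] at *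
    refine ⟨fun j hj => by rw [map_add]; exact Submodule.add_mem _ (hu.1 j hj) (hv.1 j hj),
      fun n hn hk t => ?_⟩
    obtain ⟨U, hU, htU, f, hf⟩ := hu.2 n hn hk t
    obtain ⟨V, hV, htV, g, hg⟩ := hv.2 n hn hk t
    refine ⟨U ∩ V, hU.inter hV, ⟨htU, htV⟩, f + g, fun φ hφ => ?_⟩
    rw [map_add, map_add]
    exact congrArg₂ (· + ·) (hf φ (hφ.trans inter_subset_left)) (hg φ (hφ.trans inter_subset_right))
  smul_mem' := by
    intro c u hu
    rw [mem_ofPred_eq] at *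
    refine ⟨fun j hj => by rw [map_smul]; exact Submodule.smul_mem _ c (hu.1 j hj),
      fun n hn hk t => ?_⟩
    obtain ⟨U, hU, htU, f, hf⟩ := hu.2 n hn hk t
    refine ⟨U, hU, htU, c • f, fun φ hφ => ?_⟩
    rw [map_smul, map_smul]
    exact congrArg (c * ·) (hf φ hφ)

theorem deriv_mem_regular (b : Base) (k : WithTop ℤ) (u : Distr) (hu : u ∈ regular b k) :
    Distr.deriv u ∈ regular b (k.map (· - 1)) := by
  change _ ∧ _
  have hu' : (∀ j : ℕ, ((j : ℤ) : WithTop ℤ) ≤ k →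
      (Distr.deriv ^ j) u ∈ LinearMap.range b.toDistr) ∧
    (∀ n : ℕ, 0 < n → k = ((-n : ℤ) : WithTop ℤ) → IsLocallyDeriv b n u) := hu
  refine ⟨fun j hj => ?_, fun n hn hk t => ?_⟩
  · have h := hu'.1 (j + 1) ?_
    · rwa [pow_succ] at h
    · cases k with
      | top => exact le_top
      | coe k =>
        rw [WithTop.map_coe, WithTop.coe_le_coe] at hj
        rw [WithTop.coe_le_coe]
        push_cast
        omega
  · cases k with
    | top => exact absurd hk WithTop.top_ne_coe
    | coe k =>
      rw [WithTop.map_coe, WithTop.coe_inj] at hk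
      obtain ⟨n, rfl⟩ : ∃ m, n = m + 1 := ⟨n - 1, by omega⟩
      rcases Nat.eq_zero_or_pos n with rfl | hn'
      · obtain ⟨f, hf⟩ := hu'.1 0 (by rw [WithTop.coe_le_coe]; push_cast at hk ⊢; omega)
        refine ⟨univ, isOpen_univ, mem_univ t, f, fun φ _ => ?_⟩
        rw [hf]
        rfl
      · obtain ⟨U, hU, htU, f, hf⟩ := hu'.2 n hn'
          (by rw [WithTop.coe_inj]; push_cast at hk; omega) t
        refine ⟨U, hU, htU, f, fun φ hφ => ?_⟩
        have hsub : tsupport (TestFn.deriv φ) ⊆ U := by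
          refine (closure_minimal (fun s hs => ?_) (isClosed_tsupport φ)).trans hφ
          by_contra hns
          refine hs ?_
          have h0 := notMem_tsupport_iff_eventuallyEq.1 hns
          have hc : Tendsto (fun r : ℝ => s + (r : UnitAddCircle)) (𝓝 0) (𝓝 s) := by
            have : Continuous fun r : ℝ => s + (r : UnitAddCircle) :=
              continuous_const.add (AddCircle.continuous_mk' 1)
            simpa using this.tendsto 0
          have h1 : (fun r : ℝ => φ (s + (r : UnitAddCircle))) =ᶠ[𝓝 0] fun _ => (0 : ℂ) :=
            hc.eventually h0
          change deriv (fun r : ℝ => φ (s + (r : UnitAddCircle))) 0 = 0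
          rw [h1.deriv_eq, deriv_const]
        have := congrArg Neg.neg (hf _ hsub)
        rw [pow_succ']
        exact this

/-- The smoothness classes `C^k`, `k ∈ ℤ ∪ {∞}`, and `W^{k,p}`, `k ∈ ℤ`, `1 ≤ p < ∞`. -/
inductive SmoothnessClass : Type
  | C (k : WithTop ℤ) : SmoothnessClass
  | W (k : ℤ) (p : ℝ) (hp : 1 ≤ p) : SmoothnessClass

namespace SmoothnessClass

/-- The space on which the scale of the class is built. -/
def base : SmoothnessClass → Base
  | C _ => Base.cont
  | W _ p hp => Base.leb p hp

/-- The order `k` of the class. -/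
def order : SmoothnessClass → WithTop ℤ
  | C k => k
  | W k _ _ => (k : WithTop ℤ)

/-- The class with order `k - 1` in place of `k` (where `∞ - 1 = ∞`). -/
def pred : SmoothnessClass → SmoothnessClass
  | C k => C (k.map (· - 1))
  | W k p hp => W (k - 1) p hp

theorem regular_pred (s : SmoothnessClass) :
    regular s.pred.base s.pred.order = regular s.base (s.order.map (· - 1)) := by
  cases s <;> rfl

end SmoothnessClass

/-- The space `C^k(S¹)`, resp. `W^{k,p}(S¹)`, of complex valued loops: for the class `s` this is
`Lℂ`, and `Loop s.pred` is `L⁻ℂ`. -/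
def Loop (s : SmoothnessClass) : Type := regular s.base s.order

namespace Loop

variable {s : SmoothnessClass}

instance : AddCommGroup (Loop s) := inferInstanceAs (AddCommGroup (regular s.base s.order))
instance : Module ℂ (Loop s) := inferInstanceAs (Module ℂ (regular s.base s.order))

/-- The distribution underlying a loop. -/
def toDistr (x : Loop s) : Distr := x.1

/-- The derivative `y ↦ ẏ`, from `Lℂ` to `L⁻ℂ`. -/
def deriv (y : Loop s) : Loop s.pred :=
  ⟨Distr.deriv y.1, by
    rw [SmoothnessClass.regular_pred]
    exact deriv_mem_regular s.base s.order y.1 y.2⟩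

/-- The topology of `C(S¹)`, resp. `L^p(S¹)`, transported to its image in the distributions. -/
@[reducible]
def baseTopology (b : Base) : TopologicalSpace (LinearMap.range b.toDistr) :=
  TopologicalSpace.coinduced (LinearMap.rangeRestrict b.toDistr) inferInstance

/-- If `0 ≤ k ≤ ∞`, the topology of the loop space is the one given by the
`C(S¹)`, resp. `L^p(S¹)`, norms of the derivatives of order `≤ k`. If `k = -n < 0`, it is the one
given by the norm `inf {∑ ‖f_j‖ : x = ∑_{j ≤ n} D^j f_j}`, the `f_j` in `C(S¹)`, resp. `L^p(S¹)`;
i.e. the quotient topology under `(f_0, …, f_n) ↦ ∑ D^j f_j`. -/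
instance : TopologicalSpace (Loop s) :=
  (⨅ (j : ℕ) (h : ((j : ℤ) : WithTop ℤ) ≤ s.order),
    TopologicalSpace.induced
      (fun x : Loop s => (⟨(Distr.deriv ^ j) x.1, x.2.1 j h⟩ : LinearMap.range s.base.toDistr))
      (baseTopology s.base)) ⊓
  (⨅ (n : ℕ) (_ : 0 < n) (_ : s.order = ((-n : ℤ) : WithTop ℤ)),
    TopologicalSpace.coinduced
      (fun f : {f : Fin (n + 1) → s.base.Fn //
          ∑ j : Fin (n + 1), (Distr.deriv ^ (j : ℕ)) (s.base.toDistr (f j)) ∈ regular s.base s.order} =>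
        (⟨_, f.2⟩ : Loop s))
      inferInstance)

end Loop

/-! ### The spaces of holomorphic functions -/

section Functions

variable {E : Type} [AddCommGroup E] [Module ℂ E] [TopologicalSpace E]

/-- A function on a complex topological vector space is holomorphic if it is continuous and its
restriction to each complex line is holomorphic. -/
def IsHolomorphic (F : E → ℂ) : Prop :=
  Continuous F ∧ ∀ x v : E, Differentiable ℂ fun c : ℂ => F (x + c • v)

end Functions

section Spaces

variable {s : SmoothnessClass}

/-- `F(ζ/λ, λ²y) = O(λ²)` as `λ → 0`, for all `ζ` and `y`. -/
def GrowthCondition (F : ℂ × Loop s → ℂ) : Prop :=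
  ∀ (ζ : ℂ) (y : Loop s), (fun c : ℂ => F (ζ / c, c ^ 2 • y)) =O[𝓝[≠] 0] fun c : ℂ => c ^ 2

/-- `F(ζ, x + y) = F(ζ, x) + F(ζ, y)` if `supp x ∩ supp y = ∅`. -/
def IsAdditive (F : ℂ × Loop s → ℂ) : Prop :=
  ∀ (ζ : ℂ) (x y : Loop s), Distr.supp x.toDistr ∩ Distr.supp y.toDistr = ∅ →
    F (ζ, x + y) = F (ζ, x) + F (ζ, y)

/-- `F(ζ, y + const) = F(ζ, y)`. -/
def IsConstInvariant (F : ℂ × Loop s → ℂ) : Prop :=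
  ∀ (ζ : ℂ) (y z : Loop s) (c : ℂ), z.toDistr = y.toDistr + Distr.const c → F (ζ, z) = F (ζ, y)

/-- `F` is posthomogeneous of degree `m`: each `F(ζ, ·)` is homogeneous of degree `m`. -/
def IsPosthomogeneous (m : ℕ) (F : ℂ × Loop s → ℂ) : Prop :=
  ∀ (ζ c : ℂ) (y : Loop s), F (ζ, c • y) = c ^ m * F (ζ, y)

variable (s)

/-- The holomorphic functions on `ℂ × Loop s` that satisfy the growth condition and are additive.
It carries the compact-open topology, as a subspace of `C(ℂ × Loop s, ℂ)`.
The space `𝔉̃` is `AdditiveSpace s.pred`. -/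
def AdditiveSpace : Submodule ℂ C(ℂ × Loop s, ℂ) where
  carrier := {F | IsHolomorphic F ∧ GrowthCondition F ∧ IsAdditive F}
  zero_mem' := by
    rw [mem_ofPred_eq]
    refine ⟨⟨map_continuous _, fun x v => ?_⟩, fun ζ y => ?_, fun ζ x y _ => ?_⟩
    · exact differentiable_const (0 : ℂ)
    · exact isBigO_zero _ _
    · exact (add_zero (0 : ℂ)).symm
  add_mem' := by
    intro F G hF hG
    rw [mem_ofPred_eq] at *
    refine ⟨⟨map_continuous _, fun x v => ?_⟩, fun ζ y => ?_, fun ζ x y h => ?_⟩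
    · exact (hF.1.2 x v).add (hG.1.2 x v)
    · exact (hF.2.1 ζ y).add (hG.2.1 ζ y)
    · have h1 := hF.2.2 ζ x y h
      have h2 := hG.2.2 ζ x y h
      rw [ContinuousMap.add_apply, ContinuousMap.add_apply, ContinuousMap.add_apply, h1, h2]
      ring
  smul_mem' := by
    intro c F hF
    rw [mem_ofPred_eq] at *
    refine ⟨⟨map_continuous _, fun x v => ?_⟩, fun ζ y => ?_, fun ζ x y h => ?_⟩
    · exact (hF.1.2 x v).const_mul c
    · exact (hF.2.1 ζ y).const_mul_left c
    · have h1 := hF.2.2 ζ x y h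
      rw [ContinuousMap.smul_apply, ContinuousMap.smul_apply, ContinuousMap.smul_apply, h1,
        smul_add]

/-- The space `𝔉`, with the compact-open topology. -/
def InvariantSpace : Submodule ℂ C(ℂ × Loop s, ℂ) where
  carrier := {F | F ∈ AdditiveSpace s ∧ IsConstInvariant F}
  zero_mem' := by
    rw [mem_ofPred_eq]
    exact ⟨Submodule.zero_mem _, fun _ _ _ _ _ => rfl⟩
  add_mem' := by
    intro F G hF hG
    rw [mem_ofPred_eq] at *
    exact ⟨Submodule.add_mem _ hF.1 hG.1, fun ζ y z c h =>
      congrArg₂ (· + ·) (hF.2 ζ y z c h) (hG.2 ζ y z c h)⟩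
  smul_mem' := by
    intro c F hF
    rw [mem_ofPred_eq] at *
    exact ⟨Submodule.smul_mem _ c hF.1, fun ζ y z d h => congrArg (c • ·) (hF.2 ζ y z d h)⟩

end Spaces

end LoopSpaces

end

noncomputable section

namespace LoopSpaces

/-! ### Complex analysis -/

section Parameters

variable {X K : Type*} [TopologicalSpace X] [TopologicalSpace K] [CompactSpace K]
  [MeasurableSpace K] [BorelSpace K]

/-! The derivative maps `Lℂ` onto the elements of `L⁻ℂ` of integral zero, with the constants as
kernel. Composing F ∈ 𝔉 with the primitive P of mean zero gives G(ζ, x) = F(ζ, Px), and a preimage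
of F is a locally additive function that agrees with G on the hyperplane ∫x = 0. The work lies in
extending G off this hyperplane by a formula that is linear and continuous in F.

Local structure. Local additivity alone gives f(y + x + z) = f(y + x) + f(y + z) - f(y) for every y
if x and z have disjoint supports (`LocallyAdditive.add_add_eq`). Hence each Hessian of f is a local
bilinear form. If f is also invariant under constants, the Hessian annihilates constants, and then
it vanishes on p, q as soon as p' and q' have disjoint supports (`bilin_eq_zero_of_disjoint_deriv`).
For G this is the "square" identity for increments p, q of integral zero with disjoint supports,
recorded in `IsExtendable`.

Extension. Let e₀, …, e₅ be bumps of integral one with disjoint supports. Suppose that an extension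
had the value wᵢ(t) at t eᵢ; local additivity would then force the value G(x - (∫x) eᵢ) - wᵢ(-∫x) at
each x whose support avoids that of eᵢ. All wᵢ are determined by g = w₀, and they are consistent if
g(s + t) - g(s) - g(t) equals the defect K(s, t) = G((s + t) e₀ - s e₁ - t e₂) - G(s (e₀ - e₁)) -
G(t (e₀ - e₂)). The square identity makes K a symmetric cocycle, so that g(s) = ∫₀¹ s ∂₂K(τs, 0) dτ
solves the equation (`coboundary_add`). Let χ and ψ be cut-offs with disjoint supports, equal to one
near the supports of e₀, e₁, e₂ and of e₃, e₄, e₅, respectively. An arbitrary x is treated by adding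
the values at x - χx and x - ψx and subtracting that at x - χx - ψx.

Every ingredient is a continuous linear operator between spaces C(ℂ × W, ℂ) that preserves
holomorphy, the growth condition and homogeneity (`PreservesClasses`). To this end derivatives are
written as Cauchy integrals.

Kernel. A locally additive holomorphic function that vanishes where ∫x = 0 is c(ζ) ∫x. The growth
condition makes the entire function c bounded, hence constant by Liouville's theorem. -/

theorem ContinuousMap.integrable_of_compact (μ : Measure K) [IsFiniteMeasure μ] (f : C(K, ℂ)) :
    Integrable f μ := by
  obtain ⟨c, hc⟩ := (isCompact_range f.continuous).isBounded.exists_norm_le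
  exact Integrable.of_bound f.continuous.aestronglyMeasurable c
    (Eventually.of_forall fun t => hc _ (mem_range_self t))

/-- Integration against a finite measure, as a functional on `C(K, ℂ)`. -/
def integralCLM (μ : Measure K) [IsFiniteMeasure μ] : C(K, ℂ) →L[ℂ] ℂ :=
  LinearMap.mkContinuous
    { toFun := fun f => ∫ k, f k ∂μ
      map_add' := fun f g => integral_add (ContinuousMap.integrable_of_compact μ f)
        (ContinuousMap.integrable_of_compact μ g)
      map_smul' := fun c f => integral_const_mul c _ }
    (μ.real univ) fun f => by
      have h := norm_integral_le_of_norm_le_const (μ := μ) (f := f) (C := ‖f‖)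
        (Eventually.of_forall fun k => f.norm_coe_le_norm k)
      rw [mul_comm] at h
      exact h

theorem continuous_integral_of_compact (μ : Measure K) [IsFiniteMeasure μ] {f : X → K → ℂ}
    (hf : Continuous (Function.uncurry f)) : Continuous fun x => ∫ k, f x k ∂μ :=
  (integralCLM μ).continuous.comp (ContinuousMap.curry ⟨_, hf⟩).continuous

end Parameters

/-- The parametrization of the unit circle by the unit interval. -/
def circ (θ : unitInterval) : ℂ := Complex.exp (2 * Real.pi * Complex.I * (θ : ℝ))

theorem continuous_circ : Continuous circ := by
  unfold circ
  fun_prop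

theorem circ_ne_zero (θ : unitInterval) : circ θ ≠ 0 := Complex.exp_ne_zero _

theorem integral_unitInterval (f : ℝ → ℂ) :
    ∫ θ : unitInterval, f θ = ∫ θ in (0 : ℝ)..1, f θ := by
  rw [intervalIntegral.integral_of_le zero_le_one, ← integral_Icc_eq_integral_Ioc]
  exact integral_subtype (measurableSet_Icc) f

/-- Cauchy's formula for f' on the unit circle about w. Since no derivative occurs on the left, this
form depends continuously on f in the compact-open topology and needs no norm on the spaces where it
is applied along lines. -/
theorem integral_circ_inv_mul {f : ℂ → ℂ} (hf : Differentiable ℂ f) (w : ℂ) :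
    ∫ θ : unitInterval, (circ θ)⁻¹ * f (w + circ θ) = deriv f w := by
  have h := Complex.two_pi_I_inv_smul_circleIntegral_sub_sq_inv_smul_of_differentiable
    (U := univ) isOpen_univ (c := w) (w₀ := w) (R := 1) (subset_univ _) hf.differentiableOn
    (Metric.mem_ball_self one_pos)
  rw [← h]
  have h1 := integral_unitInterval (fun θ : ℝ =>
    (Complex.exp (2 * Real.pi * Complex.I * θ))⁻¹ *
      f (w + Complex.exp (2 * Real.pi * Complex.I * θ)))
  refine h1.trans ?_
  rw [circleIntegral]
  have h2 := intervalIntegral.smul_integral_comp_mul_left (a := 0) (b := 1)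
    (fun θ : ℝ => deriv (circleMap w 1) θ • ((circleMap w 1 θ - w) ^ 2)⁻¹ • f (circleMap w 1 θ))
    (2 * Real.pi)
  rw [mul_zero, mul_one] at h2
  rw [← h2, ← intervalIntegral.integral_smul, ← intervalIntegral.integral_smul]
  refine intervalIntegral.integral_congr fun θ _ => ?_
  have hpi : (Real.pi : ℂ) ≠ 0 := by exact_mod_cast Real.pi_ne_zero
  have he : Complex.exp (2 * Real.pi * Complex.I * θ) ≠ 0 := Complex.exp_ne_zero _
  simp only [deriv_circleMap, circleMap, smul_eq_mul, Complex.real_smul]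
  push_cast
  rw [show (2 * Real.pi * θ * Complex.I : ℂ) = 2 * Real.pi * Complex.I * θ by ring]
  generalize Complex.exp (2 * Real.pi * Complex.I * θ) = e at *
  have hI := Complex.I_ne_zero
  simp only [one_mul, zero_add, add_sub_cancel_left]
  field_simp

theorem continuous_deriv_of_continuous {X : Type*} [TopologicalSpace X] {f : X → ℂ → ℂ}
    (hf : Continuous (Function.uncurry f)) (hd : ∀ x, Differentiable ℂ (f x)) {w : X → ℂ}
    (hw : Continuous w) : Continuous fun x => deriv (f x) (w x) := by
  simp_rw [← fun x => integral_circ_inv_mul (hd x) (w x)]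
  refine continuous_integral_of_compact _ ?_
  have h1 : Continuous fun p : X × unitInterval => (circ p.2)⁻¹ :=
    (continuous_circ.comp continuous_snd).inv₀ fun p => circ_ne_zero p.2
  have h2 : Continuous fun p : X × unitInterval => f p.1 (w p.1 + circ p.2) :=
    hf.comp (continuous_fst.prodMk ((hw.comp continuous_fst).add (continuous_circ.comp continuous_snd)))
  exact h1.mul h2

theorem differentiable_integral_of_compact {K : Type*} [TopologicalSpace K] [CompactSpace K]
    [MeasurableSpace K] [BorelSpace K] (μ : Measure K) [IsFiniteMeasure μ] {f : ℂ → K → ℂ}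
    (hf : Continuous (Function.uncurry f)) (hd : ∀ k, Differentiable ℂ fun z => f z k) :
    Differentiable ℂ fun z => ∫ k, f z k ∂μ := by
  intro z₀
  have hc : Continuous fun p : ℂ × K => deriv (fun z => f z p.2) p.1 :=
    continuous_deriv_of_continuous (f := fun (p : ℂ × K) z => f z p.2)
      (hf.comp (continuous_snd.prodMk (continuous_snd.comp continuous_fst))) (fun p => hd p.2)
      continuous_fst
  obtain ⟨C, hC⟩ := (((isCompact_closedBall z₀ 1).prod (isCompact_univ (X := K))).image
    hc).isBounded.exists_norm_le
  have hk : ∀ z, Continuous (f z) := fun z => hf.comp (continuous_const.prodMk continuous_id)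
  have := hasDerivAt_integral_of_dominated_loc_of_deriv_le (μ := μ) (F := f)
    (F' := fun z k => deriv (fun z => f z k) z) (x₀ := z₀) (s := Metric.closedBall z₀ 1)
    (bound := fun _ => C)
    (Metric.closedBall_mem_nhds z₀ one_pos)
    (Eventually.of_forall fun z => (hk z).aestronglyMeasurable)
    (ContinuousMap.integrable_of_compact μ ⟨_, hk z₀⟩)
    (hc.comp (continuous_const.prodMk continuous_id)).aestronglyMeasurable
    (Eventually.of_forall fun k z hz => hC _ ⟨(z, k), ⟨hz, mem_univ _⟩, rfl⟩)
    (integrable_const C)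
    (Eventually.of_forall fun k z _ => (hd k z).hasDerivAt)
  exact this.2.differentiableAt

/-- Osgood's lemma in two variables. -/
theorem differentiable_of_separately {f : ℂ × ℂ → ℂ} (hf : Continuous f)
    (h₁ : ∀ w, Differentiable ℂ fun z => f (z, w)) (h₂ : ∀ z, Differentiable ℂ fun w => f (z, w)) :
    Differentiable ℂ f := by
  intro u
  have c₁ : Continuous fun p : ℂ × ℂ => deriv (fun z => f (z, p.2)) p.1 :=
    continuous_deriv_of_continuous (f := fun (p : ℂ × ℂ) z => f (z, p.2))
      (hf.comp (continuous_snd.prodMk (continuous_snd.comp continuous_fst))) (fun p => h₁ p.2)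
      continuous_fst
  have c₂ : Continuous fun p : ℂ × ℂ => deriv (fun w => f (p.1, w)) p.2 :=
    continuous_deriv_of_continuous (f := fun (p : ℂ × ℂ) w => f (p.1, w))
      (hf.comp ((continuous_fst.comp continuous_fst).prodMk continuous_snd)) (fun p => h₂ p.1)
      continuous_snd
  have := hasStrictFDerivAt_uncurry_coprod (𝕜 := ℂ) (u := u) (f := fun z w => f (z, w))
    (f₁ := fun z w => ContinuousLinearMap.toSpanSingleton ℂ (deriv (fun z => f (z, w)) z))
    (f₂ := fun z w => ContinuousLinearMap.toSpanSingleton ℂ (deriv (fun w => f (z, w)) w))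
    (Eventually.of_forall fun v => ((h₁ v.2 v.1).hasDerivAt).hasFDerivAt)
    (Eventually.of_forall fun v => ((h₂ v.1 v.2).hasDerivAt).hasFDerivAt)
    (((ContinuousLinearMap.toSpanSingletonCLE (𝕜 := ℂ) (E := ℂ)).continuous.comp c₁).continuousAt)
    (((ContinuousLinearMap.toSpanSingletonCLE (𝕜 := ℂ) (E := ℂ)).continuous.comp c₂).continuousAt)
  exact this.hasFDerivAt.differentiableAt

/-- A separately holomorphic function on the unit polydisc that vanishes on the coordinate
hyperplanes is bounded by the product of the coordinates. -/
theorem norm_le_mul_prod_of_separately {ι : Type*} [DecidableEq ι] {h : (ι → ℂ) → ℂ} {C : ℝ}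
    (hd : ∀ t i, Differentiable ℂ fun c => h (Function.update t i c))
    (h0 : ∀ t i, t i = 0 → h t = 0) (hC : ∀ t, (∀ i, ‖t i‖ ≤ 1) → ‖h t‖ ≤ C) (S : Finset ι) :
    ∀ t, (∀ i, ‖t i‖ < 1) → ‖h t‖ ≤ C * ∏ i ∈ S, ‖t i‖ := by
  induction S using Finset.induction_on with
  | empty => exact fun t ht => by simpa using hC t fun i => (ht i).le
  | insert j S hj ih =>
    intro t ht
    -- Schwarz lemma in the variable `t j` alone. The induction hypothesis bounds the function on
    -- the disc by a product over `S`, which does not involve that variable.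
    have hM : MapsTo (fun c => h (Function.update t j c)) (Metric.ball 0 1)
        (Metric.closedBall (h (Function.update t j 0)) (C * ∏ i ∈ S, ‖t i‖)) := by
      intro c hc
      rw [h0 _ j (Function.update_self ..), mem_closedBall_zero_iff]
      have := ih (Function.update t j c) fun i => by
        rcases eq_or_ne i j with rfl | hij
        · rw [Function.update_self]; exact mem_ball_zero_iff.1 hc
        · rw [Function.update_of_ne hij]; exact ht i
      refine this.trans (le_of_eq ?_)
      congr 1
      refine Finset.prod_congr rfl fun i hi => ?_
      rw [Function.update_of_ne (ne_of_mem_of_not_mem hi hj)]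
    have := Complex.dist_le_div_mul_dist_of_mapsTo_ball (hd t j).differentiableOn hM
      (mem_ball_zero_iff.2 (ht j))
    rw [h0 _ j (Function.update_self ..), dist_zero_right, dist_zero_right,
      Function.update_eq_self] at this
    rw [Finset.prod_insert hj]
    linarith

/-- A nonzero analytic germ is zⁿ g with g(0) ≠ 0, which contradicts the estimate for the exponent n
+ 1. -/
theorem eq_zero_of_isBigO_pow {f : ℂ → ℂ} (hf : Differentiable ℂ f)
    (h : ∀ n : ℕ, f =O[𝓝 0] fun z => z ^ n) (z : ℂ) : f z = 0 := by
  have ha : AnalyticOnNhd ℂ f univ := fun z _ => hf.analyticAt z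
  have h0 : ∀ᶠ z in 𝓝 0, f z = 0 := by
    by_contra hne
    obtain ⟨n, g, hg, hg0, hgf⟩ := (hf.analyticAt 0).exists_eventuallyEq_pow_smul_nonzero_iff.2 hne
    refine hg0 ?_
    have h1 : (fun z : ℂ => z ^ n * g z) =O[𝓝 0] fun z => z ^ n * z := by
      refine ((h (n + 1)).congr' ?_ ?_)
      · filter_upwards [hgf] with z hz
        simpa using hz
      · exact Eventually.of_forall fun z => pow_succ z n
    have h2 : g =O[𝓝[≠] 0] fun z => z := by
      have h3 := (isBigO_refl (fun z : ℂ => (z ^ n)⁻¹) (𝓝[≠] 0)).mul (h1.mono nhdsWithin_le_nhds)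
      refine h3.congr' ?_ ?_ <;>
      · filter_upwards [self_mem_nhdsWithin] with z hz
        have : z ^ n ≠ 0 := pow_ne_zero n hz
        field_simp
    have h4 : Tendsto g (𝓝[≠] 0) (𝓝 0) :=
      h2.trans_tendsto (tendsto_id.mono_left nhdsWithin_le_nhds)
    exact tendsto_nhds_unique (hg.continuousAt.tendsto.mono_left nhdsWithin_le_nhds) h4
  exact congrFun (ha.eq_of_eventuallyEq (g := 0) (fun z _ => analyticAt_const) h0) z

/-- The singularity of f(z)/z² at 0 is removable, so the maximum principle on the unit disc applies.
The constant depends only on the values on the unit circle; this gives uniformity in parameters,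
which the O-condition by itself does not contain. -/
theorem norm_le_sq_mul_of_isBigO {f : ℂ → ℂ} (hf : ∀ z ≠ 0, DifferentiableAt ℂ f z)
    (h : f =O[𝓝[≠] 0] fun z => z ^ 2) {M : ℝ} (hM : ∀ z, ‖z‖ = 1 → ‖f z‖ ≤ M) {z : ℂ} (hz : z ≠ 0)
    (hz1 : ‖z‖ ≤ 1) : ‖f z‖ ≤ ‖z‖ ^ 2 * M := by
  set k : ℂ → ℂ := fun z => f z / z ^ 2 with hk
  obtain ⟨C, hC⟩ := h.bound
  obtain ⟨r, hr, hrC⟩ := Metric.mem_nhdsWithin_iff.1 hC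
  have hkd : ∀ z ≠ 0, DifferentiableAt ℂ k z := fun z hz =>
    (hf z hz).div (differentiableAt_id.pow 2) (pow_ne_zero 2 hz)
  have h1 : DifferentiableOn ℂ (Function.update k 0 (limUnder (𝓝[≠] 0) k)) (Metric.ball 0 r) := by
    refine Complex.differentiableOn_update_limUnder_of_bddAbove (Metric.ball_mem_nhds 0 hr)
      (fun z hz => (hkd z hz.2).differentiableWithinAt) ⟨C, ?_⟩
    rintro _ ⟨z, hz, rfl⟩
    have := hrC hz
    simp only [mem_ofPred_eq, norm_pow] at this
    have hz0 : 0 < ‖z‖ ^ 2 := pow_pos (norm_pos_iff.2 hz.2) 2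
    simp only [Function.comp_apply, hk, norm_div, norm_pow]
    exact (div_le_iff₀ hz0).2 this
  have h2 : Differentiable ℂ (Function.update k 0 (limUnder (𝓝[≠] 0) k)) := by
    intro z
    rcases eq_or_ne z 0 with rfl | hz
    · exact h1.differentiableAt (Metric.ball_mem_nhds 0 hr)
    · refine (hkd z hz).congr_of_eventuallyEq ?_
      filter_upwards [isOpen_ne.mem_nhds hz] with w hw
      exact Function.update_of_ne hw _ _
  have h3 := Complex.norm_le_of_forall_mem_frontier_norm_le (U := Metric.ball (0 : ℂ) 1)
    Metric.isBounded_ball h2.diffContOnCl (C := M) (z := z) ?_ ?_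
  · rw [Function.update_of_ne hz] at h3
    have hz0 : 0 < ‖z‖ ^ 2 := pow_pos (norm_pos_iff.2 hz) 2
    rw [hk, norm_div, norm_pow, div_le_iff₀ hz0] at h3
    linarith
  · intro w hw
    rw [frontier_ball _ one_ne_zero, mem_sphere_zero_iff_norm] at hw
    have hw0 : w ≠ 0 := norm_pos_iff.1 (by rw [hw]; exact one_pos)
    rw [Function.update_of_ne hw0, hk, norm_div, norm_pow, hw, one_pow, div_one]
    exact hM w hw
  · rw [closure_ball _ one_ne_zero, mem_closedBall_zero_iff]
    exact hz1

/-! ### Test functions -/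

theorem volume_real_univ : (volume : Measure UnitAddCircle).real univ = 1 := by
  rw [Measure.real, UnitAddCircle.measure_univ, ENNReal.toReal_one]

theorem integral_const' (c : ℂ) : ∫ _ : UnitAddCircle, c = c := by
  rw [integral_const, volume_real_univ, one_smul]

namespace TestFn

@[ext] theorem ext {φ ψ : TestFn} (h : ∀ t, φ t = ψ t) : φ = ψ := DFunLike.ext _ _ h

@[simp] theorem zero_apply (t : UnitAddCircle) : (0 : TestFn) t = 0 := rfl

@[simp] theorem sub_apply (φ ψ : TestFn) (t : UnitAddCircle) : (φ - ψ) t = φ t - ψ t := rfl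

@[simp] theorem one_apply (t : UnitAddCircle) : one t = 1 := rfl

@[simp] theorem sum_apply {ι : Type*} (s : Finset ι) (φ : ι → TestFn) (t : UnitAddCircle) :
    (∑ i ∈ s, φ i) t = ∑ i ∈ s, φ i t := by
  classical
  induction s using Finset.induction_on with
  | empty => simp
  | insert i s hi ih => simp [Finset.sum_insert hi, ih]

theorem hasDerivAt (φ : TestFn) (t : ℝ) :
    HasDerivAt (fun s : ℝ => φ (s : UnitAddCircle)) (deriv φ (t : UnitAddCircle)) t := by
  have h := (φ.contDiff.differentiable (by simp) t).hasDerivAt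
  rw [← deriv_lift φ t] at h
  exact h

theorem deriv_eq_of_hasDerivAt {φ ψ : TestFn}
    (h : ∀ t : ℝ, HasDerivAt (fun s : ℝ => φ (s : UnitAddCircle)) (ψ (t : UnitAddCircle)) t) :
    deriv φ = ψ := by
  ext t
  obtain ⟨t, rfl⟩ := QuotientAddGroup.mk_surjective t
  exact (φ.hasDerivAt t).unique (h t)

theorem exists_bound (φ : TestFn) : ∃ C : ℝ, 0 ≤ C ∧ ∀ t, ‖φ t‖ ≤ C := by
  obtain ⟨C, hC⟩ := (isCompact_range φ.continuous).isBounded.exists_norm_le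
  exact ⟨C, (norm_nonneg _).trans (hC _ (mem_range_self 0)), fun t => hC _ (mem_range_self t)⟩

/-- Multiplication of test functions. -/
def mul : TestFn →ₗ[ℂ] TestFn →ₗ[ℂ] TestFn :=
  LinearMap.mk₂ ℂ (fun χ φ => ⟨fun t => χ t * φ t, χ.contDiff.mul φ.contDiff⟩)
    (fun _ _ _ => ext fun _ => add_mul _ _ _) (fun _ _ _ => ext fun _ => mul_assoc _ _ _)
    (fun _ _ _ => ext fun _ => mul_add _ _ _) (fun _ _ _ => ext fun _ => mul_left_comm _ _ _)

@[simp] theorem mul_apply (χ φ : TestFn) (t : UnitAddCircle) : mul χ φ t = χ t * φ t := rfl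

theorem mul_comm' (χ φ : TestFn) : mul χ φ = mul φ χ := ext fun _ => mul_comm _ _

theorem deriv_mul (χ φ : TestFn) : deriv (mul χ φ) = mul (deriv χ) φ + mul χ (deriv φ) :=
  deriv_eq_of_hasDerivAt fun t => (χ.hasDerivAt t).mul (φ.hasDerivAt t)

theorem deriv_one : deriv one = 0 := deriv_eq_of_hasDerivAt fun t => hasDerivAt_const t 1

theorem deriv_pow_succ (j : ℕ) (φ : TestFn) : (deriv ^ (j + 1)) φ = (deriv ^ j) (deriv φ) := by
  rw [pow_succ]; rfl

theorem mul_bound (N : ℕ) : ∀ χ : TestFn, ∃ C : ℝ, 0 ≤ C ∧ ∀ (φ : TestFn) (M : ℝ),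
    (∀ j ≤ N, ∀ t, ‖(deriv ^ j) φ t‖ ≤ M) → ∀ j ≤ N, ∀ t, ‖(deriv ^ j) (mul χ φ) t‖ ≤ C * M := by
  have zero_case : ∀ χ : TestFn, ∃ C : ℝ, 0 ≤ C ∧ ∀ (φ : TestFn) (M : ℝ),
      (∀ t, ‖φ t‖ ≤ M) → ∀ t, ‖mul χ φ t‖ ≤ C * M := fun χ => by
    obtain ⟨C, hC, h⟩ := χ.exists_bound
    refine ⟨C, hC, fun φ M hM t => ?_⟩
    rw [mul_apply, norm_mul]
    exact mul_le_mul (h t) (hM t) (norm_nonneg _) hC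
  induction N with
  | zero =>
    intro χ
    obtain ⟨C, hC, h⟩ := zero_case χ
    refine ⟨C, hC, fun φ M hM j hj t => ?_⟩
    obtain rfl : j = 0 := by omega
    exact h φ M (fun t => hM 0 le_rfl t) t
  | succ N ih =>
    intro χ
    obtain ⟨C₀, hC₀, h₀⟩ := zero_case χ
    obtain ⟨C₁, hC₁, h₁⟩ := ih χ
    obtain ⟨C₂, hC₂, h₂⟩ := ih (deriv χ)
    refine ⟨C₀ + (C₁ + C₂), by positivity, fun φ M hM j hj t => ?_⟩
    have hM0 : 0 ≤ M := (norm_nonneg _).trans (hM 0 (by omega) t)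
    rcases j with - | j
    · have := h₀ φ M (fun t => hM 0 (by omega) t) t
      rw [pow_zero]
      refine this.trans ?_
      nlinarith [mul_nonneg hC₁ hM0, mul_nonneg hC₂ hM0]
    · rw [deriv_pow_succ, deriv_mul, map_add, add_apply]
      have e₁ := h₁ (deriv φ) M (fun i hi t => by
        rw [← deriv_pow_succ]; exact hM (i + 1) (by omega) t) j (by omega) t
      have e₂ := h₂ φ M (fun i hi t => hM i (by omega) t) j (by omega) t
      refine (norm_add_le _ _).trans ?_
      nlinarith [mul_nonneg hC₀ hM0]

/-- The integral of a test function over the circle. -/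
def integral : TestFn →ₗ[ℂ] ℂ where
  toFun φ := ∫ t, φ t
  map_add' φ ψ := integral_add (Base.integrable_cont ⟨φ, φ.continuous⟩)
    (Base.integrable_cont ⟨ψ, ψ.continuous⟩)
  map_smul' c _ := integral_const_mul c _

theorem integral_apply (φ : TestFn) : integral φ = ∫ t, φ t := rfl

theorem integral_one : integral one = 1 := by
  simp only [integral_apply, one_apply]
  exact integral_const' 1

theorem norm_integral_le (φ : TestFn) {M : ℝ} (h : ∀ t, ‖φ t‖ ≤ M) : ‖integral φ‖ ≤ M := by
  have := norm_integral_le_of_norm_le_const (μ := (volume : Measure UnitAddCircle)) (f := φ)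
    (Eventually.of_forall h)
  rwa [volume_real_univ, mul_one] at this

/-! Cut-off functions -/

/-- A smooth function on the plane restricted to the unit circle. -/
def ofSmooth (f : ℂ → ℝ) (hf : ContDiff ℝ ∞ f) : TestFn :=
  ⟨fun t => (f (AddCircle.toCircle t : ℂ) : ℂ), by
    change ContDiff ℝ ∞ fun t : ℝ => ((f (AddCircle.toCircle (t : UnitAddCircle) : ℂ) : ℝ) : ℂ)
    refine Complex.ofRealCLM.contDiff.comp (hf.comp ?_)
    simp only [AddCircle.toCircle_apply_mk, Circle.coe_exp]
    have h : ContDiff ℝ ∞ fun t : ℝ => ((2 * Real.pi / 1 * t : ℝ) : ℂ) :=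
      Complex.ofRealCLM.contDiff.comp (contDiff_const.mul contDiff_id)
    exact (h.mul contDiff_const).cexp⟩

theorem ofSmooth_apply (f : ℂ → ℝ) (hf : ContDiff ℝ ∞ f) (t : UnitAddCircle) :
    ofSmooth f hf t = (f (AddCircle.toCircle t : ℂ) : ℂ) := rfl

theorem continuous_toCircle : Continuous fun t : UnitAddCircle => (AddCircle.toCircle t : ℂ) :=
  continuous_subtype_val.comp AddCircle.continuous_toCircle

theorem isClosedEmbedding_toCircle :
    IsClosedEmbedding fun t : UnitAddCircle => (AddCircle.toCircle t : ℂ) :=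
  continuous_toCircle.isClosedEmbedding
    (Subtype.val_injective.comp (AddCircle.injective_toCircle one_ne_zero))

/-- The cut-offs are restrictions of smooth functions on the plane under the closed embedding of the
circle. The nonnegative function `r` is recorded because it makes the integral of a bump nonzero. -/
theorem exists_cutoff {A B : Set UnitAddCircle} (hA : IsClosed A) (hB : IsClosed B)
    (hAB : Disjoint A B) : ∃ θ : TestFn, (∀ᶠ t in 𝓝ˢ A, θ t = 1) ∧ (∀ᶠ t in 𝓝ˢ B, θ t = 0) ∧
      ∃ r : UnitAddCircle → ℝ, ∀ t, θ t = r t ∧ 0 ≤ r t := by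
  have he := isClosedEmbedding_toCircle
  obtain ⟨f, hfB, hfA, hf⟩ := exists_contMDiffMap_zero_one_nhds_of_isClosed (n := ⊤)
    (modelWithCornersSelf ℝ ℂ) (he.isClosedMap _ hB) (he.isClosedMap _ hA)
    ((disjoint_image_iff he.injective).2 hAB.symm)
  refine ⟨ofSmooth f f.contMDiff.contDiff, ?_, ?_, fun t => f (AddCircle.toCircle t : ℂ),
    fun t => ⟨rfl, (hf _).1⟩⟩
  · have h1 : Tendsto (fun t : UnitAddCircle => (AddCircle.toCircle t : ℂ)) (𝓝ˢ A)
        (𝓝ˢ ((fun t : UnitAddCircle => (AddCircle.toCircle t : ℂ)) '' A)) :=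
      continuous_toCircle.tendsto_nhdsSet (mapsTo_image _ _)
    filter_upwards [h1.eventually hfA] with t ht
    rw [ofSmooth_apply, ht, Complex.ofReal_one]
  · have h1 : Tendsto (fun t : UnitAddCircle => (AddCircle.toCircle t : ℂ)) (𝓝ˢ B)
        (𝓝ˢ ((fun t : UnitAddCircle => (AddCircle.toCircle t : ℂ)) '' B)) :=
      continuous_toCircle.tendsto_nhdsSet (mapsTo_image _ _)
    filter_upwards [h1.eventually hfB] with t ht
    rw [ofSmooth_apply, ht, Complex.ofReal_zero]

theorem exists_partition {ι : Type} [Fintype ι] (U : ι → Set UnitAddCircle)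
    (hU : ∀ i, IsOpen (U i)) (hc : ⋃ i, U i = univ) :
    ∃ χ : ι → TestFn, ∑ i, χ i = one ∧ ∀ i, tsupport (χ i) ⊆ U i := by
  have he := isClosedEmbedding_toCircle
  choose V hV hVU using fun i => he.isInducing.isOpen_iff.1 (hU i)
  obtain ⟨f, hf⟩ := SmoothPartitionOfUnity.exists_isSubordinate (modelWithCornersSelf ℝ ℂ)
    he.isClosed_range V hV (by
      rintro _ ⟨t, rfl⟩
      obtain ⟨i, hi⟩ := mem_iUnion.1 (hc.symm ▸ mem_univ t : t ∈ ⋃ i, U i)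
      rw [← hVU i] at hi
      exact mem_iUnion.2 ⟨i, hi⟩)
  refine ⟨fun i => ofSmooth (f i) (f i).contMDiff.contDiff, ?_, fun i => ?_⟩
  · ext t
    have := f.sum_eq_one (mem_range_self t)
    rw [finsum_eq_sum_of_fintype] at this
    rw [sum_apply, one_apply]
    simp only [ofSmooth_apply]
    rw [← Complex.ofReal_sum, this, Complex.ofReal_one]
  · rw [← hVU i]
    refine Subset.trans ?_ (preimage_mono (hf i))
    refine closure_minimal (fun t ht => ?_) ((isClosed_tsupport _).preimage continuous_toCircle)
    refine subset_tsupport _ ?_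
    intro h0
    refine ht ?_
    rw [ofSmooth_apply, h0, Complex.ofReal_zero]

theorem tsupport_mul_subset_left (χ φ : TestFn) : tsupport (mul χ φ) ⊆ tsupport χ :=
  closure_mono fun t ht h0 => ht (by rw [mul_apply, h0, zero_mul])

theorem tsupport_mul_subset_right (χ φ : TestFn) : tsupport (mul χ φ) ⊆ tsupport φ := by
  rw [mul_comm']; exact tsupport_mul_subset_left φ χ

theorem tsupport_deriv_subset (φ : TestFn) : tsupport (deriv φ) ⊆ tsupport φ := by
  refine closure_minimal (fun s hs => ?_) (isClosed_tsupport φ)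
  by_contra hns
  refine hs ?_
  have h0 := notMem_tsupport_iff_eventuallyEq.1 hns
  have hc : Tendsto (fun r : ℝ => s + (r : UnitAddCircle)) (𝓝 0) (𝓝 s) := by
    have : Continuous fun r : ℝ => s + (r : UnitAddCircle) :=
      continuous_const.add (AddCircle.continuous_mk' 1)
    simpa using this.tendsto 0
  have h1 : (fun r : ℝ => φ (s + (r : UnitAddCircle))) =ᶠ[𝓝 0] fun _ => (0 : ℂ) :=
    hc.eventually h0
  change _root_.deriv (fun r : ℝ => φ (s + (r : UnitAddCircle))) 0 = 0
  rw [h1.deriv_eq, deriv_const]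

theorem mul_eq_zero_of_disjoint {χ φ : TestFn} (h : Disjoint (tsupport χ) (tsupport φ)) :
    mul χ φ = 0 := by
  ext t
  by_cases ht : t ∈ tsupport χ
  · rw [mul_apply, image_eq_zero_of_notMem_tsupport (h.notMem_of_mem_left ht), mul_zero, zero_apply]
  · rw [mul_apply, image_eq_zero_of_notMem_tsupport ht, zero_mul, zero_apply]

theorem mul_one' (χ : TestFn) : mul χ one = χ := ext fun t => by simp

theorem one_mul' (χ : TestFn) : mul one χ = χ := ext fun t => by simp

theorem mul_mul (χ ψ φ : TestFn) : mul χ (mul ψ φ) = mul (mul χ ψ) φ :=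
  ext fun t => by simp [mul_assoc]

end TestFn

/-! ### Primitives on the circle -/

/-- Here h is merely integrable, so integration by parts is derived from Fubini's theorem for φ'(t)
h(s) on the triangle s ≤ t. -/
theorem integral_primitive_mul_deriv {h φ φ' : ℝ → ℂ} (hh : IntervalIntegrable h volume 0 1)
    (hφ : ∀ t, HasDerivAt φ (φ' t) t) (hφ' : Continuous φ') :
    ∫ t in (0 : ℝ)..1, (∫ s in (0 : ℝ)..t, h s) * φ' t =
      (∫ t in (0 : ℝ)..1, h t) * φ 1 - ∫ t in (0 : ℝ)..1, h t * φ t := by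
  set μ := (volume : Measure ℝ).restrict (Ioc 0 1) with hμ
  have hI : Integrable h μ := (intervalIntegrable_iff_integrableOn_Ioc_of_le zero_le_one).1 hh
  have hφc : Continuous φ := continuous_iff_continuousAt.2 fun t => (hφ t).continuousAt
  have hφI : Integrable φ' μ :=
    (intervalIntegrable_iff_integrableOn_Ioc_of_le zero_le_one).1 (hφ'.intervalIntegrable 0 1)
  set k : ℝ × ℝ → ℂ := {p : ℝ × ℝ | p.2 ≤ p.1}.indicator fun p => φ' p.1 * h p.2 with hk
  have hkI : Integrable k (μ.prod μ) :=
    (hφI.mul_prod hI).indicator (measurableSet_le measurable_snd measurable_fst)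
  have key := integral_integral_swap (f := fun t s => k (t, s)) hkI
  have e₁ : ∫ t, ∫ s, k (t, s) ∂μ ∂μ = ∫ t in (0 : ℝ)..1, (∫ s in (0 : ℝ)..t, h s) * φ' t := by
    rw [intervalIntegral.integral_of_le zero_le_one]
    refine setIntegral_congr_fun measurableSet_Ioc fun t ht => ?_
    have : (fun s => k (t, s)) = (Iic t).indicator fun s => φ' t * h s := by
      ext s; rfl
    simp only [this]
    rw [integral_indicator measurableSet_Iic, hμ, Measure.restrict_restrict measurableSet_Iic,
      integral_const_mul, mul_comm, intervalIntegral.integral_of_le ht.1.le]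
    congr 3
    ext s
    constructor
    · rintro ⟨h1, h2⟩; exact ⟨h2.1, h1⟩
    · rintro ⟨h1, h2⟩; exact ⟨h2, h1, h2.trans ht.2⟩
  have e₂ : ∫ s, ∫ t, k (t, s) ∂μ ∂μ = ∫ s in (0 : ℝ)..1, (φ 1 - φ s) * h s := by
    rw [intervalIntegral.integral_of_le zero_le_one]
    refine setIntegral_congr_fun measurableSet_Ioc fun s hs => ?_
    have : (fun t => k (t, s)) = (Ici s).indicator fun t => φ' t * h s := by
      ext t; rfl
    simp only [this]
    rw [integral_indicator measurableSet_Ici, hμ, Measure.restrict_restrict measurableSet_Ici,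
      integral_mul_const]
    have h1 : Ici s ∩ Ioc 0 1 = Icc s 1 := by
      ext t
      constructor
      · rintro ⟨h1, h2⟩; exact ⟨h1, h2.2⟩
      · rintro ⟨h1, h2⟩; exact ⟨h1, hs.1.trans_le h1, h2⟩
    rw [h1, integral_Icc_eq_integral_Ioc, ← intervalIntegral.integral_of_le hs.2,
      intervalIntegral.integral_eq_sub_of_hasDerivAt (fun t _ => hφ t)
        (hφ'.intervalIntegrable _ _)]
  rw [e₁, e₂] at key
  rw [key]
  simp only [sub_mul]
  rw [intervalIntegral.integral_sub, intervalIntegral.integral_const_mul]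
  · simp only [mul_comm]
  · exact hh.const_mul _
  · exact hh.continuousOn_mul hφc.continuousOn

section Primitive

variable {f : UnitAddCircle → ℂ}

theorem intervalIntegrable_lift (hf : Integrable f) (a b : ℝ) :
    IntervalIntegrable (fun t : ℝ => f (t : UnitAddCircle)) volume a b := by
  have h0 : IntervalIntegrable (fun t : ℝ => f (t : UnitAddCircle)) volume 0 (0 + 1) := by
    rw [intervalIntegrable_iff_integrableOn_Ioc_of_le (by norm_num)]
    exact (UnitAddCircle.measurePreserving_mk 0).integrable_comp_of_integrable hf
  refine Function.Periodic.intervalIntegrable (T := 1) (fun t => ?_) one_ne_zero (t := 0) h0 a b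
  simp

/-- The function `t ↦ ∫₀ᵗ (f - ∫ f)` on the line. -/
def primLift (f : UnitAddCircle → ℂ) (t : ℝ) : ℂ :=
  ∫ s in (0 : ℝ)..t, (f (s : UnitAddCircle) - ∫ x, f x)

theorem intervalIntegrable_sub_mean (hf : Integrable f) (a b : ℝ) :
    IntervalIntegrable (fun t : ℝ => f (t : UnitAddCircle) - ∫ x, f x) volume a b :=
  (intervalIntegrable_lift hf a b).sub intervalIntegrable_const

theorem integral_sub_mean (hf : Integrable f) (a : ℝ) :
    ∫ s in a..(a + 1), (f (s : UnitAddCircle) - ∫ x, f x) = 0 := by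
  rw [intervalIntegral.integral_sub (intervalIntegrable_lift hf _ _) intervalIntegrable_const,
    UnitAddCircle.intervalIntegral_preimage]
  simp

theorem primLift_periodic (hf : Integrable f) : Function.Periodic (primLift f) 1 := by
  intro t
  rw [primLift, primLift, ← intervalIntegral.integral_add_adjacent_intervals
    (intervalIntegrable_sub_mean hf 0 t) (intervalIntegrable_sub_mean hf t (t + 1)),
    integral_sub_mean hf, add_zero]

theorem continuous_primLift (hf : Integrable f) : Continuous (primLift f) :=
  intervalIntegral.continuous_primitive (fun a b => intervalIntegrable_sub_mean hf a b) 0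

/-- The primitive of `f - ∫ f` that vanishes at `0`. -/
def prim (f : UnitAddCircle → ℂ) (hf : Integrable f) : C(UnitAddCircle, ℂ) :=
  ⟨(primLift_periodic hf).lift, (QuotientAddGroup.isQuotientMap_mk
    (N := AddSubgroup.zmultiples (1 : ℝ))).continuous_iff.2 (continuous_primLift hf)⟩

theorem prim_coe (hf : Integrable f) (t : ℝ) : prim f hf (t : UnitAddCircle) = primLift f t := rfl

theorem prim_congr {g : UnitAddCircle → ℂ} (hf : Integrable f) (hg : Integrable g)
    (h : f =ᵐ[volume] g) : prim f hf = prim g hg := by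
  ext t
  obtain ⟨t, rfl⟩ := QuotientAddGroup.mk_surjective t
  change primLift f t = primLift g t
  have h1 : (fun t : ℝ => f (t : UnitAddCircle)) =ᵐ[volume] fun t => g (t : UnitAddCircle) := by
    -- The quotient map is measure preserving on each interval (n, n + 1], and countably many of
    -- these cover the line.
    have : ∀ n : ℤ, ∀ᵐ t : ℝ ∂(volume.restrict (Ioc (n : ℝ) (n + 1))),
        f (t : UnitAddCircle) = g (t : UnitAddCircle) := fun n =>
      (UnitAddCircle.measurePreserving_mk (n : ℝ)).quasiMeasurePreserving.ae_eq_comp h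
    have h2 := (ae_restrict_iUnion_iff (fun n : ℤ => Ioc (n : ℝ) (n + 1)) _).2 this
    rw [iUnion_Ioc_intCast, Measure.restrict_univ] at h2
    exact h2
  rw [primLift, primLift, integral_congr_ae h]
  refine intervalIntegral.integral_congr_ae ?_
  filter_upwards [h1] with s hs _
  rw [hs]

theorem prim_add {g : UnitAddCircle → ℂ} (hf : Integrable f) (hg : Integrable g) :
    prim (f + g) (hf.add hg) = prim f hf + prim g hg := by
  ext t
  obtain ⟨t, rfl⟩ := QuotientAddGroup.mk_surjective t
  change primLift (f + g) t = primLift f t + primLift g t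
  rw [primLift, primLift, primLift, ← intervalIntegral.integral_add
    (intervalIntegrable_sub_mean hf _ _) (intervalIntegrable_sub_mean hg _ _)]
  have : ∫ x, (f + g) x = (∫ x, f x) + ∫ x, g x := integral_add hf hg
  rw [this]
  refine intervalIntegral.integral_congr fun s _ => ?_
  simp only [Pi.add_apply]
  ring

theorem prim_smul (c : ℂ) (hf : Integrable f) :
    prim (c • f) (hf.smul c) = c • prim f hf := by
  ext t
  obtain ⟨t, rfl⟩ := QuotientAddGroup.mk_surjective t
  change primLift (c • f) t = c * primLift f t
  rw [primLift, primLift, ← intervalIntegral.integral_const_mul]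
  have : ∫ x, (c • f) x = c * ∫ x, f x := integral_const_mul c f
  rw [this]
  refine intervalIntegral.integral_congr fun s _ => ?_
  simp only [Pi.smul_apply, smul_eq_mul]
  ring

theorem norm_prim_le (hf : Integrable f) : ‖prim f hf‖ ≤ 2 * ∫ x, ‖f x‖ := by
  have hnn : 0 ≤ ∫ x, ‖f x‖ := integral_nonneg fun _ => norm_nonneg _
  refine (ContinuousMap.norm_le _ (by positivity)).2 fun t => ?_
  obtain ⟨t, ht, rfl⟩ : ∃ s ∈ Ico (0 : ℝ) (0 + 1), (s : UnitAddCircle) = t :=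
    ⟨_, (AddCircle.equivIco 1 0 t).2, AddCircle.coe_equivIco⟩
  rw [prim_coe, primLift]
  rw [zero_add] at ht
  have hI := (intervalIntegrable_sub_mean hf 0 1).norm
  refine (intervalIntegral.norm_integral_le_integral_norm ht.1).trans ?_
  refine (intervalIntegral.integral_mono_interval le_rfl ht.1 ht.2.le
    (Eventually.of_forall fun _ => norm_nonneg _) hI).trans ?_
  refine (intervalIntegral.integral_mono_on zero_le_one hI
    (((intervalIntegrable_lift hf 0 1).norm).add intervalIntegrable_const)
    (fun s _ => norm_sub_le _ _)).trans ?_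
  rw [intervalIntegral.integral_add ((intervalIntegrable_lift hf 0 1).norm)
    intervalIntegrable_const]
  have := UnitAddCircle.intervalIntegral_preimage 0 (fun x => ‖f x‖)
  rw [zero_add] at this
  rw [this]
  have := norm_integral_le_integral_norm f (μ := volume)
  simp only [intervalIntegral.integral_const, sub_zero, one_smul]
  linarith

theorem integral_prim_mul_deriv (hf : Integrable f) (φ : TestFn) :
    ∫ t, prim f hf t * TestFn.deriv φ t = -∫ t, (f t - ∫ x, f x) * φ t := by
  rw [← UnitAddCircle.intervalIntegral_preimage 0, ← UnitAddCircle.intervalIntegral_preimage 0,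
    zero_add]
  have := integral_primitive_mul_deriv (intervalIntegrable_sub_mean hf 0 1) φ.hasDerivAt
    (TestFn.deriv φ).contDiff.continuous
  have h0 := integral_sub_mean hf 0
  rw [zero_add] at h0
  rw [h0, zero_mul, zero_sub] at this
  exact this

theorem ofIntegrable_prim (hf : Integrable f) :
    Distr.deriv (Distr.ofIntegrable (prim f hf) (Base.integrable_cont _)) =
      Distr.ofIntegrable f hf - Distr.const (∫ x, f x) := by
  apply Subtype.ext
  apply LinearMap.ext
  intro φ
  change -(∫ t, prim f hf t * TestFn.deriv φ t) = (∫ t, f t * φ t) - ∫ t, (∫ x, f x) * φ t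
  rw [integral_prim_mul_deriv, neg_neg, ← integral_sub (Distr.integrable_mul f hf φ)
    (Distr.integrable_mul _ (integrable_const _) φ)]
  simp only [sub_mul]

end Primitive

/-! ### Primitives of test functions -/

namespace TestFn

theorem integrable (φ : TestFn) : Integrable φ := Base.integrable_cont ⟨φ, φ.continuous⟩

theorem hasDerivAt_primLift (φ : TestFn) (t : ℝ) :
    HasDerivAt (primLift φ) (φ (t : UnitAddCircle) - integral φ) t := by
  have hc : Continuous fun s : ℝ => φ (s : UnitAddCircle) - ∫ x, φ x :=
    φ.contDiff.continuous.sub continuous_const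
  exact intervalIntegral.integral_hasDerivAt_right (hc.intervalIntegrable _ _)
    (hc.stronglyMeasurableAtFilter _ _) hc.continuousAt

/-- The primitive of `φ - ∫ φ` that vanishes at `0`, as a test function. -/
def primTest (φ : TestFn) : TestFn := ⟨fun t => prim φ φ.integrable t, by
  change ContDiff ℝ ∞ (primLift φ)
  refine contDiff_infty_iff_deriv.2 ⟨fun t => (φ.hasDerivAt_primLift t).differentiableAt, ?_⟩
  rw [funext fun t => (φ.hasDerivAt_primLift t).deriv]
  exact φ.contDiff.sub contDiff_const⟩

theorem primTest_apply (φ : TestFn) (t : UnitAddCircle) :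
    primTest φ t = prim φ φ.integrable t := rfl

/-- The primitive of `φ - ∫ φ` with mean `0`. -/
def primitive : TestFn →ₗ[ℂ] TestFn where
  toFun φ := primTest φ - (∫ t, prim φ φ.integrable t) • one
  map_add' φ ψ := by
    ext t
    have h : prim (φ + ψ : TestFn) (φ + ψ).integrable = prim φ φ.integrable + prim ψ ψ.integrable :=
      prim_add φ.integrable ψ.integrable
    simp only [sub_apply, add_apply, smul_apply, one_apply, mul_one, primTest_apply]
    rw [h]
    simp only [ContinuousMap.add_apply]
    rw [integral_add (Base.integrable_cont _) (Base.integrable_cont _)]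
    ring
  map_smul' c φ := by
    ext t
    have h : prim (c • φ : TestFn) (c • φ).integrable = c • prim φ φ.integrable :=
      prim_smul c φ.integrable
    simp only [sub_apply, smul_apply, one_apply, mul_one, RingHom.id_apply, primTest_apply]
    rw [h]
    simp only [ContinuousMap.smul_apply, smul_eq_mul]
    rw [integral_const_mul]
    ring

theorem primitive_apply (φ : TestFn) (t : UnitAddCircle) :
    primitive φ t = prim φ φ.integrable t - ∫ t, prim φ φ.integrable t := by
  change prim φ φ.integrable t - (∫ t, prim φ φ.integrable t) * 1 = _
  rw [mul_one]

theorem deriv_primitive (φ : TestFn) : deriv (primitive φ) = φ - integral φ • one := by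
  refine deriv_eq_of_hasDerivAt fun t => ?_
  have : (fun s : ℝ => primitive φ (s : UnitAddCircle)) =
      fun s : ℝ => primLift φ s - ∫ t, prim φ φ.integrable t := funext fun s => primitive_apply φ s
  rw [this, sub_apply, smul_apply, one_apply, mul_one]
  exact (φ.hasDerivAt_primLift t).sub_const _

theorem integral_primitive (φ : TestFn) : integral (primitive φ) = 0 := by
  simp only [integral_apply, primitive_apply]
  rw [integral_sub (Base.integrable_cont _) (integrable_const _), integral_const', sub_self]

theorem integral_deriv (φ : TestFn) : integral (deriv φ) = 0 := by
  rw [integral_apply, ← UnitAddCircle.intervalIntegral_preimage 0,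
    intervalIntegral.integral_eq_sub_of_hasDerivAt (fun t _ => φ.hasDerivAt t)
      ((deriv φ).contDiff.continuous.intervalIntegrable _ _)]
  rw [zero_add, AddCircle.coe_period, AddCircle.coe_zero, sub_self]

theorem eq_const_of_deriv_eq_zero {φ : TestFn} (h : deriv φ = 0) : φ = integral φ • one := by
  have hc : ∀ t : ℝ, φ (t : UnitAddCircle) = φ ((0 : ℝ) : UnitAddCircle) := fun t =>
    is_const_of_deriv_eq_zero (f := fun s : ℝ => φ (s : UnitAddCircle))
      (fun s => (φ.hasDerivAt s).differentiableAt)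
      (fun s => by rw [(φ.hasDerivAt s).deriv, h, zero_apply]) t 0
  have h1 : ∀ t, φ t = φ ((0 : ℝ) : UnitAddCircle) := fun t => by
    obtain ⟨t, rfl⟩ := QuotientAddGroup.mk_surjective t
    exact hc t
  ext t
  rw [smul_apply, one_apply, mul_one, h1 t, integral_apply]
  simp only [h1]
  rw [integral_const']

theorem primitive_deriv (φ : TestFn) : primitive (deriv φ) = φ - integral φ • one := by
  have h : deriv (primitive (deriv φ) - φ) = 0 := by
    rw [map_sub, deriv_primitive, integral_deriv, zero_smul, sub_zero, sub_self]
  have h2 := eq_const_of_deriv_eq_zero h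
  rw [map_sub, integral_primitive, zero_sub, neg_smul] at h2
  rw [sub_eq_iff_eq_add.1 h2]
  abel

theorem norm_primitive_le (φ : TestFn) {M : ℝ} (h : ∀ t, ‖φ t‖ ≤ M) (t : UnitAddCircle) :
    ‖primitive φ t‖ ≤ 4 * M := by
  have h1 : ∫ t, ‖φ t‖ ≤ M := by
    have := integral_mono φ.integrable.norm (integrable_const M) h
    rwa [integral_const, volume_real_univ, one_smul] at this
  have h2 : ∀ t, ‖prim φ φ.integrable t‖ ≤ 2 * M := fun t =>
    ((ContinuousMap.norm_coe_le_norm _ t).trans (norm_prim_le _)).trans (by linarith)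
  have h3 := norm_integral_le_of_norm_le_const (μ := (volume : Measure UnitAddCircle))
    (Eventually.of_forall h2)
  rw [volume_real_univ, mul_one] at h3
  rw [primitive_apply]
  refine (norm_sub_le _ _).trans ?_
  linarith [h2 t]

end TestFn

/-! ### Fine partitions of unity and bumps of integral one -/

namespace TestFn

theorem exists_fine_partition (V : UnitAddCircle → Set UnitAddCircle) (hV : ∀ t, IsOpen (V t))
    (hmem : ∀ t, t ∈ V t) : ∃ (ι : Type) (_ : Fintype ι) (_ : DecidableEq ι) (χ : ι → TestFn),
      ∑ i, χ i = one ∧ ∀ i, ∃ t, tsupport (χ i) ⊆ V t := by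
  classical
  obtain ⟨T, -, hT⟩ := (isCompact_univ (X := UnitAddCircle)).elim_nhds_subcover V
    fun t _ => (hV t).mem_nhds (hmem t)
  obtain ⟨χ, h1, h2⟩ := exists_partition (ι := T) (fun i => V i) (fun i => hV i) (by
    refine eq_univ_of_forall fun t => ?_
    obtain ⟨s, hs, hst⟩ := mem_iUnion₂.1 (hT (mem_univ t))
    exact mem_iUnion.2 ⟨⟨s, hs⟩, hst⟩)
  exact ⟨T, inferInstance, inferInstance, χ, h1, fun i => ⟨i, h2 i⟩⟩

theorem tsupport_subset_of_eventually {θ : TestFn} {U : Set UnitAddCircle}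
    (h : ∀ᶠ t in 𝓝ˢ Uᶜ, θ t = 0) : tsupport θ ⊆ U := by
  intro t ht
  by_contra hU
  exact (notMem_tsupport_iff_eventuallyEq.2
    ((eventually_nhdsSet_iff_forall.1 h) t hU)) ht

theorem exists_bump {U : Set UnitAddCircle} (hU : IsOpen U) {t : UnitAddCircle} (ht : t ∈ U) :
    ∃ e : TestFn, tsupport e ⊆ U ∧ integral e = 1 := by
  obtain ⟨θ, h1, h0, r, hr⟩ := exists_cutoff (A := {t}) (B := Uᶜ) isClosed_singleton
    hU.isClosed_compl (disjoint_singleton_left.2 fun h => h ht)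
  have hrc : Continuous r := by
    have : r = fun t => (θ t).re := funext fun t => by rw [(hr t).1, Complex.ofReal_re]
    rw [this]
    exact Complex.continuous_re.comp θ.continuous
  have hpos : 0 < ∫ t, r t := by
    refine hrc.integral_pos_of_hasCompactSupport_nonneg_nonzero
      (HasCompactSupport.of_compactSpace r) (fun t => (hr t).2) (x := t) fun h => ?_
    have := (eventually_nhdsSet_iff_forall.1 h1 t rfl).self_of_nhds
    rw [(hr t).1, h] at this
    simp at this
  have hint : integral θ = ((∫ t, r t : ℝ) : ℂ) := by
    simp only [integral_apply, (hr _).1]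
    exact integral_ofReal
  refine ⟨(integral θ)⁻¹ • θ, ?_, ?_⟩
  · refine Subset.trans ?_ (tsupport_subset_of_eventually h0)
    exact closure_mono fun s hs h => hs (by rw [smul_apply, h, mul_zero])
  · rw [map_smul, smul_eq_mul, inv_mul_cancel₀]
    rw [hint]
    exact_mod_cast hpos.ne'

end TestFn

/-! ### Operations on distributions -/

namespace Distr

@[ext] theorem ext {u v : Distr} (h : ∀ φ, u.1 φ = v.1 φ) : u = v :=
  Subtype.ext (LinearMap.ext h)

theorem add_apply (u v : Distr) (φ : TestFn) : (u + v).1 φ = u.1 φ + v.1 φ := rfl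

theorem sub_apply (u v : Distr) (φ : TestFn) : (u - v).1 φ = u.1 φ - v.1 φ := rfl

theorem smul_apply (c : ℂ) (u : Distr) (φ : TestFn) : (c • u).1 φ = c * u.1 φ := rfl

theorem deriv_apply (u : Distr) (φ : TestFn) : (deriv u).1 φ = -u.1 (TestFn.deriv φ) := rfl

/-- Evaluation at a test function. -/
def pair (φ : TestFn) : Distr →ₗ[ℂ] ℂ := (LinearMap.applyₗ φ).comp Distr.subtype

theorem integral_eq_pair (u : Distr) : integral u = pair TestFn.one u := rfl

/-- The product of a distribution with a test function. -/
def mulAux (χ : TestFn) (u : Distr) : Distr := ⟨u.1.comp (TestFn.mul χ), by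
  obtain ⟨N, C, hC, h⟩ := u.2
  obtain ⟨C', hC', h'⟩ := TestFn.mul_bound N χ
  refine ⟨N, C * C', mul_nonneg hC hC', fun φ M hM => ?_⟩
  rw [mul_assoc]
  exact h _ _ (h' φ M hM)⟩

/-- The product of a distribution with a test function. -/
def mul : TestFn →ₗ[ℂ] Distr →ₗ[ℂ] Distr :=
  LinearMap.mk₂ ℂ mulAux
    (fun χ ψ u => ext fun φ => by
      change u.1 (TestFn.mul (χ + ψ) φ) = u.1 (TestFn.mul χ φ) + u.1 (TestFn.mul ψ φ)
      rw [map_add, LinearMap.add_apply, map_add])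
    (fun c χ u => ext fun φ => by
      change u.1 (TestFn.mul (c • χ) φ) = c * u.1 (TestFn.mul χ φ)
      rw [map_smul, LinearMap.smul_apply, map_smul, smul_eq_mul])
    (fun _ _ _ => rfl) (fun _ _ _ => rfl)

theorem mul_apply (χ : TestFn) (u : Distr) (φ : TestFn) :
    (mul χ u).1 φ = u.1 (TestFn.mul χ φ) := rfl

theorem mul_one (u : Distr) : mul TestFn.one u = u := ext fun φ => by
  rw [mul_apply, TestFn.one_mul']

theorem deriv_mul (χ : TestFn) (u : Distr) :
    deriv (mul χ u) = mul (TestFn.deriv χ) u + mul χ (deriv u) := ext fun φ => by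
  rw [deriv_apply, mul_apply, add_apply, mul_apply, mul_apply, deriv_apply, TestFn.deriv_mul,
    map_add]
  ring

theorem mul_deriv (χ : TestFn) (u : Distr) :
    mul χ (deriv u) = deriv (mul χ u) - mul (TestFn.deriv χ) u := by
  rw [deriv_mul]; abel

/-- The test function `χ` regarded as a distribution. -/
def ofTest : TestFn →ₗ[ℂ] Distr where
  toFun χ := ofIntegrable χ χ.integrable
  map_add' _ _ := ofIntegrable_add _ _ _ _ _ _ (Eventually.of_forall fun _ => rfl)
  map_smul' c _ := ofIntegrable_smul c _ _ _ _ (Eventually.of_forall fun _ => rfl)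

theorem ofTest_apply (χ φ : TestFn) : (ofTest χ).1 φ = TestFn.integral (TestFn.mul χ φ) := rfl

theorem const_eq (c : ℂ) : const c = c • ofTest TestFn.one :=
  ofIntegrable_smul c _ _ TestFn.one.integrable _ (Eventually.of_forall fun t => by simp)

theorem mul_ofTest (χ ψ : TestFn) : mul χ (ofTest ψ) = ofTest (TestFn.mul χ ψ) := ext fun φ => by
  rw [mul_apply, ofTest_apply, ofTest_apply, TestFn.mul_mul, TestFn.mul_comm' ψ χ]

theorem mul_ofTest_one (χ : TestFn) : mul χ (ofTest TestFn.one) = ofTest χ := by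
  rw [mul_ofTest, TestFn.mul_one']

theorem deriv_ofTest (χ : TestFn) : deriv (ofTest χ) = ofTest (TestFn.deriv χ) := ext fun φ => by
  rw [deriv_apply, ofTest_apply, ofTest_apply]
  have h := TestFn.integral_deriv (TestFn.mul χ φ)
  rw [TestFn.deriv_mul, map_add] at h
  rw [eq_neg_of_add_eq_zero_left h]

theorem deriv_pow_succ (j : ℕ) (u : Distr) : (deriv ^ (j + 1)) u = (deriv ^ j) (deriv u) := by
  rw [pow_succ]; rfl

theorem deriv_pow_succ' (j : ℕ) (u : Distr) : (deriv ^ (j + 1)) u = deriv ((deriv ^ j) u) := by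
  rw [pow_succ']; rfl

theorem deriv_one : deriv (ofTest TestFn.one) = 0 := by
  rw [deriv_ofTest, TestFn.deriv_one, map_zero]

theorem deriv_const (c : ℂ) : deriv (const c) = 0 := by
  rw [const_eq, map_smul, deriv_one, smul_zero]

theorem integral_ofTest (χ : TestFn) : integral (ofTest χ) = TestFn.integral χ := by
  change TestFn.integral (TestFn.mul χ TestFn.one) = _
  rw [TestFn.mul_one']

theorem integral_deriv (u : Distr) : integral (deriv u) = 0 := by
  rw [integral, deriv_apply, TestFn.deriv_one, map_zero, neg_zero]

/-- The primitive of `u - ∫ u` with mean `0`. -/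
def primitive : Distr →ₗ[ℂ] Distr where
  toFun u := ⟨-(u.1.comp TestFn.primitive), by
    obtain ⟨N, C, hC, h⟩ := u.2
    refine ⟨N, C * 4, by positivity, fun φ M hM => ?_⟩
    change ‖-(u.1 (TestFn.primitive φ))‖ ≤ _
    rw [norm_neg, mul_assoc]
    have hM0 : 0 ≤ M := (norm_nonneg _).trans (hM 0 (Nat.zero_le _) 0)
    have hφ : ∀ t, ‖φ t‖ ≤ M := fun t => hM 0 (Nat.zero_le _) t
    refine h _ _ fun j hj t => ?_
    rcases j with - | - | j
    · exact TestFn.norm_primitive_le φ hφ t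
    · rw [pow_one, TestFn.deriv_primitive, TestFn.sub_apply, TestFn.smul_apply, TestFn.one_apply,
        _root_.mul_one]
      refine (norm_sub_le _ _).trans ?_
      linarith [hφ t, φ.norm_integral_le hφ]
    · rw [TestFn.deriv_pow_succ, TestFn.deriv_primitive, map_sub, map_smul,
        TestFn.deriv_pow_succ j TestFn.one, TestFn.deriv_one, map_zero, smul_zero, sub_zero]
      linarith [hM (j + 1) (by omega) t]⟩
  map_add' u v := ext fun φ => by
    change -(u.1 _ + v.1 _) = -u.1 _ + -v.1 _
    ring
  map_smul' c u := ext fun φ => by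
    change -(c * u.1 _) = c * -u.1 _
    ring

theorem primitive_apply (u : Distr) (φ : TestFn) :
    (primitive u).1 φ = -u.1 (TestFn.primitive φ) := rfl

theorem deriv_primitive (u : Distr) :
    deriv (primitive u) = u - integral u • ofTest TestFn.one := ext fun φ => by
  rw [deriv_apply, primitive_apply, TestFn.primitive_deriv, sub_apply, smul_apply, ofTest_apply,
    TestFn.one_mul', map_sub, map_smul, neg_neg, smul_eq_mul, integral]
  ring

theorem primitive_deriv (u : Distr) :
    primitive (deriv u) = u - integral u • ofTest TestFn.one := ext fun φ => by
  rw [primitive_apply, deriv_apply, TestFn.deriv_primitive, sub_apply, smul_apply, ofTest_apply,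
    TestFn.one_mul', map_sub, map_smul, neg_neg, smul_eq_mul, integral]
  ring

theorem eq_const_of_deriv_eq_zero {u : Distr} (h : deriv u = 0) : u = const (integral u) := by
  have := primitive_deriv u
  rw [h, map_zero] at this
  rw [const_eq]
  exact (sub_eq_zero.1 this.symm)

/-- Both sides have the same derivative, so they differ by a constant, and both have mean zero. -/
theorem primitive_ofTest (χ : TestFn) : primitive (ofTest χ) = ofTest (TestFn.primitive χ) := by
  have h1 : deriv (primitive (ofTest χ) - ofTest (TestFn.primitive χ)) = 0 := by
    rw [map_sub, deriv_primitive, deriv_ofTest, TestFn.deriv_primitive, map_sub, map_smul,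
      integral_ofTest, sub_self]
  have h2 := eq_const_of_deriv_eq_zero h1
  have h3 : integral (primitive (ofTest χ) - ofTest (TestFn.primitive χ)) = 0 := by
    rw [integral_eq_pair, map_sub, ← integral_eq_pair, ← integral_eq_pair, integral_ofTest,
      TestFn.integral_primitive, integral, primitive_apply, sub_zero]
    have : TestFn.primitive TestFn.one = 0 := by
      have hh := TestFn.eq_const_of_deriv_eq_zero (φ := TestFn.primitive TestFn.one) (by
        rw [TestFn.deriv_primitive, TestFn.integral_one, one_smul, sub_self])
      rwa [TestFn.integral_primitive, zero_smul] at hh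
    rw [this, map_zero, neg_zero]
  rw [h3, const_eq, zero_smul] at h2
  exact sub_eq_zero.1 h2

/-! Supports -/

theorem isClosed_supp (u : Distr) : IsClosed (supp u) := Distribution.isClosed_dsupport

/-- A partition of unity cuts φ into pieces which are zero or are supported in open sets on which u
vanishes. -/
theorem apply_eq_zero {u : Distr} {φ : TestFn} (h : Disjoint (tsupport φ) (supp u)) :
    u.1 φ = 0 := by
  classical
  have hV : ∀ t, ∃ V : Set UnitAddCircle, IsOpen V ∧ t ∈ V ∧
      ∀ χ : TestFn, tsupport χ ⊆ V → u.1 (TestFn.mul χ φ) = 0 := fun t => by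
    by_cases ht : t ∈ tsupport φ
    · obtain ⟨s, h1, h2, h3⟩ := (Distribution.notMem_dsupport_iff t).1 (h.notMem_of_mem_left ht)
      exact ⟨s, h2, h3, fun χ hχ => h1 _ ((TestFn.tsupport_mul_subset_left χ φ).trans hχ)⟩
    · refine ⟨(tsupport φ)ᶜ, (isClosed_tsupport φ).isOpen_compl, ht, fun χ hχ => ?_⟩
      rw [TestFn.mul_eq_zero_of_disjoint (disjoint_left.2 fun s hs => hχ hs), map_zero]
  choose V hVo hVt hV using hV
  obtain ⟨ι, _, _, χ, h1, h2⟩ := TestFn.exists_fine_partition V hVo hVt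
  have : φ = ∑ i, TestFn.mul (χ i) φ := by
    rw [← LinearMap.sum_apply, ← map_sum, h1, TestFn.one_mul']
  rw [this, map_sum]
  refine Finset.sum_eq_zero fun i _ => ?_
  obtain ⟨t, ht⟩ := h2 i
  exact hV t _ ht

theorem supp_subset {u : Distr} {A : Set UnitAddCircle} (hA : IsClosed A)
    (h : ∀ φ : TestFn, Disjoint (tsupport φ) A → u.1 φ = 0) : supp u ⊆ A :=
  sInter_subset_of_mem ⟨fun φ hφ => h φ (disjoint_left.2 fun _ hs => hφ hs), hA⟩

theorem supp_zero : supp 0 = ∅ :=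
  subset_empty_iff.1 (supp_subset isClosed_empty fun _ _ => rfl)

theorem supp_add (u v : Distr) : supp (u + v) ⊆ supp u ∪ supp v :=
  supp_subset ((isClosed_supp u).union (isClosed_supp v)) fun φ hφ => by
    rw [disjoint_union_right] at hφ
    rw [add_apply, apply_eq_zero hφ.1, apply_eq_zero hφ.2, add_zero]

theorem supp_smul (c : ℂ) (u : Distr) : supp (c • u) ⊆ supp u :=
  supp_subset (isClosed_supp u) fun φ hφ => by rw [smul_apply, apply_eq_zero hφ, mul_zero]

theorem supp_mul_left (χ : TestFn) (u : Distr) : supp (mul χ u) ⊆ tsupport χ :=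
  supp_subset (isClosed_tsupport χ) fun φ hφ => by
    rw [mul_apply, TestFn.mul_eq_zero_of_disjoint hφ.symm, map_zero]

theorem supp_mul_right (χ : TestFn) (u : Distr) : supp (mul χ u) ⊆ supp u :=
  supp_subset (isClosed_supp u) fun φ hφ => by
    rw [mul_apply, apply_eq_zero (hφ.mono_left (TestFn.tsupport_mul_subset_right χ φ))]

theorem supp_deriv (u : Distr) : supp (deriv u) ⊆ supp u :=
  supp_subset (isClosed_supp u) fun φ hφ => by
    rw [deriv_apply, apply_eq_zero (hφ.mono_left (TestFn.tsupport_deriv_subset φ)), neg_zero]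

theorem supp_ofTest (χ : TestFn) : supp (ofTest χ) ⊆ tsupport χ := by
  rw [← mul_ofTest_one]; exact supp_mul_left _ _

theorem _root_.LoopSpaces.TestFn.disjoint_tsupport {θ : TestFn} {A : Set UnitAddCircle}
    (h : ∀ᶠ t in 𝓝ˢ A, θ t = 0) : Disjoint (tsupport θ) A :=
  disjoint_left.2 fun t ht hA =>
    notMem_tsupport_iff_eventuallyEq.2 (eventually_nhdsSet_iff_forall.1 h t hA) ht

theorem _root_.LoopSpaces.TestFn.disjoint_tsupport_one_sub {θ : TestFn} {A : Set UnitAddCircle}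
    (h : ∀ᶠ t in 𝓝ˢ A, θ t = 1) : Disjoint (tsupport (TestFn.one - θ)) A :=
  TestFn.disjoint_tsupport (h.mono fun t ht => by
    rw [TestFn.sub_apply, ht, TestFn.one_apply, sub_self])

/-- A distribution with vanishing derivative near a point is constant near that point. -/
theorem exists_mul_eq_const {u : Distr} {t : UnitAddCircle} (ht : t ∉ supp (deriv u)) :
    ∃ U : Set UnitAddCircle, IsOpen U ∧ t ∈ U ∧ ∃ c : ℂ, ∀ χ : TestFn, tsupport χ ⊆ U →
      mul χ u = c • ofTest χ := by
  obtain ⟨r, hr, hrs⟩ := Metric.isOpen_iff.1 (isClosed_supp (deriv u)).isOpen_compl t ht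
  -- The bound r keeps the closed ball of radius δ away from the support of u'; the bound 1/2 makes
  -- the complementary arc [a + δ, a + 1 - δ] nondegenerate.
  obtain ⟨δ, hδ, hδr⟩ : ∃ δ : ℝ, 0 < δ ∧ δ < min r (1 / 2) :=
    exists_between (lt_min hr (by norm_num))
  rw [lt_min_iff] at hδr
  -- A test function of mean zero supported in the ball has a primitive that is constant on the
  -- complementary arc. After subtraction of this constant the primitive is supported in the closed
  -- ball, where u' vanishes.
  have hmean : ∀ φ : TestFn, tsupport φ ⊆ Metric.ball t δ → TestFn.integral φ = 0 → u.1 φ = 0 := by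
    intro φ hφ h0
    obtain ⟨a, rfl⟩ := QuotientAddGroup.mk_surjective t
    set Ψ := TestFn.primitive φ
    have hd : TestFn.deriv Ψ = φ := by
      rw [TestFn.deriv_primitive, h0, zero_smul, sub_zero]
    have hdist : ∀ s b : ℝ, (b : UnitAddCircle) = a → |s - b| < δ →
        (s : UnitAddCircle) ∈ Metric.ball (a : UnitAddCircle) δ := by
      intro s b hb hs
      rw [Metric.mem_ball, ← hb, dist_eq_norm, ← AddCircle.coe_sub]
      exact (QuotientAddGroup.norm_mk_le_norm).trans_lt hs
    have hrep : ∀ x : UnitAddCircle, x ∉ Metric.ball (a : UnitAddCircle) δ →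
        ∃ s ∈ Icc (a + δ) (a + 1 - δ), (s : UnitAddCircle) = x := by
      intro x hx
      obtain ⟨s, hs, rfl⟩ : ∃ s ∈ Ico a (a + 1), (s : UnitAddCircle) = x :=
        ⟨_, (AddCircle.equivIco 1 a x).2, AddCircle.coe_equivIco⟩
      refine ⟨s, ⟨?_, ?_⟩, rfl⟩
      · by_contra hlt
        exact hx (hdist s a rfl (by rw [abs_of_nonneg] <;> linarith [hs.1]))
      · by_contra hlt
        refine hx (hdist s (a + 1) (by rw [AddCircle.coe_add, AddCircle.coe_period, add_zero]) ?_)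
        rw [abs_of_neg] <;> linarith [hs.2]
    have hzero : ∀ s ∈ Ioo (a + δ) (a + 1 - δ), φ (s : UnitAddCircle) = 0 := by
      intro s hs
      refine image_eq_zero_of_notMem_tsupport fun hmem => ?_
      have h1 := hφ hmem
      rw [Metric.mem_ball] at h1
      change dist (s : UnitAddCircle) (a : UnitAddCircle) < δ at h1
      rw [dist_eq_norm, ← AddCircle.coe_sub, AddCircle.norm_eq] at h1
      simp only [inv_one, one_mul, _root_.mul_one] at h1
      have h2 : 0 < s - a := by linarith [hs.1]
      have h3 : s - a < 1 := by linarith [hs.2]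
      rcases lt_or_ge (s - a) (1 / 2) with h4 | h4
      · have : round (s - a) = 0 := by
          rw [round_eq, Int.floor_eq_iff]
          constructor <;> push_cast <;> linarith
        rw [this, Int.cast_zero, sub_zero, abs_of_pos h2] at h1
        linarith [hs.1]
      · have : round (s - a) = 1 := by
          rw [round_eq, Int.floor_eq_iff]
          constructor <;> push_cast <;> linarith
        rw [this, Int.cast_one, abs_of_neg (by linarith)] at h1
        linarith [hs.2]
    have hconst : ∀ s ∈ Icc (a + δ) (a + 1 - δ),
        Ψ (s : UnitAddCircle) = Ψ ((a + δ : ℝ) : UnitAddCircle) := by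
      refine constant_of_has_deriv_right_zero (Ψ.contDiff.continuous.continuousOn) fun s hs => ?_
      have h1 := Ψ.hasDerivAt s
      have h2 : φ (s : UnitAddCircle) = 0 := by
        have hcl : s ∈ closure (Ioo (a + δ) (a + 1 - δ)) := by
          rw [closure_Ioo (by linarith)]
          exact Ico_subset_Icc_self hs
        exact (isClosed_eq φ.contDiff.continuous continuous_const).closure_subset_iff.2
          (fun s hs => hzero s hs) hcl
      rw [hd, h2] at h1
      exact h1.hasDerivWithinAt
    set c := Ψ ((a + δ : ℝ) : UnitAddCircle)
    have hsub : tsupport (Ψ - c • TestFn.one) ⊆ Metric.closedBall (a : UnitAddCircle) δ := by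
      refine closure_minimal (fun x hx => ?_) Metric.isClosed_closedBall
      by_contra hxb
      obtain ⟨s, hs, rfl⟩ := hrep x fun h => hxb (Metric.ball_subset_closedBall h)
      refine hx ?_
      rw [TestFn.sub_apply, TestFn.smul_apply, TestFn.one_apply, _root_.mul_one, hconst s hs, sub_self]
    have h3 : (deriv u).1 (Ψ - c • TestFn.one) = 0 := by
      refine apply_eq_zero (disjoint_left.2 fun x hx hxs => ?_)
      exact hrs (Metric.closedBall_subset_ball hδr.1 (hsub hx)) hxs
    rw [deriv_apply, map_sub, hd, map_smul, TestFn.deriv_one, smul_zero, sub_zero, neg_eq_zero] at h3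
    exact h3
  obtain ⟨e, he, he1⟩ := TestFn.exists_bump Metric.isOpen_ball (Metric.mem_ball_self hδ (x := t))
  refine ⟨Metric.ball t δ, Metric.isOpen_ball, Metric.mem_ball_self hδ, u.1 e, fun χ hχ => ?_⟩
  ext φ
  rw [mul_apply, smul_apply, ofTest_apply]
  set ψ := TestFn.mul χ φ with hψ
  have hψs : tsupport ψ ⊆ Metric.ball t δ := (TestFn.tsupport_mul_subset_left χ φ).trans hχ
  -- Subtracting a multiple of the bump e yields mean zero; hence u is u(e) times the integral near
  -- t.
  have h := hmean (ψ - TestFn.integral ψ • e) ?_ ?_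
  · rw [map_sub, map_smul, sub_eq_zero, smul_eq_mul] at h
    rw [h, mul_comm]
  · have h1 : tsupport (ψ - TestFn.integral ψ • e) ⊆ tsupport ψ ∪ tsupport e := by
      refine closure_minimal (fun s hs => ?_) ((isClosed_tsupport ψ).union (isClosed_tsupport e))
      by_contra hns
      rw [mem_union, not_or] at hns
      refine hs ?_
      rw [TestFn.sub_apply, TestFn.smul_apply, image_eq_zero_of_notMem_tsupport hns.1,
        image_eq_zero_of_notMem_tsupport hns.2, mul_zero, sub_zero]
    exact h1.trans (union_subset hψs he)
  · rw [map_sub, map_smul, he1, smul_eq_mul, _root_.mul_one, sub_self]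

end Distr

/-! ### Operators on `C(S¹)` and `L^p(S¹)` -/

namespace Base

/-- A function representing an element of `C(S¹)`, resp. `L^p(S¹)`. -/
def rep : (b : Base) → b.Fn → UnitAddCircle → ℂ
  | cont => fun f : C(UnitAddCircle, ℂ) => f
  | leb p _ => fun f : Lp ℂ (ENNReal.ofReal p) (volume : Measure UnitAddCircle) => f

variable (b : Base)

theorem integrable_rep (f : b.Fn) : Integrable (b.rep f) :=
  match b with
  | cont => integrable_cont f
  | leb _ hp => integrable_leb hp f

theorem toDistr_eq (f : b.Fn) : b.toDistr f = Distr.ofIntegrable (b.rep f) (b.integrable_rep f) :=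
  match b with
  | cont => rfl
  | leb _ _ => rfl

theorem rep_add (f g : b.Fn) : b.rep (f + g) =ᵐ[volume] b.rep f + b.rep g :=
  match b with
  | cont => Eventually.of_forall fun _ => rfl
  | leb p _ => Lp.coeFn_add (E := ℂ) (p := ENNReal.ofReal p) f g

theorem rep_smul (c : ℂ) (f : b.Fn) : b.rep (c • f) =ᵐ[volume] c • b.rep f :=
  match b with
  | cont => Eventually.of_forall fun _ => rfl
  | leb p _ => Lp.coeFn_smul (E := ℂ) (p := ENNReal.ofReal p) c f

theorem integral_norm_rep_le (f : b.Fn) : ∫ t, ‖b.rep f t‖ ≤ ‖f‖ :=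
  match b with
  | cont => by
    have h := integral_mono (μ := (volume : Measure UnitAddCircle))
      (integrable_cont f).norm (integrable_const ‖f‖)
      fun t => ContinuousMap.norm_coe_le_norm (f : C(UnitAddCircle, ℂ)) t
    rwa [integral_const, volume_real_univ, one_smul] at h
  | leb p hp => by
    have := fact_one_le hp
    let f' : Lp ℂ (ENNReal.ofReal p) (volume : Measure UnitAddCircle) := f
    change ∫ t, ‖f' t‖ ≤ ‖f'‖
    rw [integral_norm_eq_lintegral_enorm (integrable_leb hp f').aestronglyMeasurable,
      ← eLpNorm_one_eq_lintegral_enorm, Lp.norm_def]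
    refine ENNReal.toReal_mono (Lp.eLpNorm_ne_top f') ?_
    have := eLpNorm_le_eLpNorm_mul_rpow_measure_univ (μ := (volume : Measure UnitAddCircle))
      (ENNReal.one_le_ofReal.2 hp) (Lp.aestronglyMeasurable f')
    rwa [UnitAddCircle.measure_univ, ENNReal.one_rpow, mul_one] at this

/-- The inclusion of the continuous functions. -/
def ofCont : (b : Base) → C(UnitAddCircle, ℂ) →L[ℂ] b.Fn
  | cont => ContinuousLinearMap.id ℂ C(UnitAddCircle, ℂ)
  | leb p hp =>
    haveI := fact_one_le hp
    ContinuousMap.toLp (ENNReal.ofReal p) (volume : Measure UnitAddCircle) ℂ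

theorem toDistr_ofCont (g : C(UnitAddCircle, ℂ)) :
    b.toDistr (b.ofCont g) = Distr.ofIntegrable g (integrable_cont g) :=
  match b with
  | cont => rfl
  | leb p hp => by
    have := fact_one_le hp
    refine Distr.ext fun φ => integral_congr_ae ?_
    filter_upwards [ContinuousMap.coeFn_toLp (p := ENNReal.ofReal p) (𝕜 := ℂ)
      (volume : Measure UnitAddCircle) g] with t ht
    exact congrArg (· * φ t) ht

/-- A test function regarded as an element of `C(S¹)`, resp. `L^p(S¹)`. -/
def ofTest (χ : TestFn) : b.Fn := b.ofCont ⟨χ, χ.continuous⟩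

theorem toDistr_ofTest (χ : TestFn) : b.toDistr (b.ofTest χ) = Distr.ofTest χ :=
  b.toDistr_ofCont _

/-- Evaluation at a test function. -/
def pair (φ : TestFn) : b.Fn →L[ℂ] ℂ :=
  LinearMap.mkContinuous ((Distr.pair φ).comp b.toDistr) φ.exists_bound.choose fun f => by
    obtain ⟨h0, h⟩ := φ.exists_bound.choose_spec
    change ‖(b.toDistr f).1 φ‖ ≤ _
    rw [toDistr_eq]
    change ‖∫ t, b.rep f t * φ t‖ ≤ _
    refine (norm_integral_le_of_norm_le
      ((b.integrable_rep f).norm.mul_const φ.exists_bound.choose)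
      (Eventually.of_forall fun t => ?_)).trans ?_
    · rw [norm_mul]
      exact mul_le_mul_of_nonneg_left (h t) (norm_nonneg _)
    · rw [integral_mul_const, mul_comm]
      exact mul_le_mul_of_nonneg_left (b.integral_norm_rep_le f) h0

theorem pair_apply (φ : TestFn) (f : b.Fn) : b.pair φ f = (b.toDistr f).1 φ := rfl

/-- The primitive, as a map into the continuous functions. -/
def primCont : b.Fn →L[ℂ] C(UnitAddCircle, ℂ) :=
  LinearMap.mkContinuous
    { toFun := fun f => prim (b.rep f) (b.integrable_rep f)
      map_add' := fun f g => by
        rw [← prim_add]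
        exact prim_congr _ _ (b.rep_add f g)
      map_smul' := fun c f => by
        rw [RingHom.id_apply, ← prim_smul]
        exact prim_congr _ _ (b.rep_smul c f) } 2 fun f =>
    (norm_prim_le (b.integrable_rep f)).trans (mul_le_mul_of_nonneg_left (b.integral_norm_rep_le f) zero_le_two)

theorem primCont_apply (f : b.Fn) : b.primCont f = prim (b.rep f) (b.integrable_rep f) := rfl

/-- The primitive of `f - ∫ f` with mean `0`. -/
def primitive : b.Fn →L[ℂ] b.Fn :=
  b.ofCont.comp b.primCont -
    ((b.pair TestFn.one).comp (b.ofCont.comp b.primCont)).smulRight (b.ofTest TestFn.one)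

theorem toDistr_primitive (f : b.Fn) :
    b.toDistr (b.primitive f) = Distr.primitive (b.toDistr f) := by
  have h0 : Distr.deriv (b.toDistr (b.ofCont (b.primCont f))) =
      b.toDistr f - Distr.integral (b.toDistr f) • Distr.ofTest TestFn.one := by
    simp only [toDistr_ofCont, primCont_apply]
    rw [toDistr_eq, ← Distr.const_eq]
    refine (ofIntegrable_prim (b.integrable_rep f)).trans ?_
    congr 2
    change _ = ∫ t, b.rep f t * 1
    simp only [mul_one]
  have h1 := Distr.primitive_deriv (b.toDistr (b.ofCont (b.primCont f)))
  have h2 : Distr.primitive (Distr.ofTest TestFn.one) = 0 := by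
    have h := Distr.primitive_ofTest TestFn.one
    have hh := TestFn.eq_const_of_deriv_eq_zero (φ := TestFn.primitive TestFn.one) (by
      rw [TestFn.deriv_primitive, TestFn.integral_one, one_smul, sub_self])
    rw [TestFn.integral_primitive, zero_smul] at hh
    rw [h, hh, map_zero]
  rw [h0, map_sub, map_smul, h2, smul_zero, sub_zero] at h1
  rw [h1]
  change b.toDistr (b.ofCont (b.primCont f) -
    (b.pair TestFn.one (b.ofCont (b.primCont f))) • b.ofTest TestFn.one) = _
  rw [map_sub, map_smul, toDistr_ofTest, pair_apply]
  rfl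

theorem memLp_mul (χ : TestFn) {p : ENNReal}
    (f : Lp ℂ p (volume : Measure UnitAddCircle)) :
    MemLp (fun t => χ t * f t) p volume :=
  MemLp.of_le_mul (c := χ.exists_bound.choose) (Lp.memLp f)
    (χ.continuous.aestronglyMeasurable.mul (Lp.aestronglyMeasurable f))
    (Eventually.of_forall fun t => by
      rw [norm_mul]
      exact mul_le_mul_of_nonneg_right (χ.exists_bound.choose_spec.2 t) (norm_nonneg _))

/-- Multiplication by a test function on `L^p`. -/
def lpMul (χ : TestFn) (p : ENNReal) [Fact (1 ≤ p)] :
    Lp ℂ p (volume : Measure UnitAddCircle) →L[ℂ] Lp ℂ p (volume : Measure UnitAddCircle) :=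
  LinearMap.mkContinuous
    { toFun := fun f => (memLp_mul χ f).toLp _
      map_add' := fun f g => by
        rw [← MemLp.toLp_add]
        refine MemLp.toLp_congr _ _ ?_
        filter_upwards [Lp.coeFn_add f g] with t ht
        rw [ht]
        simp only [Pi.add_apply]
        ring
      map_smul' := fun c f => by
        rw [RingHom.id_apply, ← MemLp.toLp_const_smul]
        refine MemLp.toLp_congr _ _ ?_
        filter_upwards [Lp.coeFn_smul c f] with t ht
        rw [ht]
        simp only [Pi.smul_apply, smul_eq_mul]
        ring } χ.exists_bound.choose fun f => by
      refine Lp.norm_le_mul_norm_of_ae_le_mul ?_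
      filter_upwards [(memLp_mul χ f).coeFn_toLp] with t ht
      change ‖((memLp_mul χ f).toLp _ : UnitAddCircle → ℂ) t‖ ≤ _
      rw [ht, norm_mul]
      exact mul_le_mul_of_nonneg_right (χ.exists_bound.choose_spec.2 t) (norm_nonneg _)

/-- Multiplication by a test function. -/
def mul (χ : TestFn) : (b : Base) → b.Fn →L[ℂ] b.Fn
  | cont => ContinuousLinearMap.mul ℂ C(UnitAddCircle, ℂ) ⟨χ, χ.continuous⟩
  | leb p hp =>
    haveI := fact_one_le hp
    lpMul χ (ENNReal.ofReal p)

theorem rep_mul (χ : TestFn) (f : b.Fn) :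
    b.rep (b.mul χ f) =ᵐ[volume] fun t => χ t * b.rep f t :=
  match b with
  | cont => Eventually.of_forall fun _ => rfl
  | leb p _ => (memLp_mul χ (p := ENNReal.ofReal p) f).coeFn_toLp

theorem toDistr_mul (χ : TestFn) (f : b.Fn) :
    b.toDistr (b.mul χ f) = Distr.mul χ (b.toDistr f) := by
  refine Distr.ext fun φ => ?_
  rw [Distr.mul_apply, toDistr_eq, toDistr_eq]
  refine integral_congr_ae ?_
  filter_upwards [b.rep_mul χ f] with t ht
  rw [ht, TestFn.mul_apply]
  ring

end Base

instance : Infinite UnitAddCircle :=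
  haveI : Infinite (Ico (0 : ℝ) (0 + 1)) := (Ico_infinite (by norm_num)).to_subtype
  Infinite.of_injective _ (AddCircle.equivIco 1 0).symm.injective

/-! ### Structure of the spaces `regular b k` -/

namespace Distr

theorem supp_sum {ι : Type*} (s : Finset ι) (u : ι → Distr) {A : Set UnitAddCircle}
    (h : ∀ i ∈ s, supp (u i) ⊆ A) : supp (∑ i ∈ s, u i) ⊆ A := by
  classical
  induction s using Finset.induction_on with
  | empty => rw [Finset.sum_empty, supp_zero]; exact empty_subset _
  | insert i s hi ih =>
    rw [Finset.sum_insert hi]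
    exact (supp_add _ _).trans (union_subset (h i (Finset.mem_insert_self i s))
      (ih fun j hj => h j (Finset.mem_insert_of_mem hj)))

theorem supp_deriv_pow (j : ℕ) (u : Distr) : supp ((deriv ^ j) u) ⊆ supp u := by
  induction j with
  | zero => exact Subset.rfl
  | succ j ih => rw [deriv_pow_succ']; exact (supp_deriv _).trans ih

theorem deriv_pow_apply (j : ℕ) (u : Distr) (φ : TestFn) :
    ((deriv ^ j) u).1 φ = (-1) ^ j * u.1 ((TestFn.deriv ^ j) φ) := by
  induction j generalizing φ with
  | zero => simp
  | succ j ih =>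
    rw [deriv_pow_succ', deriv_apply, ih, TestFn.deriv_pow_succ]
    ring

/-- The Leibniz rule. -/
theorem exists_deriv_pow_mul (j : ℕ) : ∀ χ : TestFn, ∃ ψ : ℕ → TestFn, ∀ u : Distr,
    (deriv ^ j) (mul χ u) = ∑ i ∈ Finset.range (j + 1), mul (ψ i) ((deriv ^ i) u) := by
  induction j with
  | zero => exact fun χ => ⟨fun _ => χ, fun u => by simp⟩
  | succ j ih =>
    intro χ
    obtain ⟨ψ₁, h₁⟩ := ih (TestFn.deriv χ)
    obtain ⟨ψ₂, h₂⟩ := ih χ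
    refine ⟨fun i => (if i < j + 1 then ψ₁ i else 0) + if i = 0 then 0 else ψ₂ (i - 1), fun u => ?_⟩
    rw [deriv_pow_succ, deriv_mul, map_add, h₁, h₂]
    simp only [map_add, LinearMap.add_apply, Finset.sum_add_distrib]
    congr 1
    · rw [Finset.sum_range_succ _ (j + 1)]
      simp only [lt_irrefl, if_false, map_zero, LinearMap.zero_apply, add_zero]
      exact Finset.sum_congr rfl fun i hi => by rw [if_pos (Finset.mem_range.1 hi)]
    · rw [Finset.sum_range_succ' _ (j + 1)]
      simp [deriv_pow_succ]

end Distr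

variable {b : Base} {k : WithTop ℤ}

namespace Base

/-- The map `(f₀, …, fₙ) ↦ ∑ Dʲ fⱼ`. -/
def sumDeriv (b : Base) (n : ℕ) : (Fin (n + 1) → b.Fn) →ₗ[ℂ] Distr where
  toFun f := ∑ j : Fin (n + 1), (Distr.deriv ^ (j : ℕ)) (b.toDistr (f j))
  map_add' f g := by simp only [Pi.add_apply, map_add, Finset.sum_add_distrib]
  map_smul' c f := by simp only [Pi.smul_apply, map_smul, Finset.smul_sum, RingHom.id_apply]

theorem sumDeriv_apply (n : ℕ) (f : Fin (n + 1) → b.Fn) :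
    b.sumDeriv n f = ∑ j : Fin (n + 1), (Distr.deriv ^ (j : ℕ)) (b.toDistr (f j)) := rfl

theorem sumDeriv_zero (f : Fin 1 → b.Fn) : b.sumDeriv 0 f = b.toDistr (f 0) := by
  simp [sumDeriv_apply]

theorem sumDeriv_succ (n : ℕ) (f : Fin (n + 2) → b.Fn) :
    b.sumDeriv (n + 1) f =
      b.toDistr (f 0) + Distr.deriv (b.sumDeriv n fun j => f j.succ) := by
  rw [sumDeriv_apply, Fin.sum_univ_succ, sumDeriv_apply, map_sum]
  simp [Distr.deriv_pow_succ']

theorem sumDeriv_single (n : ℕ) (f : b.Fn) :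
    b.sumDeriv n (Pi.single 0 f) = b.toDistr f := by
  rw [sumDeriv_apply, Finset.sum_eq_single 0]
  · simp
  · intro j _ hj
    rw [Pi.single_eq_of_ne hj, map_zero, map_zero]
  · simp

/-- The rule χ Du = D(χu) - χ'u moves all derivatives to the outside. That the coefficients are
continuous operators on `b.Fn` is what makes multiplication continuous in negative regularity. -/
theorem exists_mul_deriv_pow (b : Base) (n : ℕ) : ∀ χ : TestFn, ∃ A : ℕ → b.Fn →L[ℂ] b.Fn,
    ∀ f, Distr.mul χ ((Distr.deriv ^ n) (b.toDistr f)) =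
      ∑ j ∈ Finset.range (n + 1), (Distr.deriv ^ j) (b.toDistr (A j f)) := by
  induction n with
  | zero => exact fun χ => ⟨fun _ => b.mul χ, fun f => by simp [b.toDistr_mul]⟩
  | succ n ih =>
    intro χ
    obtain ⟨A₁, h₁⟩ := ih (TestFn.deriv χ)
    obtain ⟨A₂, h₂⟩ := ih χ
    refine ⟨fun j => (if j = 0 then 0 else A₂ (j - 1)) - if j < n + 1 then A₁ j else 0,
      fun f => ?_⟩
    rw [Distr.deriv_pow_succ', Distr.mul_deriv, h₁, h₂]
    simp only [_root_.sub_apply, map_sub, Finset.sum_sub_distrib]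
    congr 1
    · rw [Finset.sum_range_succ' _ (n + 1)]
      simp [Distr.deriv_pow_succ', map_sum]
    · rw [Finset.sum_range_succ _ (n + 1)]
      simp only [lt_irrefl, if_false, _root_.zero_apply, map_zero, add_zero]
      exact Finset.sum_congr rfl fun i hi => by rw [if_pos (Finset.mem_range.1 hi)]

theorem exists_mul_sumDeriv (b : Base) (n : ℕ) (χ : TestFn) :
    ∃ A : (Fin (n + 1) → b.Fn) → (Fin (n + 1) → b.Fn), Continuous A ∧
      ∀ f, Distr.mul χ (b.sumDeriv n f) = b.sumDeriv n (A f) := by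
  choose A hA using fun j : ℕ => b.exists_mul_deriv_pow j χ
  refine ⟨fun f i => ∑ j : Fin (n + 1), if i ≤ j then A j i (f j) else 0, ?_, fun f => ?_⟩
  · refine continuous_pi fun i => continuous_finsetSum _ fun j _ => ?_
    split_ifs
    · exact (A j i).continuous.comp (continuous_apply j)
    · exact continuous_const
  · rw [sumDeriv_apply, sumDeriv_apply, map_sum]
    simp only [hA, map_sum]
    rw [Finset.sum_comm]
    refine Finset.sum_congr rfl fun j _ => ?_
    have h1 : ∀ i : Fin (n + 1), (Distr.deriv ^ (i : ℕ)) (b.toDistr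
        (if i ≤ j then A j i (f j) else 0)) = if (i : ℕ) < j + 1 then
          (Distr.deriv ^ (i : ℕ)) (b.toDistr (A j i (f j))) else 0 := fun i => by
      by_cases h : i ≤ j
      · rw [if_pos h, if_pos (Nat.lt_succ_of_le h)]
      · rw [if_neg h, if_neg (fun h' => h (Nat.le_of_lt_succ h')), map_zero, map_zero]
    simp only [h1]
    rw [Fin.sum_univ_eq_sum_range (fun i => if i < (j : ℕ) + 1 then
      (Distr.deriv ^ i) (b.toDistr (A j i (f j))) else 0) (n + 1), ← Finset.sum_filter]
    congr 1
    ext i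
    simp only [Finset.mem_range, Finset.mem_filter]
    omega

/-- The primitive shifts the indices down by one. Only f₀ needs a true primitive, and only D f₁
contributes a mean to be removed, since the higher terms remain derivatives after the shift. -/
theorem primitive_sumDeriv_succ (n : ℕ) (f : Fin (n + 2) → b.Fn) :
    Distr.primitive (b.sumDeriv (n + 1) f) = b.sumDeriv n ((fun j => f j.succ) +
      Pi.single 0 (b.primitive (f 0) - b.pair TestFn.one (f 1) • b.ofTest TestFn.one)) := by
  rw [sumDeriv_succ, map_add, Distr.primitive_deriv, map_add, sumDeriv_single, map_sub,
    map_smul, toDistr_ofTest, toDistr_primitive]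
  have : Distr.integral (b.sumDeriv n fun j => f j.succ) = b.pair TestFn.one (f 1) := by
    cases n with
    | zero => rw [sumDeriv_zero]; rfl
    | succ n =>
      rw [sumDeriv_succ, Distr.integral_eq_pair, map_add, ← Distr.integral_eq_pair,
        ← Distr.integral_eq_pair, Distr.integral_deriv, add_zero]
      rfl
  rw [this]
  abel

/-- A function on the circle has a primitive only if its mean is zero. The mean is removed with a
bump e away from t, so that f has primitives of every order up to an error supported in the support
of e. -/
theorem exists_local_primitive (b : Base) (t : UnitAddCircle) : ∃ e : TestFn, t ∉ tsupport e ∧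
    ∀ (n : ℕ) (f : b.Fn), ∃ g : b.Fn,
      Distr.supp ((Distr.deriv ^ n) (b.toDistr g) - b.toDistr f) ⊆ tsupport e := by
  obtain ⟨t', ht'⟩ := exists_ne t
  obtain ⟨e, he, he1⟩ := TestFn.exists_bump isOpen_compl_singleton ht'
  refine ⟨e, fun h => he h rfl, fun n => ?_⟩
  have step : ∀ f : b.Fn, ∃ g : b.Fn,
      Distr.deriv (b.toDistr g) = b.toDistr f - b.pair TestFn.one f • Distr.ofTest e := fun f => by
    refine ⟨b.primitive f + b.pair TestFn.one f • b.ofTest (TestFn.primitive (TestFn.one - e)), ?_⟩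
    rw [map_add, map_smul, toDistr_primitive, toDistr_ofTest, map_add, map_smul,
      Distr.deriv_primitive, Distr.deriv_ofTest, TestFn.deriv_primitive, map_sub (TestFn.integral),
      he1, TestFn.integral_one, sub_self, zero_smul, sub_zero, map_sub, smul_sub]
    change _ - (b.toDistr f).1 TestFn.one • _ + ((b.toDistr f).1 TestFn.one • _ - _) = _
    abel
  induction n with
  | zero => exact fun f => ⟨f, by simp [Distr.supp_zero]⟩
  | succ n ih =>
    intro f
    obtain ⟨g, hg⟩ := ih f
    obtain ⟨g', hg'⟩ := step g
    refine ⟨g', ?_⟩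
    rw [Distr.deriv_pow_succ, hg', map_sub, sub_right_comm, sub_eq_add_neg]
    refine (Distr.supp_add _ _).trans (union_subset hg ?_)
    rw [← map_neg, ← neg_one_smul ℂ (_ • _)]
    exact (Distr.supp_deriv_pow _ _).trans ((Distr.supp_smul _ _).trans
      ((Distr.supp_smul _ _).trans (Distr.supp_ofTest e)))

end Base

theorem mem_regular_of_nonneg (hk : 0 ≤ k) {u : Distr} : u ∈ regular b k ↔
    ∀ j : ℕ, ((j : ℤ) : WithTop ℤ) ≤ k → (Distr.deriv ^ j) u ∈ LinearMap.range b.toDistr := by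
  refine ⟨fun h => h.1, fun h => ⟨h, fun n hn hkn => ?_⟩⟩
  rw [hkn] at hk
  have := WithTop.coe_le_coe.1 hk
  omega

/-- Turns the local description into a global one. A partition of unity glues local n-th derivatives
to a sum of derivatives of orders ≤ n; conversely, near a given point `Base.exists_local_primitive`
writes each Dʲfⱼ as an n-th derivative. The case n = 0, which is the base space itself, is included
for the sake of `pred_cases`. -/
theorem mem_regular_neg {n : ℕ} {u : Distr} :
    u ∈ regular b ((-n : ℤ) : WithTop ℤ) ↔ ∃ f, b.sumDeriv n f = u := by
  rcases Nat.eq_zero_or_pos n with rfl | hn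
  · rw [mem_regular_of_nonneg (by simp)]
    constructor
    · intro h
      obtain ⟨f, hf⟩ := h 0 (by simp)
      exact ⟨fun _ => f, by rw [Base.sumDeriv_zero]; exact hf⟩
    · rintro ⟨f, rfl⟩ j hj
      have := WithTop.coe_le_coe.1 hj
      obtain rfl : j = 0 := by push_cast at this; omega
      exact ⟨f 0, (Base.sumDeriv_zero f).symm⟩
  · constructor
    · intro h
      have hloc : IsLocallyDeriv b n u := h.2 n hn rfl
      choose U hU htU f hf using hloc
      obtain ⟨ι, _, _, χ, h1, h2⟩ := TestFn.exists_fine_partition U hU htU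
      have hsum : u = ∑ i, Distr.mul (χ i) u := by
        rw [← LinearMap.sum_apply, ← map_sum, h1, Distr.mul_one]
      have hi : ∀ i, ∃ g, b.sumDeriv n g = Distr.mul (χ i) u := fun i => by
        obtain ⟨t, ht⟩ := h2 i
        obtain ⟨A, hA⟩ := b.exists_mul_deriv_pow n (χ i)
        refine ⟨fun j => A j (f t), ?_⟩
        rw [Base.sumDeriv_apply, Fin.sum_univ_eq_sum_range
          (fun j => (Distr.deriv ^ j) (b.toDistr (A j (f t)))) (n + 1), ← hA]
        ext φ
        rw [Distr.mul_apply, Distr.mul_apply]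
        exact (hf t _ ((TestFn.tsupport_mul_subset_left _ _).trans ht)).symm
      choose g hg using hi
      refine ⟨∑ i, g i, ?_⟩
      rw [map_sum, hsum]
      exact Finset.sum_congr rfl fun i _ => hg i
    · rintro ⟨f, rfl⟩
      refine ⟨fun j hj => ?_, fun m _ hm t => ?_⟩
      · have := WithTop.coe_le_coe.1 hj
        omega
      · have := WithTop.coe_inj.1 hm
        obtain rfl : m = n := by omega
        obtain ⟨e, he, hg⟩ := b.exists_local_primitive t
        choose g hg using fun j : Fin (m + 1) => hg (m - j) (f j)
        refine ⟨(tsupport e)ᶜ, (isClosed_tsupport e).isOpen_compl, he, ∑ j, g j, fun φ hφ => ?_⟩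
        have key : Distr.supp ((Distr.deriv ^ m) (b.toDistr (∑ j, g j)) - b.sumDeriv m f) ⊆
            tsupport e := by
          rw [Base.sumDeriv_apply, map_sum, map_sum, ← Finset.sum_sub_distrib]
          refine Distr.supp_sum _ _ fun j _ => ?_
          have hj : m = (j : ℕ) + (m - j) := by have := j.2; omega
          have : (Distr.deriv ^ m) (b.toDistr (g j)) =
              (Distr.deriv ^ (j : ℕ)) ((Distr.deriv ^ (m - j)) (b.toDistr (g j))) := by
            conv_lhs => rw [hj, pow_add]
            rfl
          rw [this, ← map_sub]
          exact (Distr.supp_deriv_pow _ _).trans (hg j)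
        have h0 := Distr.apply_eq_zero (disjoint_left.2 fun s hs hs' => hφ hs (key hs') :
          Disjoint (tsupport φ) _)
        rw [Distr.sub_apply, sub_eq_zero] at h0
        exact h0.symm

theorem nonneg_or_neg (k : WithTop ℤ) : 0 ≤ k ∨ ∃ n : ℕ, k = ((-n : ℤ) : WithTop ℤ) := by
  cases k with
  | top => exact Or.inl le_top
  | coe z =>
    rcases le_total 0 z with h | h
    · exact Or.inl (WithTop.coe_le_coe.2 h)
    · exact Or.inr ⟨z.natAbs, by congr 1; omega⟩

/-- The cut lies between k = 1 and k = 0, since differentiation leaves the nonnegative range at k =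
0; that value is then regarded as -0. -/
theorem pred_cases (k : WithTop ℤ) : (0 ≤ k ∧ 0 ≤ k.map (· - 1) ∧ ∀ j : ℕ,
      ((j : ℤ) : WithTop ℤ) ≤ k.map (· - 1) ↔ (((j + 1 : ℕ) : ℤ) : WithTop ℤ) ≤ k) ∨
    ∃ n : ℕ, k = ((-n : ℤ) : WithTop ℤ) ∧
      k.map (· - 1) = ((-(n + 1 : ℕ) : ℤ) : WithTop ℤ) := by
  cases k with
  | top => exact Or.inl ⟨le_top, le_top, fun j => by simp⟩
  | coe z =>
    rcases le_or_gt 1 z with h | h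
    · refine Or.inl ⟨WithTop.coe_le_coe.2 (by omega),
        WithTop.coe_le_coe.2 (by change 0 ≤ z - 1; omega), fun j => ?_⟩
      rw [WithTop.map_coe, WithTop.coe_le_coe, WithTop.coe_le_coe]
      push_cast
      omega
    · refine Or.inr ⟨z.natAbs, by congr 1; omega, ?_⟩
      rw [WithTop.map_coe]
      congr 1
      omega

theorem ofTest_mem_regular (χ : TestFn) : Distr.ofTest χ ∈ regular b k := by
  rcases nonneg_or_neg k with hk | ⟨n, rfl⟩
  · refine (mem_regular_of_nonneg hk).2 fun j _ => ⟨b.ofTest ((TestFn.deriv ^ j) χ), ?_⟩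
    rw [b.toDistr_ofTest]
    induction j with
    | zero => rfl
    | succ j ih =>
      rw [Distr.deriv_pow_succ', ← ih (by
        refine le_trans ?_ ‹_›
        rw [WithTop.coe_le_coe]; omega), Distr.deriv_ofTest, pow_succ']
      rfl
  · exact mem_regular_neg.2 ⟨Pi.single 0 (b.ofTest χ), by
      rw [Base.sumDeriv_single, b.toDistr_ofTest]⟩

theorem mul_mem_range (χ : TestFn) {u : Distr} (hu : u ∈ LinearMap.range b.toDistr) :
    Distr.mul χ u ∈ LinearMap.range b.toDistr := by
  obtain ⟨f, rfl⟩ := hu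
  exact ⟨b.mul χ f, b.toDistr_mul χ f⟩

theorem primitive_mem_range {u : Distr} (hu : u ∈ LinearMap.range b.toDistr) :
    Distr.primitive u ∈ LinearMap.range b.toDistr := by
  obtain ⟨f, rfl⟩ := hu
  exact ⟨b.primitive f, b.toDistr_primitive f⟩

theorem mul_mem_regular (χ : TestFn) {u : Distr} (hu : u ∈ regular b k) :
    Distr.mul χ u ∈ regular b k := by
  rcases nonneg_or_neg k with hk | ⟨n, rfl⟩
  · rw [mem_regular_of_nonneg hk] at hu ⊢
    intro j hj
    obtain ⟨ψ, hψ⟩ := Distr.exists_deriv_pow_mul j χ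
    rw [hψ]
    refine Submodule.sum_mem _ fun i hi => mul_mem_range _ (hu i (le_trans ?_ hj))
    rw [WithTop.coe_le_coe]
    have := Finset.mem_range.1 hi
    omega
  · rw [mem_regular_neg] at hu ⊢
    obtain ⟨f, rfl⟩ := hu
    obtain ⟨A, -, hA⟩ := b.exists_mul_sumDeriv n χ
    exact ⟨A f, (hA f).symm⟩

theorem deriv_pow_primitive_succ (j : ℕ) (u : Distr) : (Distr.deriv ^ (j + 1)) (Distr.primitive u) =
    (Distr.deriv ^ j) u - Distr.integral u • (Distr.deriv ^ j) (Distr.ofTest TestFn.one) := by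
  rw [Distr.deriv_pow_succ, Distr.deriv_primitive, map_sub, map_smul]

theorem primitive_mem_regular {u : Distr} (hu : u ∈ regular b (k.map (· - 1))) :
    Distr.primitive u ∈ regular b k := by
  rcases pred_cases k with ⟨hk, hk', hj⟩ | ⟨n, rfl, hk'⟩
  · rw [mem_regular_of_nonneg hk'] at hu
    rw [mem_regular_of_nonneg hk]
    rintro (- | j) hjk
    · exact primitive_mem_range (hu 0 (by simpa using hk'))
    · rw [deriv_pow_primitive_succ]
      exact Submodule.sub_mem _ (hu j ((hj j).2 hjk)) (Submodule.smul_mem _ _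
        ((mem_regular_of_nonneg hk').1 (ofTest_mem_regular _) j ((hj j).2 hjk)))
  · rw [hk', mem_regular_neg] at hu
    rw [mem_regular_neg]
    obtain ⟨f, rfl⟩ := hu
    exact ⟨_, (Base.primitive_sumDeriv_succ n f).symm⟩

/-! ### Topology of the loop spaces -/

section Quotient

variable {A B : Type*} [AddCommGroup A] [Module ℂ A] [TopologicalSpace A]
  [AddCommMonoid B] [Module ℂ B] [TopologicalSpace B]

/-- The saturation of an open set is the union of its translates by the kernel. Openness is needed
because products of open quotient maps are again quotient maps, which gives joint continuity of the
vector space operations. -/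
theorem isOpenQuotientMap_of_eq_coinduced [ContinuousAdd A] (π : A →ₗ[ℂ] B)
    (hπ : Function.Surjective π) (h : ‹TopologicalSpace B› = .coinduced π inferInstance) :
    IsOpenQuotientMap π := by
  refine ⟨hπ, continuous_iff_coinduced_le.2 h.ge, fun U hU => ?_⟩
  rw [h, isOpen_coinduced]
  have : π ⁻¹' (π '' U) = ⋃ z : LinearMap.ker π, (fun a => a + (z : A)) ⁻¹' U := by
    ext a
    simp only [mem_preimage, mem_image, mem_iUnion, Subtype.exists, LinearMap.mem_ker]
    constructor
    · rintro ⟨u, hu, hua⟩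
      exact ⟨u - a, by rw [sub_eq_add_neg, map_add, hua, ← map_add, add_neg_cancel, map_zero], by rwa [add_sub_cancel]⟩
    · rintro ⟨z, hz, hu⟩
      exact ⟨_, hu, by rw [map_add, hz, add_zero]⟩
  rw [this]
  exact isOpen_iUnion fun z => hU.preimage (continuous_id.add continuous_const)

theorem continuousAdd_of_isOpenQuotientMap [ContinuousAdd A] {π : A →ₗ[ℂ] B}
    (hπ : IsOpenQuotientMap π) : ContinuousAdd B := by
  refine ⟨(hπ.prodMap hπ).isQuotientMap.continuous_iff.2 ?_⟩
  have : (fun p : B × B => p.1 + p.2) ∘ Prod.map π π = π ∘ fun p : A × A => p.1 + p.2 :=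
    funext fun p => (map_add π _ _).symm
  rw [this]
  exact hπ.continuous.comp continuous_add

theorem continuousSMul_of_isOpenQuotientMap [ContinuousSMul ℂ A] {π : A →ₗ[ℂ] B}
    (hπ : IsOpenQuotientMap π) : ContinuousSMul ℂ B := by
  refine ⟨((IsOpenQuotientMap.id (X := ℂ)).prodMap hπ).isQuotientMap.continuous_iff.2 ?_⟩
  have : (fun p : ℂ × B => p.1 • p.2) ∘ Prod.map id π = π ∘ fun p : ℂ × A => p.1 • p.2 :=
    funext fun p => (map_smul π _ _).symm
  rw [this]
  exact hπ.continuous.comp continuous_smul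

end Quotient

attribute [local instance] Loop.baseTopology

section Range

variable (b : Base)

theorem isOpenQuotientMap_rangeRestrict : IsOpenQuotientMap (LinearMap.rangeRestrict b.toDistr) :=
  isOpenQuotientMap_of_eq_coinduced _ (LinearMap.surjective_rangeRestrict _) rfl

theorem continuousAdd_range : ContinuousAdd (LinearMap.range b.toDistr) :=
  continuousAdd_of_isOpenQuotientMap (isOpenQuotientMap_rangeRestrict b)

theorem continuousSMul_range : ContinuousSMul ℂ (LinearMap.range b.toDistr) :=
  continuousSMul_of_isOpenQuotientMap (isOpenQuotientMap_rangeRestrict b)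

attribute [local instance] continuousAdd_range continuousSMul_range

theorem continuous_mul_range (χ : TestFn) : Continuous fun u : LinearMap.range b.toDistr =>
    (⟨Distr.mul χ u, mul_mem_range χ u.2⟩ : LinearMap.range b.toDistr) := by
  refine (isOpenQuotientMap_rangeRestrict b).isQuotientMap.continuous_iff.2 ?_
  have : (fun u : LinearMap.range b.toDistr =>
      (⟨Distr.mul χ u, mul_mem_range χ u.2⟩ : LinearMap.range b.toDistr)) ∘
        LinearMap.rangeRestrict b.toDistr = LinearMap.rangeRestrict b.toDistr ∘ b.mul χ :=
    funext fun f => Subtype.ext (b.toDistr_mul χ f).symm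
  rw [this]
  exact (isOpenQuotientMap_rangeRestrict b).continuous.comp (b.mul χ).continuous

theorem continuous_primitive_range : Continuous fun u : LinearMap.range b.toDistr =>
    (⟨Distr.primitive u, primitive_mem_range u.2⟩ : LinearMap.range b.toDistr) := by
  refine (isOpenQuotientMap_rangeRestrict b).isQuotientMap.continuous_iff.2 ?_
  have : (fun u : LinearMap.range b.toDistr =>
      (⟨Distr.primitive u, primitive_mem_range u.2⟩ : LinearMap.range b.toDistr)) ∘
        LinearMap.rangeRestrict b.toDistr = LinearMap.rangeRestrict b.toDistr ∘ b.primitive :=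
    funext fun f => Subtype.ext (b.toDistr_primitive f).symm
  rw [this]
  exact (isOpenQuotientMap_rangeRestrict b).continuous.comp b.primitive.continuous

theorem continuous_pair_range (φ : TestFn) :
    Continuous fun u : LinearMap.range b.toDistr => u.1.1 φ :=
  (isOpenQuotientMap_rangeRestrict b).isQuotientMap.continuous_iff.2 (b.pair φ).continuous

end Range

attribute [local instance] continuousAdd_range continuousSMul_range

/-- The space of distributions of regularity `k` on the scale of `b`, with its topology. -/
def Reg (b : Base) (k : WithTop ℤ) : Type := regular b k

namespace Reg

variable {b : Base} {k : WithTop ℤ}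

instance : AddCommGroup (Reg b k) := inferInstanceAs (AddCommGroup (regular b k))
instance : Module ℂ (Reg b k) := inferInstanceAs (Module ℂ (regular b k))

/-- The formula agrees definitionally with the topology of `Loop s` for `Reg s.base s.order`. With b
and k as independent variables, k can be replaced by -n. -/
instance : TopologicalSpace (Reg b k) :=
  (⨅ (j : ℕ) (h : ((j : ℤ) : WithTop ℤ) ≤ k),
    TopologicalSpace.induced
      (fun x : Reg b k => (⟨(Distr.deriv ^ j) x.1, x.2.1 j h⟩ : LinearMap.range b.toDistr))
      (Loop.baseTopology b)) ⊓
  (⨅ (n : ℕ) (_ : 0 < n) (_ : k = ((-n : ℤ) : WithTop ℤ)),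
    TopologicalSpace.coinduced
      (fun f : {f : Fin (n + 1) → b.Fn //
          ∑ j : Fin (n + 1), (Distr.deriv ^ (j : ℕ)) (b.toDistr (f j)) ∈ regular b k} =>
        (⟨_, f.2⟩ : Reg b k))
      inferInstance)

/-- The `j`'th derivative. -/
def comp (j : ℕ) (h : ((j : ℤ) : WithTop ℤ) ≤ k) (x : Reg b k) : LinearMap.range b.toDistr :=
  ⟨(Distr.deriv ^ j) x.1, x.2.1 j h⟩

theorem continuous_comp (j : ℕ) (h : ((j : ℤ) : WithTop ℤ) ≤ k) :
    Continuous (comp j h : Reg b k → _) :=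
  continuous_iff_le_induced.2 (inf_le_left.trans (iInf₂_le j h))

/-- For k ≥ 0 the second infimum in the topology runs over an empty family. -/
theorem continuous_iff (hk : 0 ≤ k) {X : Type*} [TopologicalSpace X] {f : X → Reg b k} :
    Continuous f ↔ ∀ j h, Continuous fun x => comp j h (f x) := by
  refine ⟨fun hf j h => (continuous_comp j h).comp hf, fun H => ?_⟩
  refine continuous_inf_rng.2 ⟨continuous_iInf_rng.2 fun j => continuous_iInf_rng.2 fun h =>
    continuous_induced_rng.2 (H j h), continuous_iInf_rng.2 fun n => continuous_iInf_rng.2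
      fun hn => continuous_iInf_rng.2 fun hkn => ?_⟩
  rw [hkn] at hk
  have := WithTop.coe_le_coe.1 hk
  omega

/-- The map `(f₀, …, fₙ) ↦ ∑ Dʲ fⱼ` onto the space of regularity `-n`. -/
def sumDeriv (b : Base) (n : ℕ) : (Fin (n + 1) → b.Fn) →ₗ[ℂ] Reg b ((-n : ℤ) : WithTop ℤ) where
  toFun f := ⟨b.sumDeriv n f, mem_regular_neg.2 ⟨f, rfl⟩⟩
  map_add' f g := Subtype.ext (map_add _ f g)
  map_smul' c f := Subtype.ext (map_smul _ c f)

/-- For n > 0 only the coinduced topology with index n remains, and the membership condition in its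
domain always holds. For n = 0 the topology is instead the one induced by the derivative of order 0,
and the map is evaluation at 0 followed by the quotient map of the base space. -/
theorem isOpenQuotientMap_sumDeriv (b : Base) (n : ℕ) : IsOpenQuotientMap (sumDeriv b n) := by
  have hsurj : Function.Surjective (sumDeriv b n) := by
    rintro ⟨u, hu⟩
    obtain ⟨f, rfl⟩ := mem_regular_neg.1 hu
    exact ⟨f, rfl⟩
  rcases Nat.eq_zero_or_pos n with rfl | hn
  · have h0 : (((0 : ℕ) : ℤ) : WithTop ℤ) ≤ ((-(0 : ℕ) : ℤ) : WithTop ℤ) := by simp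
    have hcomp : ∀ f, comp 0 h0 (sumDeriv b 0 f) = LinearMap.rangeRestrict b.toDistr (f 0) :=
      fun f => Subtype.ext (Base.sumDeriv_zero f)
    refine ⟨hsurj, (continuous_iff (by simp)).2 fun j hj => ?_, fun U hU => ?_⟩
    · obtain rfl : j = 0 := by
        have := WithTop.coe_le_coe.1 hj
        push_cast at this
        omega
      simp only [hcomp]
      exact (isOpenQuotientMap_rangeRestrict b).continuous.comp (continuous_apply 0)
    · have : sumDeriv b 0 '' U = comp 0 h0 ⁻¹'
          (LinearMap.rangeRestrict b.toDistr '' ((fun f : Fin 1 → b.Fn => f 0) '' U)) := by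
        ext x
        constructor
        · rintro ⟨f, hf, rfl⟩
          exact ⟨f 0, ⟨f, hf, rfl⟩, (hcomp f).symm⟩
        · rintro ⟨_, ⟨f, hf, rfl⟩, h⟩
          refine ⟨f, hf, Subtype.ext ?_⟩
          have := congrArg Subtype.val ((hcomp f).trans h)
          exact this
      rw [this]
      refine IsOpen.preimage (continuous_comp 0 h0) ?_
      exact (isOpenQuotientMap_rangeRestrict b).isOpenMap _ (isOpenMap_eval 0 _ hU)
  · refine isOpenQuotientMap_of_eq_coinduced _ hsurj ?_
    apply le_antisymm
    · refine inf_le_right.trans ((iInf_le _ n).trans ((iInf_le _ hn).trans ((iInf_le _ rfl).trans ?_)))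
      refine continuous_iff_coinduced_le.1 ?_
      refine @Continuous.comp _ _ _ _ _ (.coinduced (sumDeriv b n) inferInstance) _ _
        continuous_coinduced_rng continuous_subtype_val
    · refine le_inf (le_iInf₂ fun j hj => ?_) (le_iInf₂ fun m hm => le_iInf fun hmn => ?_)
      · have := WithTop.coe_le_coe.1 hj
        omega
      · obtain rfl : n = m := by
          have := WithTop.coe_inj.1 hmn
          omega
        refine continuous_iff_coinduced_le.1 ?_
        refine @Continuous.comp _ _ _ _ _ (.coinduced (fun f : {f : Fin (n + 1) → b.Fn //
            ∑ j : Fin (n + 1), (Distr.deriv ^ (j : ℕ)) (b.toDistr (f j)) ∈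
              regular b ((-n : ℤ) : WithTop ℤ)} => (⟨_, f.2⟩ : Reg b ((-n : ℤ) : WithTop ℤ)))
            inferInstance) (fun f => ⟨f, mem_regular_neg.2 ⟨f, rfl⟩⟩) _
          continuous_coinduced_rng (by fun_prop)

instance : ContinuousAdd (Reg b k) := by
  rcases nonneg_or_neg k with hk | ⟨n, rfl⟩
  · refine ⟨(continuous_iff hk).2 fun j h => ?_⟩
    have : (fun p : Reg b k × Reg b k => comp j h (p.1 + p.2)) =
        fun p => comp j h p.1 + comp j h p.2 := funext fun p => Subtype.ext (map_add _ _ _)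
    rw [this]
    exact ((continuous_comp j h).comp continuous_fst).add
      ((continuous_comp j h).comp continuous_snd)
  · exact continuousAdd_of_isOpenQuotientMap (isOpenQuotientMap_sumDeriv b n)

instance : ContinuousSMul ℂ (Reg b k) := by
  rcases nonneg_or_neg k with hk | ⟨n, rfl⟩
  · refine ⟨(continuous_iff hk).2 fun j h => ?_⟩
    have : (fun p : ℂ × Reg b k => comp j h (p.1 • p.2)) =
        fun p => p.1 • comp j h p.2 := funext fun p => Subtype.ext (map_smul _ _ _)
    rw [this]
    exact continuous_fst.smul ((continuous_comp j h).comp continuous_snd)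
  · exact continuousSMul_of_isOpenQuotientMap (isOpenQuotientMap_sumDeriv b n)

theorem continuous_pair (φ : TestFn) : Continuous fun x : Reg b k => x.1.1 φ := by
  rcases nonneg_or_neg k with hk | ⟨n, rfl⟩
  · exact (continuous_pair_range b φ).comp (continuous_comp 0 (by simpa using hk))
  · refine (isOpenQuotientMap_sumDeriv b n).isQuotientMap.continuous_iff.2 ?_
    have : ((fun x : Reg b ((-n : ℤ) : WithTop ℤ) => x.1.1 φ) ∘ sumDeriv b n) =
        fun f => ∑ j : Fin (n + 1), (-1) ^ (j : ℕ) * b.pair ((TestFn.deriv ^ (j : ℕ)) φ) (f j) := by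
      funext f
      change Distr.pair φ (b.sumDeriv n f) = _
      rw [Base.sumDeriv_apply, map_sum]
      exact Finset.sum_congr rfl fun j _ => Distr.deriv_pow_apply _ _ _
    rw [this]
    exact continuous_finsetSum _ fun j _ =>
      continuous_const.mul ((b.pair _).continuous.comp (continuous_apply j))

/-- A regular distribution as an element of `Reg`. -/
def mk (u : Distr) (hu : u ∈ regular b k) : Reg b k := ⟨u, hu⟩

theorem continuous_mul (χ : TestFn) :
    Continuous fun x : Reg b k => mk (Distr.mul χ x.1) (mul_mem_regular χ x.2) := by
  rcases nonneg_or_neg k with hk | ⟨n, rfl⟩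
  · refine (continuous_iff hk).2 fun j h => ?_
    obtain ⟨ψ, hψ⟩ := Distr.exists_deriv_pow_mul j χ
    have hle : ∀ i : Fin (j + 1), (((i : ℕ) : ℤ) : WithTop ℤ) ≤ k := fun i => le_trans (by
      rw [WithTop.coe_le_coe]
      have := i.2
      omega) h
    have : (fun x : Reg b k => comp j h (mk (Distr.mul χ x.1) (mul_mem_regular χ x.2))) =
        fun x => ∑ i : Fin (j + 1), (⟨Distr.mul (ψ i) (comp i (hle i) x),
          mul_mem_range (ψ i) (comp i (hle i) x).2⟩ : LinearMap.range b.toDistr) := by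
      funext x
      refine Subtype.ext ?_
      rw [AddSubmonoidClass.coe_finsetSum]
      refine (hψ x.1).trans ?_
      rw [← Fin.sum_univ_eq_sum_range (fun i => Distr.mul (ψ i) ((Distr.deriv ^ i) x.1)) (j + 1)]
      rfl
    rw [this]
    exact continuous_finsetSum _ fun i _ =>
      (continuous_mul_range b (ψ i)).comp (continuous_comp i (hle i))
  · obtain ⟨A, hA, hAf⟩ := b.exists_mul_sumDeriv n χ
    refine (isOpenQuotientMap_sumDeriv b n).isQuotientMap.continuous_iff.2 ?_
    have : ((fun x : Reg b ((-n : ℤ) : WithTop ℤ) =>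
        mk (Distr.mul χ x.1) (mul_mem_regular χ x.2)) ∘
          sumDeriv b n) = sumDeriv b n ∘ A := funext fun f => Subtype.ext (hAf f)
    rw [this]
    exact (isOpenQuotientMap_sumDeriv b n).continuous.comp hA

theorem continuous_deriv : Continuous fun x : Reg b k =>
    mk (Distr.deriv x.1) (deriv_mem_regular b k x.1 x.2) := by
  rcases pred_cases k with ⟨hk, hk', hj⟩ | ⟨n, rfl, hk'⟩
  · refine (continuous_iff hk').2 fun j h => ?_
    have : (fun x : Reg b k => comp j h
        (mk (Distr.deriv x.1) (deriv_mem_regular b k x.1 x.2))) =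
        fun x => comp (j + 1) ((hj j).1 h) x :=
      funext fun x => Subtype.ext (Distr.deriv_pow_succ j x.1).symm
    rw [this]
    exact continuous_comp _ _
  -- The shifted order equals -(n + 1) only propositionally; it is made a variable so that it can be
  -- substituted in the type `Reg b k'`.
  · have key : ∀ (k' : WithTop ℤ) (_ : k' = ((-(n + 1 : ℕ) : ℤ) : WithTop ℤ))
        (hm : ∀ x : Reg b ((-n : ℤ) : WithTop ℤ), Distr.deriv x.1 ∈ regular b k'),
        Continuous fun x : Reg b ((-n : ℤ) : WithTop ℤ) => mk (Distr.deriv x.1) (hm x) := by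
      rintro _ rfl hm
      refine (isOpenQuotientMap_sumDeriv b n).isQuotientMap.continuous_iff.2 ?_
      have : ((fun x : Reg b ((-n : ℤ) : WithTop ℤ) =>
          mk (Distr.deriv x.1) (hm x)) ∘ sumDeriv b n) =
          sumDeriv b (n + 1) ∘ fun f => Fin.cons 0 f := funext fun f => Subtype.ext (by
        change Distr.deriv (b.sumDeriv n f) = b.sumDeriv (n + 1) (Fin.cons 0 f)
        rw [Base.sumDeriv_succ, Fin.cons_zero, map_zero, zero_add]
        rfl)
      rw [this]
      exact (isOpenQuotientMap_sumDeriv b (n + 1)).continuous.comp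
        (continuous_pi fun j => Fin.cases continuous_const (fun j => continuous_apply j) j)
    exact key _ hk' _

theorem continuous_primitive : Continuous fun x : Reg b (k.map (· - 1)) =>
    (mk (Distr.primitive x.1) (primitive_mem_regular x.2) : Reg b k) := by
  rcases pred_cases k with ⟨hk, hk', hj⟩ | ⟨n, rfl, hk'⟩
  · refine (continuous_iff hk).2 fun j h => ?_
    rcases j with - | j
    · exact (continuous_primitive_range b).comp (continuous_comp 0 (by simpa using hk'))
    · have hjk := (hj j).2 h
      let o : Reg b (k.map (· - 1)) := ⟨Distr.ofTest TestFn.one, ofTest_mem_regular _⟩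
      have hsub : ∀ (u v : Distr) (c : ℂ), u - c • v = u + (-c) • v := fun u v c =>
        Distr.ext fun φ => by
          rw [Distr.sub_apply, Distr.add_apply, Distr.smul_apply, Distr.smul_apply]
          ring
      have : (fun x : Reg b (k.map (· - 1)) => comp (j + 1) h
          (mk (Distr.primitive x.1) (primitive_mem_regular x.2) : Reg b k)) =
          fun x => comp j hjk x + (-(x.1.1 TestFn.one)) • comp j hjk o :=
        funext fun x => Subtype.ext ((deriv_pow_primitive_succ j x.1).trans (hsub _ _ _))
      rw [this]
      exact (continuous_comp j hjk).add ((continuous_pair _).neg.smul continuous_const)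
  · have key : ∀ (k' : WithTop ℤ) (_ : k' = ((-(n + 1 : ℕ) : ℤ) : WithTop ℤ))
        (hm : ∀ x : Reg b k', Distr.primitive x.1 ∈ regular b ((-n : ℤ) : WithTop ℤ)),
        Continuous fun x : Reg b k' =>
          mk (Distr.primitive x.1) (hm x) := by
      rintro _ rfl hm
      refine (isOpenQuotientMap_sumDeriv b (n + 1)).isQuotientMap.continuous_iff.2 ?_
      have : ((fun x : Reg b ((-(n + 1 : ℕ) : ℤ) : WithTop ℤ) =>
          mk (Distr.primitive x.1) (hm x)) ∘ sumDeriv b (n + 1)) =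
          sumDeriv b n ∘ fun f => ((fun j => f j.succ) + Pi.single 0
            (b.primitive (f 0) - b.pair TestFn.one (f 1) • b.ofTest TestFn.one)) :=
        funext fun f => Subtype.ext (Base.primitive_sumDeriv_succ n f)
      rw [this]
      refine (isOpenQuotientMap_sumDeriv b n).continuous.comp (Continuous.add
        (continuous_pi fun j => continuous_apply _) ((continuous_single 0).comp ?_))
      exact (b.primitive.continuous.comp (continuous_apply 0)).sub
        (((b.pair TestFn.one).continuous.comp (continuous_apply 1)).smul continuous_const)
    exact key _ hk' _

end Reg

namespace Loop

variable {s : SmoothnessClass}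

instance : ContinuousAdd (Loop s) :=
  inferInstanceAs (ContinuousAdd (Reg s.base s.order))

instance : ContinuousSMul ℂ (Loop s) :=
  inferInstanceAs (ContinuousSMul ℂ (Reg s.base s.order))

@[ext] theorem ext {x y : Loop s} (h : x.toDistr = y.toDistr) : x = y := Subtype.ext h

theorem toDistr_add (x y : Loop s) : (x + y).toDistr = x.toDistr + y.toDistr := rfl

theorem toDistr_smul (c : ℂ) (x : Loop s) : (c • x).toDistr = c • x.toDistr := rfl

theorem toDistr_zero : (0 : Loop s).toDistr = 0 := rfl

theorem toDistr_deriv (x : Loop s) : x.deriv.toDistr = Distr.deriv x.toDistr := rfl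

/-- Multiplication by a test function. -/
def mul : TestFn →ₗ[ℂ] Loop s →ₗ[ℂ] Loop s :=
  LinearMap.mk₂ ℂ (fun χ x => ⟨Distr.mul χ x.1, mul_mem_regular χ x.2⟩)
    (fun χ ψ x => ext (LinearMap.map_add₂ Distr.mul χ ψ x.toDistr))
    (fun c χ x => ext (LinearMap.map_smul₂ Distr.mul c χ x.toDistr))
    (fun χ _ _ => ext (map_add (Distr.mul χ) _ _))
    (fun _ χ _ => ext (map_smul (Distr.mul χ) _ _))

theorem continuous_mul (χ : TestFn) : Continuous (mul χ : Loop s → Loop s) :=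
  Reg.continuous_mul (b := s.base) (k := s.order) χ

theorem continuous_deriv : Continuous (deriv : Loop s → Loop s.pred) := by
  cases s with
  | C k => exact Reg.continuous_deriv (b := Base.cont) (k := k)
  | W k p hp => exact Reg.continuous_deriv (b := Base.leb p hp) (k := (k : WithTop ℤ))

/-- The primitive of `x - ∫ x` with mean `0`. -/
def primitive : Loop s.pred →ₗ[ℂ] Loop s where
  toFun x := ⟨Distr.primitive x.1, primitive_mem_regular (by
    rw [← SmoothnessClass.regular_pred]
    exact x.2)⟩
  map_add' _ _ := ext (map_add Distr.primitive _ _)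
  map_smul' _ _ := ext (map_smul Distr.primitive _ _)

theorem toDistr_primitive (x : Loop s.pred) :
    (primitive x).toDistr = Distr.primitive x.toDistr := rfl

theorem continuous_primitive : Continuous (primitive : Loop s.pred → Loop s) := by
  cases s with
  | C k => exact Reg.continuous_primitive (b := Base.cont) (k := k)
  | W k p hp => exact Reg.continuous_primitive (b := Base.leb p hp) (k := (k : WithTop ℤ))

/-- A test function regarded as a loop. -/
def ofTest : TestFn →ₗ[ℂ] Loop s where
  toFun χ := ⟨Distr.ofTest χ, ofTest_mem_regular χ⟩
  map_add' _ _ := ext (map_add Distr.ofTest _ _)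
  map_smul' _ _ := ext (map_smul Distr.ofTest _ _)

theorem toDistr_ofTest (χ : TestFn) : (ofTest χ : Loop s).toDistr = Distr.ofTest χ := rfl

/-- The integral of a loop over the circle. -/
def integral : Loop s →ₗ[ℂ] ℂ where
  toFun x := Distr.integral x.toDistr
  map_add' _ _ := rfl
  map_smul' _ _ := rfl

theorem integral_apply (x : Loop s) : integral x = Distr.integral x.toDistr := rfl

theorem continuous_integral : Continuous (integral : Loop s → ℂ) :=
  Reg.continuous_pair (b := s.base) (k := s.order) TestFn.one

theorem mul_one (x : Loop s) : mul TestFn.one x = x := ext (Distr.mul_one _)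

theorem integral_ofTest (χ : TestFn) : integral (ofTest χ : Loop s) = TestFn.integral χ :=
  Distr.integral_ofTest χ

theorem mul_ofTest_one (χ : TestFn) : mul χ (ofTest TestFn.one : Loop s) = ofTest χ :=
  ext (Distr.mul_ofTest_one χ)

end Loop

/-! ### Directional derivatives of holomorphic functions -/

section Directional

variable {E : Type} [AddCommGroup E] [Module ℂ E] [TopologicalSpace E] {f g : E → ℂ}

/-- The derivative of `f` in the direction `p`. -/
def dirDeriv (p : E) (f : E → ℂ) (y : E) : ℂ := deriv (fun c : ℂ => f (y + c • p)) 0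

theorem IsHolomorphic.hasDerivAt (hf : IsHolomorphic f) (p y : E) (c : ℂ) :
    HasDerivAt (fun c : ℂ => f (y + c • p)) (dirDeriv p f (y + c • p)) c := by
  have h := (hf.2 y p c).hasDerivAt
  have : dirDeriv p f (y + c • p) = deriv (fun c : ℂ => f (y + c • p)) c := by
    have h1 := deriv_comp_const_add (f := fun c : ℂ => f (y + c • p)) c 0
    rw [add_zero] at h1
    rw [← h1, dirDeriv]
    simp only [add_smul, add_assoc]
  rwa [this]

theorem IsHolomorphic.dirDeriv_eq_integral (hf : IsHolomorphic f) (p y : E) :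
    dirDeriv p f y = ∫ θ : unitInterval, (circ θ)⁻¹ * f (y + circ θ • p) := by
  have := integral_circ_inv_mul (hf.2 y p) 0
  simp only [zero_add] at this
  exact this.symm

theorem continuous_circ_inv : Continuous fun θ : unitInterval => (circ θ)⁻¹ :=
  continuous_circ.inv₀ circ_ne_zero

theorem dirDeriv_add_fun (hf : IsHolomorphic f) (hg : IsHolomorphic g) (p : E) :
    dirDeriv p (f + g) = dirDeriv p f + dirDeriv p g :=
  funext fun y => deriv_add (hf.2 y p 0) (hg.2 y p 0)

theorem dirDeriv_smul_fun (hf : IsHolomorphic f) (c : ℂ) (p : E) :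
    dirDeriv p (c • f) = c • dirDeriv p f :=
  funext fun y => deriv_const_mul c (hf.2 y p 0)

theorem dirDeriv_smul (hf : IsHolomorphic f) (c : ℂ) (p : E) :
    dirDeriv (c • p) f = c • dirDeriv p f := by
  funext y
  have h := hf.hasDerivAt p y (0 * c)
  have h1 := HasDerivAt.comp (0 : ℂ) h ((hasDerivAt_id (0 : ℂ)).mul_const c)
  simp only [Function.comp_def, id, mul_smul, zero_mul, zero_smul, add_zero, one_mul] at h1
  exact h1.deriv.trans (mul_comm _ _)

theorem add_eq_of_dirDeriv_eq_zero (hf : IsHolomorphic f) {p : E} (h : ∀ y, dirDeriv p f y = 0)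
    (y : E) : f (y + p) = f y := by
  have := is_const_of_deriv_eq_zero (hf.2 y p)
    (fun c => (hf.hasDerivAt p y c).deriv.trans (h _)) 1 0
  simpa using this

variable [ContinuousAdd E] [ContinuousSMul ℂ E]

/-- As a Cauchy integral over a compact circle, the directional derivative inherits continuity and
holomorphy along lines from f. -/
theorem IsHolomorphic.dirDeriv (hf : IsHolomorphic f) (p : E) : IsHolomorphic (dirDeriv p f) := by
  have hfun : LoopSpaces.dirDeriv p f =
      fun y => ∫ θ : unitInterval, (circ θ)⁻¹ * f (y + circ θ • p) :=
    funext fun y => hf.dirDeriv_eq_integral p y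
  rw [hfun]
  have hc1 := hf.1
  have hc2 := continuous_circ
  have hc3 := continuous_circ_inv
  refine ⟨continuous_integral_of_compact _ ?_, fun x v => ?_⟩
  · change Continuous fun a : E × unitInterval => (circ a.2)⁻¹ * f (a.1 + circ a.2 • p)
    fun_prop (disch := exact fun _ => circ_ne_zero _)
  · refine differentiable_integral_of_compact _ (f := fun (c : ℂ) (θ : unitInterval) =>
      (circ θ)⁻¹ * f (x + c • v + circ θ • p)) ?_ fun θ => ?_
    · change Continuous fun a : ℂ × unitInterval =>
        (circ a.2)⁻¹ * f (x + a.1 • v + circ a.2 • p)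
      fun_prop (disch := exact fun _ => circ_ne_zero _)
    · have := (hf.2 (x + circ θ • p) v).const_mul (circ θ)⁻¹
      simpa only [add_right_comm] using this

/-- On the plane y + span(p, q) the function is holomorphic in two variables by Osgood's lemma, so
its derivative there is linear. -/
theorem dirDeriv_add (hf : IsHolomorphic f) (p q : E) :
    dirDeriv (p + q) f = dirDeriv p f + dirDeriv q f := by
  funext y
  have hF : Differentiable ℂ fun z : ℂ × ℂ => f (y + z.1 • p + z.2 • q) := by
    refine differentiable_of_separately ?_ (fun w => ?_) fun z => hf.2 (y + z • p) q
    · have := hf.1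
      fun_prop
    · have := hf.2 (y + w • q) p
      simpa only [add_right_comm] using this
  have h1 : HasDerivAt (fun c : ℂ => f (y + c • (p + q)))
      (fderiv ℂ (fun z : ℂ × ℂ => f (y + z.1 • p + z.2 • q)) (0, 0) (1, 1)) 0 := by
    have := (hF (0, 0)).hasFDerivAt.comp_hasDerivAt (f := fun c : ℂ => (c, c)) (0 : ℂ)
      ((hasDerivAt_id (0 : ℂ)).prodMk (hasDerivAt_id (0 : ℂ)))
    simpa only [Function.comp_def, id, smul_add, add_assoc] using this
  have h2 : HasDerivAt (fun c : ℂ => f (y + c • p))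
      (fderiv ℂ (fun z : ℂ × ℂ => f (y + z.1 • p + z.2 • q)) (0, 0) (1, 0)) 0 := by
    have := (hF (0, 0)).hasFDerivAt.comp_hasDerivAt (f := fun c : ℂ => (c, 0)) (0 : ℂ)
      ((hasDerivAt_id (0 : ℂ)).prodMk (hasDerivAt_const (0 : ℂ) (0 : ℂ)))
    simpa only [Function.comp_def, id, zero_smul, add_zero] using this
  have h3 : HasDerivAt (fun c : ℂ => f (y + c • q))
      (fderiv ℂ (fun z : ℂ × ℂ => f (y + z.1 • p + z.2 • q)) (0, 0) (0, 1)) 0 := by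
    have := (hF (0, 0)).hasFDerivAt.comp_hasDerivAt (f := fun c : ℂ => (0, c)) (0 : ℂ)
      ((hasDerivAt_const (0 : ℂ) (0 : ℂ)).prodMk (hasDerivAt_id (0 : ℂ)))
    simpa only [Function.comp_def, id, zero_smul, add_zero] using this
  rw [Pi.add_apply, dirDeriv, dirDeriv, dirDeriv, h1.deriv, h2.deriv, h3.deriv, ← map_add]
  simp

/-- Fubini's theorem for the two Cauchy integrals. -/
theorem dirDeriv_comm (hf : IsHolomorphic f) (p q : E) :
    dirDeriv q (dirDeriv p f) = dirDeriv p (dirDeriv q f) := by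
  funext y
  rw [(hf.dirDeriv p).dirDeriv_eq_integral, (hf.dirDeriv q).dirDeriv_eq_integral]
  simp only [hf.dirDeriv_eq_integral, ← integral_const_mul]
  rw [integral_integral_swap]
  · refine integral_congr_ae (Eventually.of_forall fun θ => integral_congr_ae
      (Eventually.of_forall fun η => ?_))
    simp only
    rw [mul_left_comm, add_right_comm]
  · have hc1 := hf.1
    have hc2 := continuous_circ
    have hc3 := continuous_circ_inv
    have hc : Continuous (Function.uncurry fun θ η : unitInterval =>
        (circ θ)⁻¹ * ((circ η)⁻¹ * f (y + circ θ • q + circ η • p))) := by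
      change Continuous fun a : unitInterval × unitInterval =>
        (circ a.1)⁻¹ * ((circ a.2)⁻¹ * f (y + circ a.1 • q + circ a.2 • p))
      fun_prop (disch := exact fun _ => circ_ne_zero _)
    exact ContinuousMap.integrable_of_compact _ ⟨_, hc⟩

/-- The Hessian of `f` at `y`. -/
def hessian (f : E → ℂ) (hf : IsHolomorphic f) (y : E) : E →ₗ[ℂ] E →ₗ[ℂ] ℂ :=
  LinearMap.mk₂ ℂ (fun p q => dirDeriv q (dirDeriv p f) y)
    (fun p p' q => by
      rw [dirDeriv_add hf, dirDeriv_add_fun (hf.dirDeriv p) (hf.dirDeriv p')]; rfl)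
    (fun c p q => by rw [dirDeriv_smul hf, dirDeriv_smul_fun (hf.dirDeriv p)]; rfl)
    (fun p q q' => by rw [dirDeriv_add (hf.dirDeriv p)]; rfl)
    (fun c p q => by rw [dirDeriv_smul (hf.dirDeriv p)]; rfl)

theorem hessian_apply (hf : IsHolomorphic f) (y p q : E) :
    hessian f hf y p q = dirDeriv q (dirDeriv p f) y := rfl

theorem hessian_symm (hf : IsHolomorphic f) (y p q : E) :
    hessian f hf y p q = hessian f hf y q p :=
  congrFun (dirDeriv_comm hf p q) y

/-- If the Hessian vanishes on (p, q), the derivative in the direction p is invariant under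
translation by q, so the difference f(· + q) - f is constant in the direction p. -/
theorem add_add_eq_of_hessian_eq_zero (hf : IsHolomorphic f) {p q : E}
    (h : ∀ y, hessian f hf y p q = 0) (y : E) : f (y + p + q) = f (y + p) + f (y + q) - f y := by
  have h1 := add_eq_of_dirDeriv_eq_zero (hf.dirDeriv p) h
  have hd : ∀ c : ℂ, HasDerivAt (fun c : ℂ => f (y + q + c • p) - f (y + c • p)) 0 c := fun c => by
    have := (hf.hasDerivAt p (y + q) c).sub (hf.hasDerivAt p y c)
    rwa [add_right_comm, h1, sub_self] at this
  have := is_const_of_deriv_eq_zero (fun c => (hd c).differentiableAt) (fun c => (hd c).deriv) 1 0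
  simp only [one_smul, zero_smul, add_zero] at this
  rw [add_right_comm y p q]
  linear_combination this

theorem hessian_eq_zero_of_add_add_eq (hf : IsHolomorphic f) {p q : E}
    (h : ∀ (y : E) (c d : ℂ), f (y + c • p + d • q) = f (y + c • p) + f (y + d • q) - f y) (y : E) :
    hessian f hf y p q = 0 := by
  have h1 : ∀ d : ℂ, dirDeriv p f (y + d • q) = dirDeriv p f y := by
    intro d
    have : (fun c : ℂ => f (y + d • q + c • p)) =
        fun c => f (y + c • p) + (f (y + d • q) - f y) := funext fun c => by
      rw [add_right_comm, h]; ring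
    rw [dirDeriv, this, deriv_add_const]
    rfl
  rw [hessian_apply, dirDeriv]
  simp only [h1, deriv_const]

end Directional

/-! ### Additive holomorphic functions -/

section Additive

variable {s : SmoothnessClass} {f : Loop s → ℂ}

/-- `f(x + y) = f(x) + f(y)` if `x` and `y` have disjoint supports. -/
def LocallyAdditive (f : Loop s → ℂ) : Prop :=
  ∀ x y : Loop s, Disjoint (Distr.supp x.toDistr) (Distr.supp y.toDistr) → f (x + y) = f x + f y

namespace Loop

theorem supp_add_subset {x y : Loop s} {A : Set UnitAddCircle} (hx : Distr.supp x.toDistr ⊆ A)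
    (hy : Distr.supp y.toDistr ⊆ A) : Distr.supp (x + y).toDistr ⊆ A :=
  (Distr.supp_add _ _).trans (union_subset hx hy)

theorem supp_smul_subset {x : Loop s} {A : Set UnitAddCircle} (hx : Distr.supp x.toDistr ⊆ A)
    (c : ℂ) : Distr.supp (c • x).toDistr ⊆ A :=
  (Distr.supp_smul _ _).trans hx

theorem supp_sum_subset {ι : Type*} {S : Finset ι} {x : ι → Loop s} {A : Set UnitAddCircle}
    (hx : ∀ i ∈ S, Distr.supp (x i).toDistr ⊆ A) : Distr.supp (∑ i ∈ S, x i).toDistr ⊆ A := by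
  classical
  induction S using Finset.induction_on with
  | empty =>
    rw [Finset.sum_empty, toDistr_zero, Distr.supp_zero]
    exact empty_subset A
  | insert i S hi ih =>
    rw [Finset.sum_insert hi]
    exact supp_add_subset (hx i (Finset.mem_insert_self i S))
      (ih fun j hj => hx j (Finset.mem_insert_of_mem hj))

/-- A loop supported in the union of two disjoint closed sets is the sum of two loops supported in
either. -/
theorem exists_split {A B : Set UnitAddCircle} (hA : IsClosed A) (hB : IsClosed B)
    (hAB : Disjoint A B) {x : Loop s} (hx : Distr.supp x.toDistr ⊆ A ∪ B) :
    ∃ u v : Loop s, x = u + v ∧ Distr.supp u.toDistr ⊆ A ∧ Distr.supp v.toDistr ⊆ B := by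
  obtain ⟨θ, h1, h0, -⟩ := TestFn.exists_cutoff hA hB hAB
  refine ⟨mul θ x, mul (TestFn.one - θ) x, ?_, fun t ht => ?_, fun t ht => ?_⟩
  · rw [map_sub, LinearMap.sub_apply, mul_one, add_sub_cancel]
  · refine (hx (Distr.supp_mul_right θ _ ht)).resolve_right fun htB => ?_
    exact disjoint_left.1 (TestFn.disjoint_tsupport h0) (Distr.supp_mul_left θ _ ht) htB
  · refine (hx (Distr.supp_mul_right (TestFn.one - θ) _ ht)).resolve_left fun htA => ?_
    exact disjoint_left.1 (TestFn.disjoint_tsupport_one_sub h1) (Distr.supp_mul_left _ _ ht) htA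

end Loop

/-- Each of the four arguments splits into a part in A and a part in B, and the values split
accordingly. -/
theorem LocallyAdditive.add_add_eq_of_split (hf : LocallyAdditive f) {A B : Set UnitAddCircle}
    (hA : IsClosed A) (hB : IsClosed B) (hAB : Disjoint A B) {x z y : Loop s}
    (hx : Distr.supp x.toDistr ⊆ A) (hz : Distr.supp z.toDistr ⊆ B)
    (hy : Distr.supp y.toDistr ⊆ A ∪ B) : f (y + x + z) = f (y + x) + f (y + z) - f y := by
  obtain ⟨u, v, rfl, hu, hv⟩ := Loop.exists_split hA hB hAB hy
  have key : ∀ a b : Loop s, Distr.supp a.toDistr ⊆ A → Distr.supp b.toDistr ⊆ B →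
      f (a + b) = f a + f b := fun a b ha hb => hf a b (hAB.mono ha hb)
  have e1 : u + v + x + z = (u + x) + (v + z) := by abel
  have e2 : u + v + x = (u + x) + v := by abel
  rw [e1, e2, add_assoc u v z, key _ _ (Loop.supp_add_subset hu hx) (Loop.supp_add_subset hv hz),
    key _ _ (Loop.supp_add_subset hu hx) hv, key _ _ hu (Loop.supp_add_subset hv hz), key _ _ hu hv]
  ring

/-- Each cut-off equals one near the support of the preceding one, and all vanish near B. This
produces arbitrarily many successive gaps between the supports of θₙ and of 1 - θₙ₊₁. -/
theorem TestFn.exists_cutoff_chain {A B : Set UnitAddCircle} (hA : IsClosed A) (hB : IsClosed B)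
    (hAB : Disjoint A B) : ∃ θ : ℕ → TestFn, A ⊆ tsupport (θ 0) ∧
      (∀ n, Disjoint (tsupport (θ n)) (tsupport (one - θ (n + 1)))) ∧
      (∀ n, B ⊆ tsupport (one - θ n)) ∧ ∀ n, tsupport (θ n) ⊆ tsupport (θ (n + 1)) ∧
        tsupport (one - θ (n + 1)) ⊆ tsupport (one - θ n) := by
  have step : ∀ A' : Set UnitAddCircle, IsClosed A' ∧ Disjoint A' B → ∃ θ : TestFn,
      (∀ᶠ t in 𝓝ˢ A', θ t = 1) ∧ ∀ᶠ t in 𝓝ˢ B, θ t = 0 := fun A' h => by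
    obtain ⟨θ, h1, h0, -⟩ := exists_cutoff h.1 hB h.2
    exact ⟨θ, h1, h0⟩
  choose! Θ hΘ1 hΘ0 using step
  let S : ℕ → Set UnitAddCircle := fun n => Nat.rec A (fun _ A' => tsupport (Θ A')) n
  have hS : ∀ n, IsClosed (S n) ∧ Disjoint (S n) B := by
    intro n
    induction n with
    | zero => exact ⟨hA, hAB⟩
    | succ n ih => exact ⟨isClosed_tsupport _, disjoint_tsupport (hΘ0 _ ih)⟩
  have hsub : ∀ n, S n ⊆ tsupport (Θ (S n)) := fun n t ht => subset_tsupport _ (by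
    rw [Function.mem_support, (hΘ1 _ (hS n)).self_of_nhdsSet t ht]
    exact one_ne_zero)
  have hdis : ∀ n, Disjoint (S n) (tsupport (one - Θ (S n))) := fun n =>
    (disjoint_tsupport_one_sub (hΘ1 _ (hS n))).symm
  refine ⟨fun n => Θ (S n), hsub 0, fun n => hdis (n + 1), fun n t ht => ?_, fun n =>
    ⟨hsub (n + 1), fun t ht => ?_⟩⟩
  · refine subset_tsupport _ ?_
    rw [Function.mem_support, sub_apply, one_apply, (hΘ0 _ (hS n)).self_of_nhdsSet t ht, sub_zero]
    exact one_ne_zero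
  · by_contra hns
    refine disjoint_left.1 (hdis (n + 1)) (subset_tsupport _ ?_ : t ∈ tsupport (Θ (S n))) ht
    have := image_eq_zero_of_notMem_tsupport hns
    rw [sub_apply, one_apply, sub_eq_zero] at this
    rw [Function.mem_support, ← this]
    exact one_ne_zero

/-- If y vanishes on a gap between the supports of x and z, `add_add_eq_of_split` applies. For
general y, cut out pieces of y over n successive gaps. The error Δ vanishes when any one of these
pieces is removed, so it vanishes to order n along the line c ↦ c y. As n is arbitrary and Δ is
entire on this line, Δ = 0. -/
theorem LocallyAdditive.add_add_eq (ha : LocallyAdditive f) (hf : IsHolomorphic f) {x z : Loop s}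
    (hxz : Disjoint (Distr.supp x.toDistr) (Distr.supp z.toDistr)) (y : Loop s) :
    f (y + x + z) = f (y + x) + f (y + z) - f y := by
  obtain ⟨θ, hθA, hθd, hθB, hθm⟩ := TestFn.exists_cutoff_chain (Distr.isClosed_supp x.toDistr)
    (Distr.isClosed_supp z.toDistr) hxz
  have hmono : Monotone fun n => tsupport (θ n) := monotone_nat_of_le_succ fun n => (hθm n).1
  have hanti : Antitone fun n => tsupport (TestFn.one - θ n) :=
    antitone_nat_of_succ_le fun n => (hθm n).2
  let Δ : Loop s → ℂ := fun w => f (w + x + z) - f (w + x) - f (w + z) + f w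
  have hΔc : Continuous Δ := by
    have := hf.1
    fun_prop
  have hΔd : ∀ w v, Differentiable ℂ fun c : ℂ => Δ (w + c • v) := by
    intro w v
    have h1 := hf.2 (w + x + z) v
    have h2 := hf.2 (w + x) v
    have h3 := hf.2 (w + z) v
    have e1 : (fun c : ℂ => f (w + x + z + c • v)) = fun c => f (w + c • v + x + z) :=
      funext fun c => congrArg f (by abel)
    have e2 : (fun c : ℂ => f (w + x + c • v)) = fun c => f (w + c • v + x) :=
      funext fun c => congrArg f (by abel)
    have e3 : (fun c : ℂ => f (w + z + c • v)) = fun c => f (w + c • v + z) :=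
      funext fun c => congrArg f (by abel)
    rw [e1] at h1
    rw [e2] at h2
    rw [e3] at h3
    exact ((h1.sub h2).sub h3).add (hf.2 w v)
  have hzero : ∀ j w, Distr.supp w.toDistr ⊆ tsupport (θ j) ∪ tsupport (TestFn.one - θ (j + 1)) →
      Δ w = 0 := by
    intro j w hw
    have := ha.add_add_eq_of_split (isClosed_tsupport _) (isClosed_tsupport _) (hθd j)
      (hθA.trans (hmono (Nat.zero_le j))) (hθB (j + 1)) hw
    change f (w + x + z) - f (w + x) - f (w + z) + f w = 0
    rw [this]
    ring
  suffices h : ∀ c : ℂ, Δ (c • y) = 0 by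
    have := h 1
    rw [one_smul] at this
    change f (y + x + z) - f (y + x) - f (y + z) + f y = 0 at this
    linear_combination this
  refine eq_zero_of_isBigO_pow (by simpa using hΔd 0 y) fun n => ?_
  let e : Loop s := Loop.mul (θ 0) y + Loop.mul (TestFn.one - θ n) y
  -- The piece `w i` is the part of y over the i-th gap, and `e` is the part at the two ends.
  -- Together they add up to y.
  let w : Fin n → Loop s := fun i => Loop.mul (θ (i + 1) - θ i) y
  have hsum : ∀ c : ℂ, c • e + ∑ i, c • w i = c • y := by
    intro c
    rw [← Finset.smul_sum, ← smul_add]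
    congr 1
    have : ∑ i, w i = Loop.mul (θ n) y - Loop.mul (θ 0) y := by
      rw [Fin.sum_univ_eq_sum_range (fun i => Loop.mul (θ (i + 1) - θ i) y) n]
      simp only [map_sub, LinearMap.sub_apply]
      exact Finset.sum_range_sub (fun i => Loop.mul (θ i) y) n
    rw [this]
    change Loop.mul (θ 0) y + Loop.mul (TestFn.one - θ n) y + _ = y
    rw [map_sub, LinearMap.sub_apply, Loop.mul_one]
    abel
  -- The pieces receive independent coefficients, so that the Schwarz lemma can be applied in each
  -- of them; afterwards all are set equal to c. The bound C is taken on a compact polydisc and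
  -- serves all c in the unit disc.
  let H : ℂ → (Fin n → ℂ) → ℂ := fun c t => Δ (c • e + ∑ i, t i • w i)
  have hHc : Continuous (Function.uncurry H) := by
    refine hΔc.comp ((continuous_fst.smul continuous_const).add
      (continuous_finsetSum _ fun i _ => ?_))
    exact ((continuous_apply i).comp continuous_snd).smul continuous_const
  obtain ⟨C, hC⟩ := (((isCompact_closedBall (0 : ℂ) 1).prod
    (isCompact_univ_pi fun _ : Fin n => isCompact_closedBall (0 : ℂ) 1)).image
      hHc).isBounded.exists_norm_le
  have key : ∀ c : ℂ, ‖c‖ < 1 → ‖Δ (c • y)‖ ≤ C * ‖c‖ ^ n := by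
    intro c hc
    have := norm_le_mul_prod_of_separately (h := H c) (C := C) (fun t i => ?_) (fun t j hj => ?_)
      (fun t ht => ?_) Finset.univ (fun _ => c) (fun _ => hc)
    · rw [Finset.prod_const, Finset.card_univ, Fintype.card_fin] at this
      change ‖Δ (c • e + ∑ i, c • w i)‖ ≤ _ at this
      rwa [hsum] at this
    · have h1 := hΔd (c • e + ∑ j ∈ Finset.univ.erase i, t j • w j) (w i)
      convert h1 using 2 with d
      change Δ _ = _
      congr 1
      rw [← Finset.add_sum_erase _ _ (Finset.mem_univ i), Function.update_self,
        Finset.sum_congr rfl fun j hj => by rw [Function.update_of_ne (Finset.ne_of_mem_erase hj)]]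
      abel
    · refine hzero j _ (Loop.supp_add_subset (Loop.supp_smul_subset (Loop.supp_add_subset ?_ ?_) c)
        (Loop.supp_sum_subset fun i _ => ?_))
      · exact (Distr.supp_mul_left _ _).trans
          ((hmono (Nat.zero_le j)).trans subset_union_left)
      · exact (Distr.supp_mul_left _ _).trans ((hanti j.2).trans subset_union_right)
      · rcases lt_trichotomy i j with hij | rfl | hij
        · refine Loop.supp_smul_subset ?_ _
          change Distr.supp (Loop.mul (θ (i + 1) - θ i) y).toDistr ⊆ _
          rw [map_sub, LinearMap.sub_apply, sub_eq_add_neg, ← neg_one_smul ℂ]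
          refine Loop.supp_add_subset ?_ (Loop.supp_smul_subset ?_ _)
          · exact (Distr.supp_mul_left _ _).trans ((hmono hij).trans subset_union_left)
          · exact (Distr.supp_mul_left _ _).trans ((hmono hij.le).trans subset_union_left)
        · rw [hj, zero_smul, Loop.toDistr_zero, Distr.supp_zero]
          exact empty_subset _
        · refine Loop.supp_smul_subset ?_ _
          have hij' : (j : ℕ) + 1 ≤ i := hij
          have e1 : θ (i + 1) - θ i = (TestFn.one - θ i) - (TestFn.one - θ (i + 1)) := by abel
          change Distr.supp (Loop.mul (θ (i + 1) - θ i) y).toDistr ⊆ _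
          rw [e1, map_sub, LinearMap.sub_apply, sub_eq_add_neg, ← neg_one_smul ℂ]
          refine Loop.supp_add_subset ?_ (Loop.supp_smul_subset ?_ _)
          · exact (Distr.supp_mul_left _ _).trans
              ((hanti hij').trans subset_union_right)
          · exact (Distr.supp_mul_left _ _).trans
              ((hanti (hij'.trans (Nat.le_succ _))).trans subset_union_right)
    · exact hC _ ⟨(c, t), ⟨mem_closedBall_zero_iff.2 hc.le,
        fun i _ => mem_closedBall_zero_iff.2 (ht i)⟩, rfl⟩
  refine IsBigO.of_bound C ?_
  filter_upwards [Metric.ball_mem_nhds (0 : ℂ) one_pos] with c hc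
  rw [norm_pow]
  exact key c (mem_ball_zero_iff.1 hc)

end Additive

/-! ### Additive holomorphic functions that are invariant under constants -/

section Invariant

variable {s : SmoothnessClass} {f : Loop s → ℂ}

/-- With δ a Lebesgue number and supports in balls of radius δ/4, every support that meets the i-th
one lies within 3δ/4 of the centre of the i-th ball. -/
theorem TestFn.exists_star_partition (W : UnitAddCircle → Set UnitAddCircle)
    (hW : ∀ t, IsOpen (W t)) (hmem : ∀ t, t ∈ W t) :
    ∃ (ι : Type) (_ : Fintype ι) (χ : ι → TestFn), ∑ i, χ i = one ∧ ∀ i, ∃ t,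
      tsupport (χ i) ⊆ W t ∧
        ∀ j, ¬ Disjoint (tsupport (χ i)) (tsupport (χ j)) → tsupport (χ j) ⊆ W t := by
  obtain ⟨δ, hδ, hδW⟩ := lebesgue_number_lemma_of_metric (isCompact_univ (X := UnitAddCircle))
    hW (fun t _ => mem_iUnion.2 ⟨t, hmem t⟩)
  obtain ⟨ι, hι, -, χ, hsum, hχ⟩ := exists_fine_partition (fun t => Metric.ball t (δ / 4))
    (fun _ => Metric.isOpen_ball) fun t => Metric.mem_ball_self (by positivity)
  refine ⟨ι, hι, χ, hsum, fun i => ?_⟩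
  choose x hx using hχ
  obtain ⟨t, ht⟩ := hδW (x i) (mem_univ _)
  refine ⟨t, (hx i).trans ((Metric.ball_subset_ball (by linarith)).trans ht), fun j hij => ?_⟩
  obtain ⟨a, hai, haj⟩ := not_disjoint_iff.1 hij
  refine Subset.trans (fun b hb => ?_) ht
  have h1 := Metric.mem_ball.1 (hx i hai)
  have h2 := Metric.mem_ball.1 (hx j haj)
  have h3 := Metric.mem_ball.1 (hx j hb)
  rw [Metric.mem_ball]
  have h4 := dist_triangle b (x j) (x i)
  have h5 := dist_triangle_left (x j) (x i) a
  linarith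

/-- A symmetric local bilinear form on the loop space that annihilates the constants also vanishes
on loops whose derivatives have disjoint supports. -/
theorem bilin_eq_zero_of_disjoint_deriv (B : Loop s →ₗ[ℂ] Loop s →ₗ[ℂ] ℂ)
    (hsymm : ∀ p q, B p q = B q p)
    (hloc : ∀ p q, Disjoint (Distr.supp p.toDistr) (Distr.supp q.toDistr) → B p q = 0)
    (hone : ∀ q, B (Loop.ofTest TestFn.one) q = 0) {p q : Loop s}
    (hpq : Disjoint (Distr.supp (Distr.deriv p.toDistr)) (Distr.supp (Distr.deriv q.toDistr))) :
    B p q = 0 := by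
  classical
  have hW : ∀ t : UnitAddCircle, ∃ W : Set UnitAddCircle, IsOpen W ∧ t ∈ W ∧ ∃ c : ℂ,
      (∀ χ : TestFn, tsupport χ ⊆ W → Loop.mul χ p = c • Loop.ofTest χ) ∨
      (∀ χ : TestFn, tsupport χ ⊆ W → Loop.mul χ q = c • Loop.ofTest χ) := by
    intro t
    by_cases ht : t ∈ Distr.supp (Distr.deriv p.toDistr)
    · obtain ⟨W, h1, h2, c, hc⟩ := Distr.exists_mul_eq_const (disjoint_left.1 hpq ht)
      exact ⟨W, h1, h2, c, Or.inr fun χ hχ => Loop.ext (hc χ hχ)⟩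
    · obtain ⟨W, h1, h2, c, hc⟩ := Distr.exists_mul_eq_const ht
      exact ⟨W, h1, h2, c, Or.inl fun χ hχ => Loop.ext (hc χ hχ)⟩
  choose W hWo hWm c hc using hW
  obtain ⟨ι, _, χ, hsum, hχ⟩ := TestFn.exists_star_partition W hWo hWm
  choose t ht hstar using hχ
  have hdec : ∀ x : Loop s, ∑ i, Loop.mul (χ i) x = x := fun x => by
    have : ∑ i, Loop.mul (χ i) x = Loop.mul (∑ i, χ i) x := by
      rw [map_sum, LinearMap.sum_apply]
    rw [this, hsum, Loop.mul_one]
  have hdec1 : ∑ i, (Loop.ofTest (χ i) : Loop s) = Loop.ofTest TestFn.one := by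
    rw [← map_sum, hsum]
  have hlocmul : ∀ i j x y, Disjoint (tsupport (χ i)) (tsupport (χ j)) →
      B (Loop.mul (χ i) x) (Loop.mul (χ j) y) = 0 := fun i j x y h =>
    hloc _ _ (h.mono (Distr.supp_mul_left _ _) (Distr.supp_mul_left _ _))
  have hof : ∀ i, (Loop.ofTest (χ i) : Loop s) = Loop.mul (χ i) (Loop.ofTest TestFn.one) :=
    fun i => (Loop.mul_ofTest_one _).symm
  -- On the star of each i at least one of p and q is constant. `P i` selects the indices at which p
  -- is, with `d i` that constant; at all other indices q is constant.
  let P : ι → Prop := fun i =>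
    ∀ ψ : TestFn, tsupport ψ ⊆ W (t i) → Loop.mul ψ p = c (t i) • Loop.ofTest ψ
  have hQ : ∀ i, ¬ P i → ∀ ψ : TestFn, tsupport ψ ⊆ W (t i) →
      Loop.mul ψ q = c (t i) • Loop.ofTest ψ := fun i hi => (hc (t i)).resolve_left hi
  let d : ι → ℂ := fun i => if P i then c (t i) else 0
  -- An antisymmetric flow whose divergence at i is B(χᵢ, q), because B annihilates constants. The
  -- proof is a summation by parts: B(p, q) is the sum of dᵢ Jᵢⱼ, and d does not change along edges
  -- with nonzero flow.
  let J : ι → ι → ℂ := fun i j => B (Loop.ofTest (χ i)) (Loop.mul (χ j) q) -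
    B (Loop.ofTest (χ j)) (Loop.mul (χ i) q)
  have hJanti : ∀ i j, J j i = -J i j := fun i j => by
    change _ - _ = -(_ - _)
    ring
  have hJsum : ∀ i, ∑ j, J i j = B (Loop.ofTest (χ i)) q := fun i => by
    change ∑ j, (B (Loop.ofTest (χ i)) (Loop.mul (χ j) q) -
      B (Loop.ofTest (χ j)) (Loop.mul (χ i) q)) = _
    rw [Finset.sum_sub_distrib, ← map_sum, hdec, ← LinearMap.sum_apply, ← map_sum, hdec1, hone,
      sub_zero]
  have hBi : ∀ i, B (Loop.mul (χ i) p) q = d i * ∑ j, J i j := by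
    intro i
    by_cases hi : P i
    · rw [hJsum, hi _ (ht i), map_smul, LinearMap.smul_apply, smul_eq_mul]
      simp only [d, if_pos hi]
    -- Here q is constant wherever a χⱼ meets χᵢ, so by locality q may be replaced by a constant,
    -- which B annihilates.
    · simp only [d, if_neg hi, zero_mul]
      have hj : ∀ j, B (Loop.mul (χ i) p) (Loop.mul (χ j) q) =
          c (t i) * B (Loop.mul (χ i) p) (Loop.ofTest (χ j)) := by
        intro j
        by_cases hij : Disjoint (tsupport (χ i)) (tsupport (χ j))
        · rw [hof j, hlocmul _ _ _ _ hij, hlocmul _ _ _ _ hij, mul_zero]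
        · rw [hQ i hi _ (hstar i j hij), map_smul, smul_eq_mul]
      rw [← hdec q, map_sum, Finset.sum_congr rfl fun j _ => hj j, ← Finset.mul_sum, ← map_sum,
        hdec1, hsymm, hone, mul_zero]
  have hJ : ∀ i j, (d i - d j) * J i j = 0 := by
    intro i j
    by_cases hij : Disjoint (tsupport (χ i)) (tsupport (χ j))
    · have : J i j = 0 := by
        change B (Loop.ofTest (χ i)) (Loop.mul (χ j) q) -
          B (Loop.ofTest (χ j)) (Loop.mul (χ i) q) = 0
        rw [hof, hof, hlocmul _ _ _ _ hij, hlocmul _ _ _ _ hij.symm, sub_zero]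
      rw [this, mul_zero]
    have hji : ¬ Disjoint (tsupport (χ j)) (tsupport (χ i)) := fun h => hij h.symm
    have hq : ∀ a : ℂ, Loop.mul (χ i) q = a • Loop.ofTest (χ i) →
        Loop.mul (χ j) q = a • Loop.ofTest (χ j) → J i j = 0 := by
      intro a hi hj
      change B (Loop.ofTest (χ i)) (Loop.mul (χ j) q) -
        B (Loop.ofTest (χ j)) (Loop.mul (χ i) q) = 0
      rw [hi, hj, map_smul, map_smul, hsymm, sub_self]
    by_cases hi : P i
    · by_cases hj : P j
      -- On the overlap p equals both constants; they must agree there unless B(ψ, ·) vanishes.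
      · have hcoef : ∀ ψ : TestFn, tsupport ψ ⊆ W (t i) → tsupport ψ ⊆ W (t j) →
            ∀ y, (d i - d j) * B (Loop.ofTest ψ) y = 0 := by
          intro ψ hψi hψj y
          have h1 := (hi ψ hψi).symm.trans (hj ψ hψj)
          have h2 := congrArg (fun x => B x y) h1
          simp only [map_smul, LinearMap.smul_apply, smul_eq_mul] at h2
          simp only [d, if_pos hi, if_pos hj]
          linear_combination h2
        change (d i - d j) * (B (Loop.ofTest (χ i)) (Loop.mul (χ j) q) -
          B (Loop.ofTest (χ j)) (Loop.mul (χ i) q)) = 0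
        rw [mul_sub, hcoef _ (ht i) (hstar j i hji), hcoef _ (hstar i j hij) (ht j), sub_zero]
      · rw [hq (c (t j)) (hQ j hj _ (hstar j i hji)) (hQ j hj _ (ht j)), mul_zero]
    · rw [hq (c (t i)) (hQ i hi _ (ht i)) (hQ i hi _ (hstar i j hij)), mul_zero]
  have h1 : B p q = ∑ i, ∑ j, d i * J i j := by
    nth_rewrite 1 [← hdec p]
    rw [map_sum, LinearMap.sum_apply]
    exact Finset.sum_congr rfl fun i _ => (hBi i).trans (Finset.mul_sum _ _ _)
  have h2 : B p q = ∑ i, ∑ j, -(d j * J i j) := by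
    rw [h1, Finset.sum_comm]
    refine Finset.sum_congr rfl fun i _ => Finset.sum_congr rfl fun j _ => ?_
    rw [hJanti, mul_neg]
  -- Antisymmetrization: twice B(p, q) is the sum of (dᵢ - dⱼ) Jᵢⱼ, and every term vanishes.
  have h3 : B p q + B p q = 0 := by
    nth_rewrite 1 [h1]
    rw [h2, ← Finset.sum_add_distrib]
    refine Finset.sum_eq_zero fun i _ => ?_
    rw [← Finset.sum_add_distrib]
    refine Finset.sum_eq_zero fun j _ => ?_
    linear_combination hJ i j
  exact self_eq_neg.1 (eq_neg_of_add_eq_zero_left h3)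

/-- `add_add_eq` makes the Hessian local, and invariance makes it annihilate constants; the
vanishing of the Hessian on (p, q) is then integrated. -/
theorem LocallyAdditive.add_add_eq_of_disjoint_deriv (ha : LocallyAdditive f)
    (hf : IsHolomorphic f) (hinv : ∀ (y : Loop s) (c : ℂ), f (y + c • Loop.ofTest TestFn.one) = f y)
    {p q : Loop s}
    (hpq : Disjoint (Distr.supp (Distr.deriv p.toDistr)) (Distr.supp (Distr.deriv q.toDistr)))
    (y : Loop s) : f (y + p + q) = f (y + p) + f (y + q) - f y := by
  refine add_add_eq_of_hessian_eq_zero hf (fun y => ?_) y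
  refine bilin_eq_zero_of_disjoint_deriv (hessian f hf y) (hessian_symm hf y) (fun p q h => ?_)
    (fun q => ?_) hpq
  · refine hessian_eq_zero_of_add_add_eq hf (fun y c d => ?_) y
    exact ha.add_add_eq hf (h.mono (Distr.supp_smul _ _) (Distr.supp_smul _ _)) y
  · refine hessian_eq_zero_of_add_add_eq hf (fun y c d => ?_) y
    rw [add_right_comm, hinv, hinv]
    ring

end Invariant

/-! ### Holomorphic symmetric cocycles on `ℂ` are coboundaries -/

section Cocycle

/-- The integrand of `coboundary`. -/
def coboundaryKernel (k : ℂ × ℂ → ℂ) (s : ℂ) (p : unitInterval × unitInterval) : ℂ :=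
  s * (circ p.2)⁻¹ * k ((p.1 : ℝ) * s, circ p.2)

/-- The function `s ↦ ∫₀¹ s ∂₂k(τs, 0) dτ`, the derivative being written as a Cauchy integral. -/
def coboundary (k : ℂ × ℂ → ℂ) (s : ℂ) : ℂ :=
  ∫ p : unitInterval × unitInterval, coboundaryKernel k s p

theorem continuous_coboundaryKernel {X : Type*} [TopologicalSpace X] {k : X → ℂ × ℂ → ℂ}
    (hk : Continuous (Function.uncurry k)) {σ : X → ℂ} (hσ : Continuous σ) :
    Continuous fun p : X × (unitInterval × unitInterval) =>
      coboundaryKernel (k p.1) (σ p.1) p.2 := by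
  have h1 := continuous_circ
  have h2 := continuous_circ_inv
  change Continuous fun p : X × (unitInterval × unitInterval) =>
    σ p.1 * (circ p.2.2)⁻¹ * (Function.uncurry k) (p.1, ((p.2.1 : ℝ) * σ p.1, circ p.2.2))
  fun_prop (disch := exact fun _ => circ_ne_zero _)

theorem coboundary_eq {k : ℂ × ℂ → ℂ} (hk : Continuous k)
    (hd : ∀ s, Differentiable ℂ fun t => k (s, t)) (s : ℂ) :
    coboundary k s = ∫ τ in (0 : ℝ)..1, s * deriv (fun t => k (τ * s, t)) 0 := by
  have hc := (continuous_coboundaryKernel (X := Unit) (k := fun _ => k)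
    (hk.comp continuous_snd) (continuous_const (y := s))).comp
      (continuous_const.prodMk continuous_id : Continuous fun p => ((), p))
  rw [← integral_unitInterval (fun τ => s * deriv (fun t => k (τ * s, t)) 0), coboundary,
    Measure.volume_eq_prod, integral_prod (coboundaryKernel k s)
      (ContinuousMap.integrable_of_compact _ ⟨coboundaryKernel k s, hc⟩)]
  refine integral_congr_ae (Eventually.of_forall fun τ => ?_)
  have := integral_circ_inv_mul (hd ((τ : ℝ) * s)) 0
  simp only [zero_add] at this
  simp only [coboundaryKernel, mul_assoc, integral_const_mul]
  rw [this]

/-- Let k₂(s) = ∂₂k(s, 0). The cocycle identity gives ∂₂k(s, t) = k₂(s + t) - k₂(t), and symmetry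
gives ∂₁k. Hence the derivative of k(τs, τt) in τ is a combination of k₂ at τ(s + t), τs and τt, and
integration over [0, 1] proves the identity. -/
theorem coboundary_add {k : ℂ × ℂ → ℂ} (hk : Continuous k)
    (hd : ∀ s, Differentiable ℂ fun t => k (s, t)) (h0 : k (0, 0) = 0)
    (hsymm : ∀ s t, k (s, t) = k (t, s))
    (hcoc : ∀ s t r, k (s, t) + k (s + t, r) = k (t, r) + k (s, t + r)) (s t : ℂ) :
    coboundary k (s + t) = coboundary k s + coboundary k t + k (s, t) := by
  have hD : Differentiable ℂ k := differentiable_of_separately hk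
    (fun w => by simpa only [hsymm _ w] using hd w) hd
  set k₂ : ℂ → ℂ := fun s => deriv (fun t => k (s, t)) 0 with hk₂
  have hk₂c : Continuous k₂ := continuous_deriv_of_continuous (f := fun s t => k (s, t)) hk hd
    continuous_const
  have hd₂ : ∀ s t, HasDerivAt (fun r => k (s, r)) (k₂ (s + t) - k₂ t) t := by
    intro s t
    -- The cocycle identity is differentiated in its third argument r at r = 0.
    have h1 : HasDerivAt (fun r => k (s, t) + k (s + t, r) - k (t, r)) (k₂ (s + t) - k₂ t) 0 :=
      (((hd (s + t) 0).hasDerivAt.const_add _).sub (hd t 0).hasDerivAt)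
    have h2 : (fun r => k (s, t) + k (s + t, r) - k (t, r)) = fun r => k (s, t + r) :=
      funext fun r => by linear_combination hcoc s t r
    rw [h2] at h1
    have h3 := deriv_comp_const_add (f := fun r => k (s, r)) t 0
    rw [add_zero] at h3
    rw [← h1.deriv, h3]
    exact (hd s t).hasDerivAt
  have hline : ∀ τ : ℝ, HasDerivAt (fun τ : ℝ => k (τ * s, τ * t))
      ((s + t) * k₂ (τ * (s + t)) - s * k₂ (τ * s) - t * k₂ (τ * t)) τ := by
    intro τ
    have hF := (hD ((τ : ℂ) * s, (τ : ℂ) * t)).hasFDerivAt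
    set L := fderiv ℂ k ((τ : ℂ) * s, (τ : ℂ) * t)
    have e1 : L (0, 1) = k₂ (τ * s + τ * t) - k₂ (τ * t) := by
      have := hF.comp_hasDerivAt (f := fun r : ℂ => ((τ : ℂ) * s, r)) ((τ : ℂ) * t)
        ((hasDerivAt_const _ _).prodMk (hasDerivAt_id _))
      exact this.unique (hd₂ _ _)
    have e2 : L (1, 0) = k₂ (τ * t + τ * s) - k₂ (τ * s) := by
      have := hF.comp_hasDerivAt (f := fun r : ℂ => (r, (τ : ℂ) * t)) ((τ : ℂ) * s)
        ((hasDerivAt_id _).prodMk (hasDerivAt_const _ _))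
      refine this.unique ?_
      have h := hd₂ ((τ : ℂ) * t) ((τ : ℂ) * s)
      simpa only [Function.comp_def, hsymm _ ((τ : ℂ) * t)] using h
    have h1 := hF.comp_hasDerivAt (f := fun r : ℂ => (r * s, r * t)) (τ : ℂ)
      (((hasDerivAt_id _).mul_const s).prodMk ((hasDerivAt_id _).mul_const t))
    have h2 := h1.comp_ofReal
    have e3 : ((1 : ℂ) * s, (1 : ℂ) * t) = s • ((1 : ℂ), (0 : ℂ)) + t • ((0 : ℂ), (1 : ℂ)) := by
      simp
    rw [e3, map_add, map_smul, map_smul, e1, e2, smul_eq_mul, smul_eq_mul, add_comm (τ * t : ℂ),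
      ← mul_add] at h2
    refine h2.congr_deriv ?_
    ring
  have hI : ∀ a : ℂ, IntervalIntegrable (fun τ : ℝ => a * k₂ (τ * a)) volume 0 1 := fun a => by
    refine Continuous.intervalIntegrable ?_ _ _
    fun_prop
  have h := intervalIntegral.integral_eq_sub_of_hasDerivAt (a := 0) (b := 1)
    (fun τ _ => hline τ) (((hI (s + t)).sub (hI s)).sub (hI t))
  rw [intervalIntegral.integral_sub ((hI (s + t)).sub (hI s)) (hI t),
    intervalIntegral.integral_sub (hI (s + t)) (hI s)] at h
  simp only [Complex.ofReal_one, one_mul, Complex.ofReal_zero, zero_mul, h0, sub_zero] at h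
  rw [coboundary_eq hk hd, coboundary_eq hk hd, coboundary_eq hk hd]
  linear_combination h

theorem coboundary_zero (k : ℂ × ℂ → ℂ) : coboundary k 0 = 0 := by
  simp [coboundary, coboundaryKernel]

end Cocycle

/-! ### Extension of additive functions from the loops of integral zero -/

section Extension

variable {V : Type*} [AddCommGroup V] [Module ℂ V]

/-- The defect of additivity of `G` on combinations of `a - b` and `a - c`. -/
def defect (G : V → ℂ) (a b c : V) (p : ℂ × ℂ) : ℂ :=
  G ((p.1 + p.2) • a - p.1 • b - p.2 • c) - G (p.1 • (a - b)) - G (p.2 • (a - c))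

/-- `G` is additive on orthogonal increments of integral zero, with respect to a functional `α` and
an orthogonality relation `perp`; the `e i` are pairwise orthogonal and have integral one. -/
structure IsExtendable (α : V →ₗ[ℂ] ℂ) (perp : V → V → Prop) (e : Fin 6 → V) (G : V → ℂ) :
    Prop where
  symm : ∀ {x y}, perp x y → perp y x
  comb : ∀ {x y z} (r t : ℂ), perp x z → perp y z → perp (r • x + t • y) z
  integral_bump : ∀ i, α (e i) = 1
  perp_bump : ∀ {i j}, i ≠ j → perp (e i) (e j)
  zero : G 0 = 0
  square : ∀ {x p q}, α p = 0 → α q = 0 → perp p q → G (x + p + q) = G (x + p) + G (x + q) - G x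

/-- The values of the extension of `G` on the multiples of the `e i`, given those on the multiples
of `e 0`. -/
def weight (e : Fin 6 → V) (G : V → ℂ) (g : ℂ → ℂ) (i : Fin 6) (t : ℂ) : ℂ :=
  if i = 0 then g t else G (t • (e i - e 0)) - g (-t)

/-- The extension of `G` to the elements orthogonal to `e i`. -/
def extendOff (α : V →ₗ[ℂ] ℂ) (e : Fin 6 → V) (G : V → ℂ) (g : ℂ → ℂ) (i : Fin 6) (x : V) : ℂ :=
  G (x - α x • e i) - weight e G g i (-α x)

theorem defect_swap (G : V → ℂ) (a b c : V) (s t : ℂ) :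
    defect G a b c (s, t) = defect G a c b (t, s) := by
  have : (s + t) • a - s • b - t • c = (t + s) • a - t • c - s • b := by module
  simp only [defect, this]
  ring

namespace IsExtendable

variable {α : V →ₗ[ℂ] ℂ} {perp : V → V → Prop} {e : Fin 6 → V} {G : V → ℂ} {g : ℂ → ℂ}

/-- The form of `square` in which it is applied: the increments are combinations of two vectors
each, and the equations for the corners are left to be checked by `module`. -/
theorem square_comb (h : IsExtendable α perp e G) {x y z w a b c d : V} {r t u v : ℂ}
    (hy : y = x + (r • a + t • b)) (hz : z = x + (u • c + v • d))
    (hw : w = x + (r • a + t • b) + (u • c + v • d))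
    (h1 : r * α a + t * α b = 0) (h2 : u * α c + v * α d = 0) (hac : perp a c) (had : perp a d)
    (hbc : perp b c) (hbd : perp b d) : G w = G y + G z - G x := by
  subst hy hz hw
  refine h.square (by simpa using h1) (by simpa using h2) ?_
  exact h.symm (h.comb _ _ (h.symm (h.comb _ _ hac hbc)) (h.symm (h.comb _ _ had hbd)))

/-- The square with sides t (eₗ - eₖ) and s (eⱼ - e₀), which have disjoint supports. -/
theorem defect_congr_right (h : IsExtendable α perp e G) {j k l : Fin 6} (hk : k ≠ 0)
    (hl : l ≠ 0) (hjk : j ≠ k) (hjl : j ≠ l) (s t : ℂ) :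
    defect G (e 0) (e j) (e k) (s, t) = defect G (e 0) (e j) (e l) (s, t) := by
  have := h.square_comb (x := (s + t) • e 0 - s • e j - t • e l)
    (y := (s + t) • e 0 - s • e j - t • e k) (z := t • (e 0 - e l)) (w := t • (e 0 - e k))
    (a := e l) (b := e k) (c := e 0) (d := e j) (r := t) (t := -t) (u := -s) (v := s)
    (by module) (by module) (by module) (by simp [h.integral_bump]) (by simp [h.integral_bump])
    (h.perp_bump hl) (h.perp_bump hjl.symm) (h.perp_bump hk) (h.perp_bump hjk.symm)
  simp only [defect]
  linear_combination -this

/-- The last index may be changed freely, and `defect_swap` lets it act on either index. The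
auxiliary index m avoids collisions on the way from (1, 2) to (j, k). Choosing (2, 1) yields
symmetry. -/
theorem defect_eq (h : IsExtendable α perp e G) {j k : Fin 6} (hj : j ≠ 0) (hk : k ≠ 0)
    (hjk : j ≠ k) (s t : ℂ) :
    defect G (e 0) (e 1) (e 2) (s, t) = defect G (e 0) (e j) (e k) (s, t) := by
  obtain ⟨m, hm0, hm2, hmk⟩ : ∃ m : Fin 6, m ≠ 0 ∧ m ≠ 2 ∧ m ≠ k :=
    (by decide : ∀ k : Fin 6, ∃ m : Fin 6, m ≠ 0 ∧ m ≠ 2 ∧ m ≠ k) k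
  rw [defect_swap, h.defect_congr_right (l := m) (by decide) hm0 (by decide) hm2.symm, defect_swap,
    h.defect_congr_right (by decide) hk hm2 hmk, defect_swap,
    h.defect_congr_right hm0 hj hmk.symm hjk.symm, defect_swap]

theorem defect_symm (h : IsExtendable α perp e G) (s t : ℂ) :
    defect G (e 0) (e 1) (e 2) (s, t) = defect G (e 0) (e 1) (e 2) (t, s) := by
  rw [h.defect_eq (j := 2) (k := 1) (by decide) (by decide) (by decide), defect_swap]

/-- The closed form on the right is symmetric under simultaneous permutations of (s, j), (t, k), (r,
l). This symmetry is the cocycle identity. -/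
theorem defect_add_defect (h : IsExtendable α perp e G) {j k l : Fin 6} (hj : j ≠ 0) (hk : k ≠ 0)
    (hl : l ≠ 0) (hjk : j ≠ k) (hjl : j ≠ l) (hkl : k ≠ l) (s t r : ℂ) :
    defect G (e 0) (e 1) (e 2) (s, t) + defect G (e 0) (e 1) (e 2) (s + t, r) =
      G ((s + t + r) • e 0 - s • e j - t • e k - r • e l) - G (s • (e 0 - e j)) -
        G (t • (e 0 - e k)) - G (r • (e 0 - e l)) := by
  rw [h.defect_eq hj hk hjk s, h.defect_eq hj hl hjl (s + t)]
  have := h.square_comb (x := (s + t) • (e 0 - e j))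
    (y := (s + t + r) • e 0 - (s + t) • e j - r • e l) (z := (s + t) • e 0 - s • e j - t • e k)
    (w := (s + t + r) • e 0 - s • e j - t • e k - r • e l)
    (a := e 0) (b := e l) (c := e j) (d := e k) (r := r) (t := -r) (u := t) (v := -t)
    (by module) (by module) (by module) (by simp [h.integral_bump]) (by simp [h.integral_bump])
    (h.perp_bump hj.symm) (h.perp_bump hk.symm) (h.perp_bump hjl.symm) (h.perp_bump hkl.symm)
  simp only [defect]
  linear_combination -this

theorem defect_cocycle (h : IsExtendable α perp e G) (s t r : ℂ) :
    defect G (e 0) (e 1) (e 2) (s, t) + defect G (e 0) (e 1) (e 2) (s + t, r) =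
      defect G (e 0) (e 1) (e 2) (t, r) + defect G (e 0) (e 1) (e 2) (s, t + r) := by
  rw [h.defect_symm s (t + r), h.defect_add_defect (j := 1) (k := 2) (l := 3) (by decide)
    (by decide) (by decide) (by decide) (by decide) (by decide),
    h.defect_add_defect (j := 2) (k := 3) (l := 1) (by decide) (by decide) (by decide) (by decide)
    (by decide) (by decide)]
  have : (s + t + r) • e 0 - s • e 1 - t • e 2 - r • e 3 =
      (t + r + s) • e 0 - t • e 2 - r • e 3 - s • e 1 := by module
  rw [this]
  ring

theorem apply_bump_zero (h : IsExtendable α perp e G)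
    (hg : ∀ s t, g (s + t) = g s + g t + defect G (e 0) (e 1) (e 2) (s, t)) {j k : Fin 6}
    (hj : j ≠ 0) (hk : k ≠ 0) (hjk : j ≠ k) {r s t : ℂ} (hr : r + s + t = 0) :
    G (r • e 0 + s • e j + t • e k) = g r + weight e G g j s + weight e G g k t := by
  obtain rfl : r = -s + -t := by linear_combination hr
  have h1 := hg (-s) (-t)
  rw [h.defect_eq hj hk hjk] at h1
  have e1 : (-s + -t) • e 0 - (-s) • e j - (-t) • e k = (-s + -t) • e 0 + s • e j + t • e k := by
    module
  have e2 : (-s) • (e 0 - e j) = s • (e j - e 0) := by module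
  have e3 : (-t) • (e 0 - e k) = t • (e k - e 0) := by module
  simp only [defect, e1, e2, e3] at h1
  simp only [weight, if_neg hj, if_neg hk]
  linear_combination -h1

theorem apply_two_bumps (h : IsExtendable α perp e G) (hg0 : g 0 = 0)
    (hg : ∀ s t, g (s + t) = g s + g t + defect G (e 0) (e 1) (e 2) (s, t)) {j k : Fin 6}
    (hjk : j ≠ k) (t : ℂ) :
    G (t • (e j - e k)) = weight e G g j t + weight e G g k (-t) := by
  by_cases hj : j = 0
  · subst hj
    have e1 : t • (e 0 - e k) = (-t) • (e k - e 0) := by module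
    simp only [weight, if_neg hjk.symm, if_true, e1, neg_neg]
    ring
  by_cases hk : k = 0
  · subst hk
    simp only [weight, if_neg hj, if_true]
    ring
  · have h1 := h.apply_bump_zero hg hj hk hjk (r := 0) (s := t) (t := -t) (by ring)
    rw [hg0] at h1
    have e1 : (0 : ℂ) • e 0 + t • e j + (-t) • e k = t • (e j - e k) := by module
    rw [e1] at h1
    linear_combination h1

/-- Consistency of the weights. The functional equation of g is the case in which `e 0` occurs; the
square with sides r (eᵢ - e₀) and t (eₖ - eⱼ) reduces the remaining case to it. -/
theorem apply_three_bumps (h : IsExtendable α perp e G) (hg0 : g 0 = 0)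
    (hg : ∀ s t, g (s + t) = g s + g t + defect G (e 0) (e 1) (e 2) (s, t)) {i j k : Fin 6}
    (hij : i ≠ j) (hik : i ≠ k) (hjk : j ≠ k) {r s t : ℂ} (hr : r + s + t = 0) :
    G (r • e i + s • e j + t • e k) =
      weight e G g i r + weight e G g j s + weight e G g k t := by
  have hw0 : ∀ t, weight e G g 0 t = g t := fun t => if_pos rfl
  by_cases hi : i = 0
  · subst hi
    rw [h.apply_bump_zero hg hij.symm hik.symm hjk hr, hw0]
  by_cases hj : j = 0
  · subst hj
    have e1 : r • e i + s • e 0 + t • e k = s • e 0 + r • e i + t • e k := by module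
    rw [e1, h.apply_bump_zero hg hi hjk.symm hik (by linear_combination hr), hw0]
    ring
  by_cases hk : k = 0
  · subst hk
    have e1 : r • e i + s • e j + t • e 0 = t • e 0 + r • e i + s • e j := by module
    rw [e1, h.apply_bump_zero hg hi hj hij (by linear_combination hr), hw0]
    ring
  obtain rfl : s = -r - t := by linear_combination hr
  have h1 := h.square_comb (x := r • (e 0 - e j)) (y := r • (e i - e j))
    (z := r • e 0 + (-r - t) • e j + t • e k) (w := r • e i + (-r - t) • e j + t • e k)
    (a := e i) (b := e 0) (c := e k) (d := e j) (r := r) (t := -r) (u := t) (v := -t)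
    (by module) (by module) (by module) (by simp [h.integral_bump]) (by simp [h.integral_bump])
    (h.perp_bump hik) (h.perp_bump hij) (h.perp_bump (Ne.symm hk)) (h.perp_bump (Ne.symm hj))
  rw [h1, h.apply_two_bumps hg0 hg hij, h.apply_bump_zero hg hj hk hjk (by ring),
    h.apply_two_bumps hg0 hg (Ne.symm hj), hw0]
  ring

/-- The integral of v may be compensated by two bumps in any proportion, with the outcome predicted
by the weights. A third bump `e k` serves as a stand-in for v in the square. -/
theorem apply_add_bumps (h : IsExtendable α perp e G) (hg0 : g 0 = 0)
    (hg : ∀ s t, g (s + t) = g s + g t + defect G (e 0) (e 1) (e 2) (s, t)) {i j : Fin 6}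
    (hij : i ≠ j) {v : V} (hvi : perp (e i) v) (hvj : perp (e j) v) {s t : ℂ}
    (hst : α v + s + t = 0) :
    G (v + s • e i + t • e j) =
      extendOff α e G g i v + weight e G g i s + weight e G g j t := by
  obtain ⟨k, hik, hjk⟩ : ∃ k : Fin 6, i ≠ k ∧ j ≠ k :=
    (by decide : ∀ i j : Fin 6, ∃ k : Fin 6, i ≠ k ∧ j ≠ k) i j
  obtain rfl : s = -α v - t := by linear_combination hst
  have h1 := h.square_comb (x := α v • (e k - e i)) (y := α v • e k + (-α v - t) • e i + t • e j)
    (z := v - α v • e i) (w := v + (-α v - t) • e i + t • e j)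
    (a := e j) (b := e i) (c := v) (d := e k) (r := t) (t := -t) (u := 1) (v := -α v)
    (by module) (by module) (by module) (by simp [h.integral_bump]) (by simp [h.integral_bump])
    hvj (h.perp_bump hjk) hvi (h.perp_bump hik)
  rw [h1, h.apply_three_bumps hg0 hg hik.symm hjk.symm hij (by ring),
    h.apply_two_bumps hg0 hg hik.symm, extendOff]
  ring

/-- Besides `e i`, two further bumps are needed, to make the increments of x and y separately of
integral zero. This accounts for three bumps on each side, six in all. -/
theorem extendOff_add (h : IsExtendable α perp e G) (hg0 : g 0 = 0)
    (hg : ∀ s t, g (s + t) = g s + g t + defect G (e 0) (e 1) (e 2) (s, t)) {i j k : Fin 6}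
    (hij : i ≠ j) (hik : i ≠ k) (hjk : j ≠ k) {x y : V} (hxy : perp x y) (hxi : perp (e i) x)
    (hxk : perp (e k) x) (hyi : perp (e i) y) (hyj : perp (e j) y) :
    extendOff α e G g i (x + y) = extendOff α e G g i x + extendOff α e G g i y := by
  have h1 := h.square_comb (x := (-α x - α y) • e i + α x • e j + α y • e k)
    (y := x + (-α x - α y) • e i + α y • e k) (z := y + (-α x - α y) • e i + α x • e j)
    (w := x + y - α (x + y) • e i)
    (a := x) (b := e j) (c := y) (d := e k) (r := 1) (t := -α x) (u := 1) (v := -α y)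
    (by module) (by module) (by rw [map_add]; module) (by simp [h.integral_bump])
    (by simp [h.integral_bump]) hxy (h.symm hxk) hyj (h.perp_bump hjk)
  rw [h.apply_add_bumps hg0 hg hik hxi hxk (by ring),
    h.apply_add_bumps hg0 hg hij hyi hyj (by ring), h.apply_three_bumps hg0 hg hij hik hjk (by ring)]
    at h1
  have h2 : extendOff α e G g i (x + y) =
      G (x + y - α (x + y) • e i) - weight e G g i (-α (x + y)) := rfl
  rw [h2, h1, map_add, neg_add, ← sub_eq_add_neg]
  ring

/-- On integral zero the glued formula returns G. The square at the base v, completed by multiples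
of `e i` and `e j`, exchanges `e j` for w and `e i` for u. -/
theorem apply_eq_extendOff (h : IsExtendable α perp e G) (hg0 : g 0 = 0)
    (hg : ∀ s t, g (s + t) = g s + g t + defect G (e 0) (e 1) (e 2) (s, t)) {i j : Fin 6}
    (hij : i ≠ j) {u v w : V} (h0 : α (u + v + w) = 0) (huw : perp u w) (hwi : perp (e i) w)
    (huj : perp (e j) u) (hvi : perp (e i) v) (hvj : perp (e j) v) :
    G (u + v + w) =
      extendOff α e G g i (v + w) + extendOff α e G g j (v + u) - extendOff α e G g i v := by
  have hv : α v = -α u - α w := by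
    rw [map_add, map_add] at h0
    linear_combination h0
  have h1 := h.square_comb (x := v + α u • e i + α w • e j) (y := v + w + α u • e i)
    (z := v + u + α w • e j) (w := u + v + w)
    (a := w) (b := e j) (c := u) (d := e i) (r := 1) (t := -α w) (u := 1) (v := -α u)
    (by module) (by module) (by module) (by simp [h.integral_bump]) (by simp [h.integral_bump])
    (h.symm huw) (h.symm hwi) huj (h.perp_bump hij.symm)
  rw [h1, h.apply_add_bumps hg0 hg hij hvi hvj (by rw [hv]; ring)]
  have e1 : v + w - α (v + w) • e i = v + w + α u • e i := by
    rw [map_add, hv]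
    module
  have e2 : v + u - α (v + u) • e j = v + u + α w • e j := by
    rw [map_add, hv]
    module
  have e3 : -α (v + w) = α u := by rw [map_add, hv]; ring
  have e4 : -α (v + u) = α w := by rw [map_add, hv]; ring
  have h2 : extendOff α e G g i (v + w) = G (v + w + α u • e i) - weight e G g i (α u) := by
    rw [extendOff, e1, e3]
  have h3 : extendOff α e G g j (v + u) = G (v + u + α w • e j) - weight e G g j (α w) := by
    rw [extendOff, e2, e4]
  rw [h2, h3]
  ring

end IsExtendable

end Extension

/-- Scaling the argument amounts to scaling k; in this way growth and homogeneity pass from a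
cocycle to its coboundary. -/
theorem coboundary_mul {k : ℂ × ℂ → ℂ} (hk : Continuous k)
    (hd : ∀ s, Differentiable ℂ fun t => k (s, t)) (c t : ℂ) :
    coboundary k (c * t) = coboundary (fun p => k (c • p)) t := by
  rw [coboundary_eq hk hd, coboundary_eq (k := fun p => k (c • p))
    (hk.comp (continuous_const_smul c)) fun s =>
      (hd (c * s)).comp (differentiable_id.const_mul c)]
  refine intervalIntegral.integral_congr fun τ _ => ?_
  have h := deriv_comp_mul_left c (fun u => k (τ * (c * t), u)) 0
  simp only [mul_zero, smul_eq_mul] at h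
  simp only [Prod.smul_mk, smul_eq_mul, mul_left_comm c (τ : ℂ) t, h]
  ring

/-! ### Operators on spaces of holomorphic functions -/

section Operators

/-- Composition with a continuous map, as an operator on spaces of continuous functions. -/
def precompCLM {X Y : Type*} [TopologicalSpace X] [TopologicalSpace Y] (φ : C(X, Y)) :
    C(Y, ℂ) →L[ℂ] C(X, ℂ) where
  toFun F := F.comp φ
  map_add' _ _ := rfl
  map_smul' _ _ := rfl
  cont := ContinuousMap.continuous_precomp φ

variable {W W' : Type} [AddCommGroup W] [Module ℂ W] [TopologicalSpace W]
  [AddCommGroup W'] [Module ℂ W'] [TopologicalSpace W']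

/-- The operator `F(ζ, y) ↦ F(ζ, Ly)`. -/
def pullback (L : W →L[ℂ] W') : C(ℂ × W', ℂ) →L[ℂ] C(ℂ × W, ℂ) :=
  precompCLM ⟨fun p => (p.1, L p.2), continuous_fst.prodMk (L.continuous.comp continuous_snd)⟩

theorem pullback_apply (L : W →L[ℂ] W') (F : C(ℂ × W', ℂ)) (ζ : ℂ) (y : W) :
    pullback L F (ζ, y) = F (ζ, L y) := rfl

/-- `F` is holomorphic and `F(ζ/λ, λ²y) = O(λ²)` as `λ → 0`. -/
structure IsAdmissible (F : ℂ × W → ℂ) : Prop where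
  holomorphic : IsHolomorphic F
  growth : ∀ (ζ : ℂ) (y : W), (fun c : ℂ => F (ζ / c, c ^ 2 • y)) =O[𝓝[≠] 0] fun c : ℂ => c ^ 2

/-- `F(ζ, ·)` is homogeneous of degree `m` for all `ζ`. -/
def IsHomogeneousSnd (m : ℕ) (F : ℂ × W → ℂ) : Prop :=
  ∀ (ζ c : ℂ) (y : W), F (ζ, c • y) = c ^ m * F (ζ, y)

/-- A continuous linear operator that preserves admissible functions, and homogeneous functions
among these. -/
structure PreservesClasses (T : C(ℂ × W, ℂ) →L[ℂ] C(ℂ × W', ℂ)) : Prop where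
  admissible : ∀ F : C(ℂ × W, ℂ), IsAdmissible F → IsAdmissible (T F)
  homogeneous : ∀ (F : C(ℂ × W, ℂ)) m, IsAdmissible F → IsHomogeneousSnd m F → IsHomogeneousSnd m (T F)

theorem IsHolomorphic.snd_continuous {F : ℂ × W → ℂ} (hF : IsHolomorphic F) (ζ : ℂ) :
    Continuous fun y => F (ζ, y) :=
  hF.1.comp (continuous_const.prodMk continuous_id)

theorem IsHolomorphic.snd {F : ℂ × W → ℂ} (hF : IsHolomorphic F) (ζ : ℂ) :
    IsHolomorphic fun y => F (ζ, y) :=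
  ⟨hF.snd_continuous ζ, fun x v => by simpa using hF.2 (ζ, x) (0, v)⟩

theorem preservesClasses_pullback (L : W →L[ℂ] W') : PreservesClasses (pullback L) where
  admissible F hF := by
    refine ⟨⟨map_continuous _, fun x v => ?_⟩, fun ζ y => ?_⟩
    · have := hF.1.2 (x.1, L x.2) (v.1, L v.2)
      have e : (fun c : ℂ => pullback L F (x + c • v)) =
          fun c => F ((x.1, L x.2) + c • (v.1, L v.2)) := funext fun c =>
        congrArg (fun w => F (x.1 + c • v.1, w)) (show L (x.2 + c • v.2) = L x.2 + c • L v.2 by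
          rw [map_add, map_smul])
      rw [e]
      exact this
    · simpa only [pullback_apply, map_smul] using hF.2 ζ (L y)
  homogeneous F m _ hm ζ c y := by
    rw [pullback_apply, pullback_apply, map_smul, hm]

variable {W'' : Type} [AddCommGroup W''] [Module ℂ W''] [TopologicalSpace W'']

theorem PreservesClasses.comp {S : C(ℂ × W', ℂ) →L[ℂ] C(ℂ × W'', ℂ)}
    {T : C(ℂ × W, ℂ) →L[ℂ] C(ℂ × W', ℂ)} (hS : PreservesClasses S) (hT : PreservesClasses T) :
    PreservesClasses (S.comp T) where
  admissible F hF := hS.1 _ (hT.1 F hF)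
  homogeneous F m hF hm := hS.2 _ m (hT.1 F hF) (hT.2 F m hF hm)

theorem PreservesClasses.add {S T : C(ℂ × W, ℂ) →L[ℂ] C(ℂ × W', ℂ)} (hS : PreservesClasses S)
    (hT : PreservesClasses T) : PreservesClasses (S + T) where
  admissible F hF := ⟨⟨map_continuous _, fun x v =>
    ((hS.1 F hF).1.2 x v).add ((hT.1 F hF).1.2 x v)⟩, fun ζ y =>
      ((hS.1 F hF).2 ζ y).add ((hT.1 F hF).2 ζ y)⟩
  homogeneous F m hF hm ζ c y := by
    change S F _ + T F _ = c ^ m * (S F _ + T F _)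
    rw [hS.2 F m hF hm, hT.2 F m hF hm, mul_add]

theorem PreservesClasses.sub {S T : C(ℂ × W, ℂ) →L[ℂ] C(ℂ × W', ℂ)} (hS : PreservesClasses S)
    (hT : PreservesClasses T) : PreservesClasses (S - T) where
  admissible F hF := ⟨⟨map_continuous _, fun x v =>
    ((hS.1 F hF).1.2 x v).sub ((hT.1 F hF).1.2 x v)⟩, fun ζ y =>
      ((hS.1 F hF).2 ζ y).sub ((hT.1 F hF).2 ζ y)⟩
  homogeneous F m hF hm ζ c y := by
    change S F _ - T F _ = c ^ m * (S F _ - T F _)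
    rw [hS.2 F m hF hm, hT.2 F m hF hm, mul_sub]

/-! ### The coboundary operator -/

/-- The substitution in the integrand of `coboundary`. -/
def coboundaryArg : C((ℂ × ℂ) × (unitInterval × unitInterval), ℂ × (ℂ × ℂ)) :=
  ⟨fun p => (p.1.1, ((p.2.1 : ℝ) * p.1.2, circ p.2.2)), by
    have := continuous_circ
    fun_prop⟩

/-- The factor in the integrand of `coboundary`. -/
def coboundaryFactor : C((ℂ × ℂ) × (unitInterval × unitInterval), ℂ) :=
  ⟨fun p => p.1.2 * (circ p.2.2)⁻¹, by
    have := continuous_circ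
    fun_prop (disch := exact fun _ => circ_ne_zero _)⟩

/-- The integrand of `coboundary`, as an operator. -/
def coboundaryKernelCLM :
    C(ℂ × (ℂ × ℂ), ℂ) →L[ℂ] C(ℂ × ℂ, C(unitInterval × unitInterval, ℂ)) where
  toFun K := (coboundaryFactor * K.comp coboundaryArg).curry
  map_add' _ _ := ContinuousMap.ext fun p => ContinuousMap.ext fun q =>
    mul_add (coboundaryFactor (p, q)) _ _
  map_smul' c _ := ContinuousMap.ext fun p => ContinuousMap.ext fun q =>
    mul_left_comm (coboundaryFactor (p, q)) c _
  cont := ContinuousMap.continuous_curry.comp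
    (continuous_const.mul (ContinuousMap.continuous_precomp coboundaryArg))

/-- The operator that applies `coboundary` for each value of the first variable. -/
def coboundaryCLM : C(ℂ × (ℂ × ℂ), ℂ) →L[ℂ] C(ℂ × ℂ, ℂ) :=
  ((integralCLM (volume : Measure (unitInterval × unitInterval))).compLeftContinuous ℂ
    (ℂ × ℂ)).comp coboundaryKernelCLM

theorem coboundaryCLM_apply (K : C(ℂ × (ℂ × ℂ), ℂ)) (ζ t : ℂ) :
    coboundaryCLM K (ζ, t) = coboundary (fun q => K (ζ, q)) t := rfl

theorem IsHolomorphic.differentiable_snd_snd {K : ℂ × (ℂ × ℂ) → ℂ} (hK : IsHolomorphic K)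
    (ζ s : ℂ) : Differentiable ℂ fun t => K (ζ, (s, t)) := by
  simpa using hK.2 (ζ, (s, 0)) (0, (0, 1))

theorem IsHolomorphic.differentiableAt_scaling [ContinuousSMul ℂ W] {F : ℂ × W → ℂ}
    (hF : IsHolomorphic F) (ζ : ℂ) (y : W) {c : ℂ} (hc : c ≠ 0) :
    DifferentiableAt ℂ (fun c : ℂ => F (ζ / c, c ^ 2 • y)) c := by
  have hD : Differentiable ℂ fun p : ℂ × ℂ => F (p.1, p.2 • y) := by
    refine differentiable_of_separately ?_ (fun w => ?_) fun z => ?_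
    · exact hF.1.comp (continuous_fst.prodMk (continuous_snd.smul continuous_const))
    · simpa using hF.2 (0, w • y) (1, 0)
    · simpa using hF.2 (z, 0) (0, y)
  have h1 : DifferentiableAt ℂ (fun c : ℂ => (ζ / c, c ^ 2)) c :=
    ((differentiableAt_const ζ).div differentiableAt_id hc).prodMk (differentiableAt_id.pow 2)
  exact (hD _).comp (f := fun c : ℂ => (ζ / c, c ^ 2)) c h1

theorem preservesClasses_coboundaryCLM : PreservesClasses coboundaryCLM where
  admissible K hK := by
    refine ⟨⟨map_continuous _, fun x v => ?_⟩, fun ζ t => ?_⟩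
    · have hc : Continuous (Function.uncurry fun (c : ℂ) (p : unitInterval × unitInterval) =>
          coboundaryKernel (fun q => K (x.1 + c * v.1, q)) (x.2 + c * v.2) p) := by
        refine continuous_coboundaryKernel (X := ℂ) (k := fun c q => K (x.1 + c * v.1, q))
          (σ := fun c => x.2 + c * v.2) ?_ (by fun_prop)
        change Continuous fun p : ℂ × (ℂ × ℂ) => K (x.1 + p.1 * v.1, p.2)
        fun_prop
      refine differentiable_integral_of_compact volume (f := fun (c : ℂ) p =>
        coboundaryKernel (fun q => K (x.1 + c * v.1, q)) (x.2 + c * v.2) p) hc fun p => ?_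
      have h1 := hK.1.2 (x.1, ((p.1 : ℝ) * x.2, circ p.2)) (v.1, ((p.1 : ℝ) * v.2, 0))
      have h2 : Differentiable ℂ fun c : ℂ => (x.2 + c * v.2) * (circ p.2)⁻¹ := by fun_prop
      have e : (fun c : ℂ => coboundaryKernel (fun q => K (x.1 + c * v.1, q)) (x.2 + c * v.2) p) =
          fun c => (x.2 + c * v.2) * (circ p.2)⁻¹ *
            K ((x.1, ((p.1 : ℝ) * x.2, circ p.2)) + c • (v.1, ((p.1 : ℝ) * v.2, 0))) := by
        funext c
        simp only [coboundaryKernel, Prod.smul_mk, Prod.mk_add_mk, smul_eq_mul, mul_zero, add_zero]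
        rw [mul_add, mul_left_comm c]
      exact e ▸ h2.mul h1
    · have hsc : ∀ c : ℂ, coboundaryCLM K (ζ / c, c ^ 2 • t) =
          ∫ p, coboundaryKernel (fun q => K (ζ / c, c ^ 2 • q)) t p := fun c => by
        rw [coboundaryCLM_apply, smul_eq_mul, coboundary_mul (hK.1.snd_continuous _)
          (hK.1.differentiable_snd_snd _)]
        rfl
      -- The growth condition holds for each point p of the integration domain separately. A uniform
      -- constant is the maximum over |z| = 1 and the compact domain, carried into the disc by
      -- `norm_le_sq_mul_of_isBigO`.
      have hcont : Continuous fun p : Metric.sphere (0 : ℂ) 1 × (unitInterval × unitInterval) =>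
          coboundaryKernel (fun q => K (ζ / p.1, (p.1 : ℂ) ^ 2 • q)) t p.2 := by
        refine continuous_coboundaryKernel (X := Metric.sphere (0 : ℂ) 1)
          (k := fun z q => K (ζ / z, (z : ℂ) ^ 2 • q)) ?_ continuous_const
        change Continuous fun p : Metric.sphere (0 : ℂ) 1 × (ℂ × ℂ) =>
          K (ζ / p.1, (p.1 : ℂ) ^ 2 • p.2)
        fun_prop (disch := exact fun p => Metric.ne_of_mem_sphere p.1.2 one_ne_zero)
      obtain ⟨M, hM⟩ := (isCompact_range hcont).isBounded.exists_norm_le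
      refine IsBigO.of_bound M ?_
      have hball : Metric.ball (0 : ℂ) 1 ∈ 𝓝[≠] (0 : ℂ) :=
        mem_nhdsWithin_of_mem_nhds (Metric.ball_mem_nhds 0 one_pos)
      filter_upwards [hball, self_mem_nhdsWithin] with c hc hc0
      rw [hsc]
      have hb : ∀ p : unitInterval × unitInterval,
          ‖coboundaryKernel (fun q => K (ζ / c, c ^ 2 • q)) t p‖ ≤ M * ‖c ^ 2‖ := by
        intro p
        have := norm_le_sq_mul_of_isBigO
          (f := fun c => coboundaryKernel (fun q => K (ζ / c, c ^ 2 • q)) t p) (M := M) ?_ ?_ ?_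
          hc0 (mem_ball_zero_iff.1 hc).le
        · rw [norm_pow, mul_comm]
          exact this
        · intro z hz
          exact (hK.1.differentiableAt_scaling ζ _ hz).const_mul _
        · exact (hK.2 ζ _).const_mul_left _
        · intro z hz
          exact hM _ ⟨(⟨z, mem_sphere_zero_iff_norm.2 hz⟩, p), rfl⟩
      have := norm_integral_le_of_norm_le_const (μ := (volume : Measure (unitInterval × unitInterval)))
        (Eventually.of_forall hb)
      simpa using this
  homogeneous K m hK hm ζ c t := by
    rw [coboundaryCLM_apply, coboundaryCLM_apply, smul_eq_mul,
      coboundary_mul (hK.1.snd_continuous _) (hK.1.differentiable_snd_snd _), coboundary,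
      coboundary, ← integral_const_mul]
    refine integral_congr_ae (Eventually.of_forall fun p => ?_)
    simp only [coboundaryKernel, hm ζ c]
    ring

end Operators

/-! ### The extension operator -/

section ExtensionOperator

variable {V : Type} [AddCommGroup V] [Module ℂ V] [TopologicalSpace V] [IsTopologicalAddGroup V]
  [ContinuousSMul ℂ V]

/-- The operator that applies `defect` for each value of the first variable. -/
def defectCLM (a b c : V) : C(ℂ × V, ℂ) →L[ℂ] C(ℂ × (ℂ × ℂ), ℂ) :=
  pullback
      { toFun := fun p => (p.1 + p.2) • a - p.1 • b - p.2 • c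
        map_add' := fun p q => by
          simp only [Prod.fst_add, Prod.snd_add]
          module
        map_smul' := fun r p => by
          simp only [Prod.smul_fst, Prod.smul_snd, smul_eq_mul, RingHom.id_apply]
          module } -
    pullback ((ContinuousLinearMap.fst ℂ ℂ ℂ).smulRight (a - b)) -
    pullback ((ContinuousLinearMap.snd ℂ ℂ ℂ).smulRight (a - c))

theorem preservesClasses_defectCLM (a b c : V) : PreservesClasses (defectCLM a b c) :=
  ((preservesClasses_pullback _).sub (preservesClasses_pullback _)).sub
    (preservesClasses_pullback _)

/-- The holomorphic function whose coboundary is the defect of `G`. -/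
def potential (e : Fin 6 → V) (G : V → ℂ) (t : ℂ) : ℂ :=
  coboundary (defect G (e 0) (e 1) (e 2)) t

/-- The operator that applies `potential` for each value of the first variable. -/
def potentialCLM (e : Fin 6 → V) : C(ℂ × V, ℂ) →L[ℂ] C(ℂ × ℂ, ℂ) :=
  coboundaryCLM.comp (defectCLM (e 0) (e 1) (e 2))

theorem preservesClasses_potentialCLM (e : Fin 6 → V) : PreservesClasses (potentialCLM e) :=
  preservesClasses_coboundaryCLM.comp (preservesClasses_defectCLM _ _ _)

/-- The operator that applies `weight` for each value of the first variable. -/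
def weightCLM (e : Fin 6 → V) (i : Fin 6) : C(ℂ × V, ℂ) →L[ℂ] C(ℂ × ℂ, ℂ) :=
  if i = 0 then potentialCLM e else
    pullback ((ContinuousLinearMap.id ℂ ℂ).smulRight (e i - e 0)) -
      (pullback (-ContinuousLinearMap.id ℂ ℂ)).comp (potentialCLM e)

theorem weightCLM_apply (e : Fin 6 → V) (i : Fin 6) (H : C(ℂ × V, ℂ)) (ζ t : ℂ) :
    weightCLM e i H (ζ, t) =
      weight e (fun x => H (ζ, x)) (potential e fun x => H (ζ, x)) i t := by
  unfold weightCLM weight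
  split_ifs <;> rfl

theorem preservesClasses_weightCLM (e : Fin 6 → V) (i : Fin 6) :
    PreservesClasses (weightCLM e i) := by
  unfold weightCLM
  split_ifs
  · exact preservesClasses_potentialCLM e
  · exact (preservesClasses_pullback _).sub
      ((preservesClasses_pullback _).comp (preservesClasses_potentialCLM e))

/-- The operator that applies `extendOff` for each value of the first variable. -/
def extendOffCLM (α : V →L[ℂ] ℂ) (e : Fin 6 → V) (i : Fin 6) :
    C(ℂ × V, ℂ) →L[ℂ] C(ℂ × V, ℂ) :=
  pullback (ContinuousLinearMap.id ℂ V - α.smulRight (e i)) -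
    (pullback (-α)).comp (weightCLM e i)

theorem extendOffCLM_apply (α : V →L[ℂ] ℂ) (e : Fin 6 → V) (i : Fin 6) (H : C(ℂ × V, ℂ)) (ζ : ℂ)
    (x : V) : extendOffCLM α e i H (ζ, x) =
      extendOff α e (fun x => H (ζ, x)) (potential e fun x => H (ζ, x)) i x :=
  congrArg (H (ζ, x - α x • e i) - ·) (weightCLM_apply e i H ζ (-α x))

theorem preservesClasses_extendOffCLM (α : V →L[ℂ] ℂ) (e : Fin 6 → V) (i : Fin 6) :
    PreservesClasses (extendOffCLM α e i) :=
  (preservesClasses_pullback _).sub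
    ((preservesClasses_pullback _).comp (preservesClasses_weightCLM e i))

/-- Given a decomposition of the identity of `V` as `A + B` plus a third operator, the operator
that extends functions on the kernel of `α`. -/
def extendCLM (α : V →L[ℂ] ℂ) (e : Fin 6 → V) (A B : V →L[ℂ] V) :
    C(ℂ × V, ℂ) →L[ℂ] C(ℂ × V, ℂ) :=
  (pullback (ContinuousLinearMap.id ℂ V - A)).comp (extendOffCLM α e 0) +
    (pullback (ContinuousLinearMap.id ℂ V - B)).comp (extendOffCLM α e 3) -
    (pullback (ContinuousLinearMap.id ℂ V - A - B)).comp (extendOffCLM α e 0)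

theorem extendCLM_apply (α : V →L[ℂ] ℂ) (e : Fin 6 → V) (A B : V →L[ℂ] V) (H : C(ℂ × V, ℂ)) (ζ : ℂ)
    (x : V) : extendCLM α e A B H (ζ, x) =
      extendOff α e (fun x => H (ζ, x)) (potential e fun x => H (ζ, x)) 0 (x - A x) +
        extendOff α e (fun x => H (ζ, x)) (potential e fun x => H (ζ, x)) 3 (x - B x) -
        extendOff α e (fun x => H (ζ, x)) (potential e fun x => H (ζ, x)) 0 (x - A x - B x) := by
  rw [← extendOffCLM_apply, ← extendOffCLM_apply, ← extendOffCLM_apply]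
  rfl

theorem preservesClasses_extendCLM (α : V →L[ℂ] ℂ) (e : Fin 6 → V) (A B : V →L[ℂ] V) :
    PreservesClasses (extendCLM α e A B) :=
  (((preservesClasses_pullback _).comp (preservesClasses_extendOffCLM α e 0)).add
    ((preservesClasses_pullback _).comp (preservesClasses_extendOffCLM α e 3))).sub
    ((preservesClasses_pullback _).comp (preservesClasses_extendOffCLM α e 0))

theorem IsExtendable.potential_add {α : V →L[ℂ] ℂ} {perp : V → V → Prop} {e : Fin 6 → V}
    {H : C(ℂ × V, ℂ)} {ζ : ℂ} (h : IsExtendable (α : V →ₗ[ℂ] ℂ) perp e fun x => H (ζ, x))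
    (hH : IsAdmissible H) (s t : ℂ) :
    potential e (fun x => H (ζ, x)) (s + t) = potential e (fun x => H (ζ, x)) s +
      potential e (fun x => H (ζ, x)) t + defect (fun x => H (ζ, x)) (e 0) (e 1) (e 2) (s, t) := by
  have hK := ((preservesClasses_defectCLM (e 0) (e 1) (e 2)).1 H hH).1
  have h0 : H (ζ, 0) = 0 := h.zero
  exact coboundary_add (hK.snd_continuous ζ) (hK.differentiable_snd_snd ζ)
    (show defect (fun x => H (ζ, x)) (e 0) (e 1) (e 2) (0, 0) = 0 by simp [defect, h0])
    h.defect_symm h.defect_cocycle s t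

end ExtensionOperator

/-! ### Bumps and cutoffs -/

/-- Six test functions of integral one with disjoint supports, and two cutoffs with disjoint
supports, the first one equal to `1` near the first three supports, the second one equal to `1`
near the other three. -/
theorem TestFn.exists_bumps : ∃ (e : Fin 6 → TestFn) (χ ψ : TestFn),
    (∀ i, integral (e i) = 1) ∧ (∀ i j, i ≠ j → Disjoint (tsupport (e i)) (tsupport (e j))) ∧
    Disjoint (tsupport χ) (tsupport ψ) ∧
    (∀ i, i < 3 → Disjoint (tsupport (e i)) (tsupport (one - χ)) ∧
      Disjoint (tsupport (e i)) (tsupport ψ)) ∧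
    (∀ i, 3 ≤ i → Disjoint (tsupport (e i)) (tsupport (one - ψ)) ∧
      Disjoint (tsupport (e i)) (tsupport χ)) := by
  let x : Fin 6 → UnitAddCircle := fun i => Infinite.natEmbedding UnitAddCircle i
  have hx : Function.Injective x := (Infinite.natEmbedding UnitAddCircle).injective.comp
    Fin.val_injective
  obtain ⟨U, hU, hUd⟩ := (finite_range x).t2_separation
  have he : ∀ i, ∃ e : TestFn, tsupport e ⊆ U (x i) ∧ integral e = 1 := fun i =>
    exists_bump (hU (x i)).2 (hU (x i)).1
  choose e heU he1 using he
  have hdis : ∀ i j, i ≠ j → Disjoint (tsupport (e i)) (tsupport (e j)) := fun i j hij =>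
    (hUd (mem_range_self i) (mem_range_self j) (hx.ne hij)).mono (heU i) (heU j)
  let A : Set UnitAddCircle := ⋃ i : {i : Fin 6 // i < 3}, tsupport (e i)
  let B : Set UnitAddCircle := ⋃ i : {i : Fin 6 // 3 ≤ i}, tsupport (e i)
  have hA : IsClosed A := isClosed_iUnion_of_finite fun i => isClosed_tsupport _
  have hB : IsClosed B := isClosed_iUnion_of_finite fun i => isClosed_tsupport _
  have hAB : Disjoint A B := disjoint_iUnion_left.2 fun i => disjoint_iUnion_right.2 fun j =>
    hdis _ _ (ne_of_lt (lt_of_lt_of_le i.2 j.2))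
  obtain ⟨χ, hχ1, hχ0, -⟩ := exists_cutoff hA hB hAB
  have hχB : Disjoint (tsupport χ) B := disjoint_tsupport hχ0
  -- The second cut-off is made to vanish near the whole support of the first, which forces disjoint
  -- supports.
  obtain ⟨ψ, hψ1, hψ0, -⟩ := exists_cutoff hB (isClosed_tsupport χ) hχB.symm
  have hψχ : Disjoint (tsupport ψ) (tsupport χ) := disjoint_tsupport hψ0
  have hAχ : A ⊆ tsupport χ := fun t ht => subset_tsupport _ (by
    rw [Function.mem_support, hχ1.self_of_nhdsSet t ht]
    exact one_ne_zero)
  refine ⟨e, χ, ψ, he1, hdis, hψχ.symm, fun i hi => ?_, fun i hi => ?_⟩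
  · have hi' : tsupport (e i) ⊆ A := subset_iUnion (fun i : {i : Fin 6 // i < 3} =>
      tsupport (e i)) ⟨i, hi⟩
    exact ⟨(disjoint_tsupport_one_sub hχ1).symm.mono_left hi',
      hψχ.symm.mono_left (hi'.trans hAχ)⟩
  · have hi' : tsupport (e i) ⊆ B := subset_iUnion (fun i : {i : Fin 6 // 3 ≤ i} =>
      tsupport (e i)) ⟨i, hi⟩
    exact ⟨(disjoint_tsupport_one_sub hψ1).symm.mono_left hi', hχB.symm.mono_left hi'⟩

namespace Loop

variable {s : SmoothnessClass}

instance : IsTopologicalAddGroup (Loop s) where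
  continuous_neg := by
    have : (fun x : Loop s => -x) = fun x => (-1 : ℂ) • x := funext fun x => by
      rw [neg_smul, one_smul]
    rw [this]
    exact continuous_const_smul _

/-- Two loops are orthogonal if their supports are disjoint. -/
def Perp (x y : Loop s) : Prop := Disjoint (Distr.supp x.toDistr) (Distr.supp y.toDistr)

theorem Perp.symm {x y : Loop s} (h : Perp x y) : Perp y x := Disjoint.symm h

theorem Perp.comb {x y z : Loop s} (r t : ℂ) (hx : Perp x z) (hy : Perp y z) :
    Perp (r • x + t • y) z :=
  (disjoint_union_left.2 ⟨hx, hy⟩).mono_left (supp_add_subset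
    (supp_smul_subset subset_union_left r) (supp_smul_subset subset_union_right t))

theorem Perp.mul_left {x y : Loop s} (h : Perp x y) (χ : TestFn) : Perp (mul χ x) y :=
  h.mono_left (Distr.supp_mul_right χ _)

theorem perp_mul_mul {χ ψ : TestFn} (h : Disjoint (tsupport χ) (tsupport ψ)) (x y : Loop s) :
    Perp (mul χ x) (mul ψ y) :=
  h.mono (Distr.supp_mul_left _ _) (Distr.supp_mul_left _ _)

theorem perp_ofTest_mul {χ ψ : TestFn} (h : Disjoint (tsupport χ) (tsupport ψ)) (y : Loop s) :
    Perp (ofTest χ) (mul ψ y) :=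
  h.mono (Distr.supp_ofTest _) (Distr.supp_mul_left _ _)

theorem perp_ofTest_ofTest {χ ψ : TestFn} (h : Disjoint (tsupport χ) (tsupport ψ)) :
    Perp (ofTest χ : Loop s) (ofTest ψ) :=
  h.mono (Distr.supp_ofTest _) (Distr.supp_ofTest _)

theorem sub_mul (χ : TestFn) (x : Loop s) : x - mul χ x = mul (TestFn.one - χ) x := by
  rw [map_sub, LinearMap.sub_apply, mul_one]

/-- Multiplication by a test function, as a continuous linear map. -/
def mulCLM (χ : TestFn) : Loop s →L[ℂ] Loop s := ⟨mul χ, continuous_mul χ⟩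

/-- The derivative, as a continuous linear map. -/
def derivCLM : Loop s →L[ℂ] Loop s.pred where
  toFun := deriv
  map_add' _ _ := ext (map_add Distr.deriv _ _)
  map_smul' _ _ := ext (map_smul Distr.deriv _ _)
  cont := continuous_deriv

/-- The primitive, as a continuous linear map. -/
def primitiveCLM : Loop s.pred →L[ℂ] Loop s := ⟨primitive, continuous_primitive⟩

/-- The integral, as a continuous linear map. -/
def integralCLM : Loop s →L[ℂ] ℂ := ⟨integral, continuous_integral⟩

theorem deriv_primitive {x : Loop s.pred} (hx : integral x = 0) : (primitive x).deriv = x := by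
  refine ext ((Distr.deriv_primitive x.toDistr).trans ?_)
  rw [← integral_apply, hx, zero_smul, sub_zero]

theorem primitive_deriv (y : Loop s) :
    y.toDistr = (primitive y.deriv).toDistr + Distr.const (Distr.integral y.toDistr) := by
  rw [toDistr_primitive, toDistr_deriv, Distr.primitive_deriv, Distr.const_eq, sub_add_cancel]

theorem integral_deriv (y : Loop s) : integral y.deriv = 0 := Distr.integral_deriv y.toDistr

end Loop

/-! ### The spaces of holomorphic functions -/

section Spaces

variable {s : SmoothnessClass}

theorem mem_additiveSpace {F : C(ℂ × Loop s, ℂ)} :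
    F ∈ AdditiveSpace s ↔ IsAdmissible F ∧ ∀ ζ, LocallyAdditive fun y => F (ζ, y) := by
  refine ⟨fun h => ⟨⟨h.1, h.2.1⟩, fun ζ x y hxy => h.2.2 ζ x y (disjoint_iff_inter_eq_empty.1 hxy)⟩,
    fun h => ⟨h.1.1, h.1.2, fun ζ x y hxy => h.2 ζ x y (disjoint_iff_inter_eq_empty.2 hxy)⟩⟩

theorem LocallyAdditive.map_zero {f : Loop s → ℂ} (h : LocallyAdditive f) : f 0 = 0 := by
  have := h 0 0 (by rw [Loop.toDistr_zero, Distr.supp_zero]; exact disjoint_bot_left)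
  rw [add_zero] at this
  exact left_eq_add.1 this

theorem pullback_derivCLM_mem {F : C(ℂ × Loop s.pred, ℂ)} (hF : F ∈ AdditiveSpace s.pred) :
    pullback Loop.derivCLM F ∈ InvariantSpace s := by
  obtain ⟨hF1, hF2⟩ := mem_additiveSpace.1 hF
  refine ⟨mem_additiveSpace.2 ⟨(preservesClasses_pullback _).1 F hF1, fun ζ x y hxy => ?_⟩,
    fun ζ y z c hz => ?_⟩
  · change F (ζ, Loop.derivCLM (x + y)) = _
    rw [map_add]
    exact hF2 ζ _ _ (hxy.mono (Distr.supp_deriv _) (Distr.supp_deriv _))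
  · refine congrArg (fun x => F (ζ, x)) (Loop.ext ?_)
    change Distr.deriv z.toDistr = Distr.deriv y.toDistr
    rw [hz, map_add, Distr.deriv_const, add_zero]

/-- The function `F(ζ, ·)` of the primitive is additive on increments of integral zero. -/
theorem isExtendable_of_mem {F : C(ℂ × Loop s, ℂ)} (hF : F ∈ InvariantSpace s)
    {e : Fin 6 → TestFn} (he1 : ∀ i, TestFn.integral (e i) = 1)
    (he : ∀ i j, i ≠ j → Disjoint (tsupport (e i)) (tsupport (e j))) (ζ : ℂ) :
    IsExtendable (Loop.integralCLM : Loop s.pred →L[ℂ] ℂ).toLinearMap Loop.Perp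
      (fun i => Loop.ofTest (e i)) fun x => pullback Loop.primitiveCLM F (ζ, x) := by
  obtain ⟨hF1, hF2⟩ := mem_additiveSpace.1 hF.1
  refine ⟨Loop.Perp.symm, Loop.Perp.comb, fun i => (Loop.integral_ofTest _).trans (he1 i),
    fun hij => Loop.perp_ofTest_ofTest (he _ _ hij), ?_, fun {x p q} hp hq hpq => ?_⟩
  · change F (ζ, Loop.primitiveCLM 0) = 0
    rw [map_zero]
    exact (hF2 ζ).map_zero
  · change F (ζ, Loop.primitiveCLM (x + p + q)) = F (ζ, Loop.primitiveCLM (x + p)) +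
      F (ζ, Loop.primitiveCLM (x + q)) - F (ζ, Loop.primitiveCLM x)
    simp only [map_add]
    refine (hF2 ζ).add_add_eq_of_disjoint_deriv (hF1.1.snd ζ) (fun y c => ?_) ?_ _
    · refine hF.2 ζ _ _ c ?_
      rw [Loop.toDistr_add, Loop.toDistr_smul, Loop.toDistr_ofTest, Distr.const_eq]
    · have h1 : Distr.deriv (Loop.primitiveCLM p).toDistr = p.toDistr :=
        congrArg Loop.toDistr (Loop.deriv_primitive hp)
      have h2 : Distr.deriv (Loop.primitiveCLM q).toDistr = q.toDistr :=
        congrArg Loop.toDistr (Loop.deriv_primitive hq)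
      rw [h1, h2]
      exact hpq

-- R is a composition of operators on all continuous functions, so continuity and preservation of
-- the classes do not depend on F. Membership in 𝔉 enters through `IsExtendable`, which yields local
-- additivity and the agreement with F on derivatives. The supports of x - χx and x - ψx avoid those
-- of e₀, e₁, e₂ and of e₃, e₄, e₅, respectively.
variable (s) in
theorem exists_rightInverse : ∃ R : C(ℂ × Loop s, ℂ) →L[ℂ] C(ℂ × Loop s.pred, ℂ),
    PreservesClasses R ∧ ∀ F ∈ InvariantSpace s, R F ∈ AdditiveSpace s.pred ∧
      ∀ ζ y, R F (ζ, Loop.deriv y) = F (ζ, y) := by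
  obtain ⟨e, χ, ψ, he1, he, hχψ, hA, hB⟩ := TestFn.exists_bumps
  let E : Fin 6 → Loop s.pred := fun i => Loop.ofTest (e i)
  let R : C(ℂ × Loop s, ℂ) →L[ℂ] C(ℂ × Loop s.pred, ℂ) :=
    (extendCLM Loop.integralCLM E (Loop.mulCLM χ) (Loop.mulCLM ψ)).comp (pullback Loop.primitiveCLM)
  have hR : PreservesClasses R :=
    (preservesClasses_extendCLM _ _ _ _).comp (preservesClasses_pullback _)
  refine ⟨R, hR, fun F hF => ?_⟩
  obtain ⟨hF1, -⟩ := mem_additiveSpace.1 hF.1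
  have hH := (preservesClasses_pullback Loop.primitiveCLM).1 F hF1
  have hext := isExtendable_of_mem hF he1 he
  have hg0 : ∀ ζ, potential E (fun x => pullback Loop.primitiveCLM F (ζ, x)) 0 = 0 :=
    fun ζ => coboundary_zero _
  have hg := fun ζ => (hext ζ).potential_add hH
  have hsub : ∀ x : Loop s.pred,
      x - Loop.mul χ x - Loop.mul ψ x = Loop.mul (TestFn.one - χ - ψ) x := fun x => by
    rw [map_sub, LinearMap.sub_apply, ← Loop.sub_mul]
  have hAv : ∀ i, i < 3 → ∀ x, Loop.Perp (E i) (x - Loop.mul χ x) := fun i hi x => by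
    rw [Loop.sub_mul]
    exact Loop.perp_ofTest_mul (hA i hi).1 x
  have hAψ : ∀ i, i < 3 → ∀ x, Loop.Perp (E i) (Loop.mul ψ x) := fun i hi x =>
    Loop.perp_ofTest_mul (hA i hi).2 x
  have hBv : ∀ i, 3 ≤ i → ∀ x, Loop.Perp (E i) (x - Loop.mul ψ x) := fun i hi x => by
    rw [Loop.sub_mul]
    exact Loop.perp_ofTest_mul (hB i hi).1 x
  have hBχ : ∀ i, 3 ≤ i → ∀ x, Loop.Perp (E i) (Loop.mul χ x) := fun i hi x =>
    Loop.perp_ofTest_mul (hB i hi).2 x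
  have hsubperp : ∀ i x y, Loop.Perp (E i) x → Loop.Perp (E i) y → Loop.Perp (E i) (x - y) :=
    fun i x y hx hy => by
      have := Loop.Perp.comb 1 (-1) hx.symm hy.symm
      rw [one_smul, neg_one_smul, ← sub_eq_add_neg] at this
      exact this.symm
  have hAv' : ∀ i, i < 3 → ∀ x, Loop.Perp (E i) (x - Loop.mul χ x - Loop.mul ψ x) :=
    fun i hi x => hsubperp _ _ _ (hAv i hi x) (hAψ i hi x)
  have hBv' : ∀ i, 3 ≤ i → ∀ x, Loop.Perp (E i) (x - Loop.mul χ x - Loop.mul ψ x) :=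
    fun i hi x => by
      rw [sub_right_comm]
      exact hsubperp _ _ _ (hBv i hi x) (hBχ i hi x)
  refine ⟨mem_additiveSpace.2 ⟨hR.1 F hF1, fun ζ x y hxy => ?_⟩, fun ζ y => ?_⟩
  · have hmul : ∀ θ : TestFn, Loop.Perp (Loop.mul θ x) (Loop.mul θ y) := fun θ =>
      ((Loop.Perp.mul_left hxy θ).symm.mul_left θ).symm
    have h1 := (hext ζ).extendOff_add (hg0 ζ) (hg ζ) (i := 0) (j := 1) (k := 2) (by decide)
      (by decide) (by decide) (by rw [Loop.sub_mul, Loop.sub_mul]; exact hmul _)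
      (hAv 0 (by decide) x) (hAv 2 (by decide) x) (hAv 0 (by decide) y) (hAv 1 (by decide) y)
    have h2 := (hext ζ).extendOff_add (hg0 ζ) (hg ζ) (i := 3) (j := 4) (k := 5) (by decide)
      (by decide) (by decide) (by rw [Loop.sub_mul, Loop.sub_mul]; exact hmul _)
      (hBv 3 (by decide) x) (hBv 5 (by decide) x) (hBv 3 (by decide) y) (hBv 4 (by decide) y)
    have h3 := (hext ζ).extendOff_add (hg0 ζ) (hg ζ) (i := 0) (j := 1) (k := 2) (by decide)
      (by decide) (by decide) (by rw [hsub, hsub]; exact hmul _)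
      (hAv' 0 (by decide) x) (hAv' 2 (by decide) x) (hAv' 0 (by decide) y) (hAv' 1 (by decide) y)
    change extendCLM _ _ _ _ _ (ζ, x + y) =
      extendCLM _ _ _ _ _ (ζ, x) + extendCLM _ _ _ _ _ (ζ, y)
    rw [extendCLM_apply, extendCLM_apply, extendCLM_apply]
    have e1 : x + y - Loop.mulCLM χ (x + y) = x - Loop.mul χ x + (y - Loop.mul χ y) := by
      rw [map_add]
      exact add_sub_add_comm _ _ _ _
    have e2 : x + y - Loop.mulCLM ψ (x + y) = x - Loop.mul ψ x + (y - Loop.mul ψ y) := by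
      rw [map_add]
      exact add_sub_add_comm _ _ _ _
    have e3 : x + y - Loop.mulCLM χ (x + y) - Loop.mulCLM ψ (x + y) =
        x - Loop.mul χ x - Loop.mul ψ x + (y - Loop.mul χ y - Loop.mul ψ y) := by
      rw [e1, map_add]
      exact add_sub_add_comm _ _ _ _
    rw [e3, e1, e2]
    have hring : ∀ a a' b b' c c' : ℂ,
        a + a' + (b + b') - (c + c') = a + b - c + (a' + b' - c') := fun _ _ _ _ _ _ => by ring
    exact (congrArg₂ (· - ·) (congrArg₂ (· + ·) h1 h2) h3).trans (hring _ _ _ _ _ _)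
  · set x := Loop.deriv y with hx
    have h0 : Loop.mul χ x + (x - Loop.mul χ x - Loop.mul ψ x) + Loop.mul ψ x = x := by abel
    have h1 := (hext ζ).apply_eq_extendOff (hg0 ζ) (hg ζ) (i := 0) (j := 3) (by decide)
      (u := Loop.mul χ x) (v := x - Loop.mul χ x - Loop.mul ψ x) (w := Loop.mul ψ x)
      (by rw [h0]; exact Loop.integral_deriv y) (Loop.perp_mul_mul hχψ x x)
      (hAψ 0 (by decide) x) (hBχ 3 (by decide) x) (hAv' 0 (by decide) x) (hBv' 3 (by decide) x)
    rw [h0] at h1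
    have e1 : x - Loop.mul χ x - Loop.mul ψ x + Loop.mul ψ x = x - Loop.mul χ x := by abel
    have e2 : x - Loop.mul χ x - Loop.mul ψ x + Loop.mul χ x = x - Loop.mul ψ x := by abel
    rw [e1, e2] at h1
    refine (extendCLM_apply _ _ _ _ _ ζ x).trans (Eq.trans h1.symm ?_)
    -- The primitive of y' differs from y by a constant, to which F is insensitive.
    exact (hF.2 ζ _ _ _ (Loop.primitive_deriv y)).symm

end Spaces

/-! ### The kernel -/

section Kernel

variable {s : SmoothnessClass}

theorem eq_mul_of_additive {h : ℂ → ℂ} (hd : Differentiable ℂ h)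
    (hadd : ∀ a b, h (a + b) = h a + h b) (t : ℂ) : h t = h 1 * t := by
  have hderiv : ∀ a, deriv h a = deriv h 0 := fun a => by
    have h1 := deriv_comp_const_add (f := h) a 0
    rw [add_zero] at h1
    rw [← h1]
    simp only [hadd, deriv_const_add]
  have h0 : h 0 = 0 := by simpa using hadd 0 0
  have h2 : ∀ t, h t - deriv h 0 * t = 0 := fun t => by
    have := is_const_of_deriv_eq_zero (f := fun t => h t - deriv h 0 * t)
      (hd.sub (differentiable_id.const_mul _)) (fun a => by
        have := (hd a).hasDerivAt.sub ((hasDerivAt_id a).const_mul (deriv h 0))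
        rw [mul_one, hderiv a, sub_self] at this
        exact this.deriv) t 0
    simpa [h0] using this
  linear_combination h2 t - t * h2 1

/-- An additive holomorphic function that vanishes on the loops of integral zero is a multiple of
the integral. -/
theorem LocallyAdditive.exists_eq_mul_integral {f : Loop s → ℂ} (ha : LocallyAdditive f)
    (hf : IsHolomorphic f) (h0 : ∀ x, Loop.integral x = 0 → f x = 0) {a : Loop s}
    (ha1 : Loop.integral a = 1) (x : Loop s) : f x = f a * Loop.integral x := by
  obtain ⟨e, χ, ψ, he1, he, hχψ, hA, hB⟩ := TestFn.exists_bumps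
  let E : Fin 6 → Loop s := fun i => Loop.ofTest (e i)
  have hE1 : ∀ i, Loop.integral (E i) = 1 := fun i => (Loop.integral_ofTest _).trans (he1 i)
  have hE : ∀ i j, i ≠ j → Loop.Perp (E i) (E j) := fun i j h =>
    Loop.perp_ofTest_ofTest (he i j h)
  have hsmul : ∀ {x y : Loop s} (r t : ℂ), Loop.Perp x y → Loop.Perp (r • x) (t • y) :=
    fun r t h => h.mono (Distr.supp_smul _ _) (Distr.supp_smul _ _)
  -- Adding the multiple of `E i` that cancels the integral gives an element on which f vanishes.
  have hoff : ∀ i z, Loop.Perp (E i) z → f z = -f ((-Loop.integral z) • E i) := by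
    intro i z hz
    have h1 := ha z ((-Loop.integral z) • E i) 
      (by simpa only [one_smul] using (hsmul (-Loop.integral z) 1 hz).symm : Loop.Perp _ _)
    rw [h0 _ (by rw [map_add, map_smul, hE1, smul_eq_mul, _root_.mul_one, add_neg_cancel])] at h1
    linear_combination -h1
  let h : ℂ → ℂ := fun t => f (t • E 0)
  have hneg : ∀ i j, i ≠ j → ∀ t : ℂ, f (t • E j) = -f ((-t) • E i) := fun i j hij t => by
    have := hoff i (t • E j) (by simpa using hsmul 1 t (hE i j hij))
    rwa [map_smul, hE1, smul_eq_mul, _root_.mul_one] at this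
  have hi : ∀ i t, f (t • E i) = h t := by
    intro i t
    by_cases hi0 : i = 0
    · rw [hi0]
    -- Two sign changes through a third bump compare `E i` with `E 0`.
    · obtain ⟨k, hk0, hki⟩ : ∃ k : Fin 6, k ≠ 0 ∧ k ≠ i :=
        (by decide : ∀ i : Fin 6, ∃ k : Fin 6, k ≠ 0 ∧ k ≠ i) i
      rw [hneg k i hki, ← hneg k 0 hk0]
  have hodd : ∀ t, h (-t) = -h t := fun t => by
    have := hneg 1 0 (by decide) (-t)
    rwa [neg_neg, hi 1] at this
  have hoff' : ∀ i z, Loop.Perp (E i) z → f z = h (Loop.integral z) := fun i z hz => by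
    rw [hoff i z hz, hi, hodd, neg_neg]
  have hadd : ∀ r t, h (r + t) = h r + h t := by
    intro r t
    have h1 := ha (r • E 0) (t • E 1) (hsmul r t (hE 0 1 (by decide)))
    rw [hi, hi, hoff' 2 _ (Loop.Perp.comb r t (hE 0 2 (by decide)) (hE 1 2 (by decide))).symm,
      map_add, map_smul, map_smul, hE1, hE1, smul_eq_mul, smul_eq_mul, _root_.mul_one,
      _root_.mul_one] at h1
    exact h1
  have hdiff : Differentiable ℂ h := by simpa using hf.2 0 (E 0)
  have hlin := eq_mul_of_additive hdiff hadd
  -- For arbitrary x the cut-offs and `add_add_eq` express f(x) by values at elements whose supports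
  -- each avoid some bump.
  have hgen : ∀ x, f x = h 1 * Loop.integral x := by
    intro x
    set v := x - Loop.mul χ x - Loop.mul ψ x
    have e1 : v + Loop.mul χ x = Loop.mul (TestFn.one - ψ) x := by
      rw [← Loop.sub_mul]
      simp only [v]
      abel
    have e2 : v + Loop.mul ψ x = Loop.mul (TestFn.one - χ) x := by
      rw [← Loop.sub_mul]
      simp only [v]
      abel
    have e3 : v + Loop.mul χ x + Loop.mul ψ x = x := by
      simp only [v]
      abel
    have p1 : Loop.Perp (E 3) (v + Loop.mul χ x) := by
      rw [e1]
      exact Loop.perp_ofTest_mul (hB 3 (by decide)).1 x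
    have p2 : Loop.Perp (E 0) (v + Loop.mul ψ x) := by
      rw [e2]
      exact Loop.perp_ofTest_mul (hA 0 (by decide)).1 x
    have p3 : Loop.Perp (E 0) v := by
      have := (Loop.Perp.comb 1 (-1) p2.symm
        (Loop.perp_ofTest_mul (hA 0 (by decide)).2 x).symm).symm
      rwa [one_smul, neg_one_smul, ← sub_eq_add_neg, add_sub_cancel_right] at this
    have h1 := ha.add_add_eq hf (Loop.perp_mul_mul hχψ x x) v
    rw [hoff' 3 _ p1, hoff' 0 _ p2, hoff' 0 _ p3, e3, hlin, hlin (Loop.integral (v + _)),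
      hlin (Loop.integral v)] at h1
    have h2 := congrArg Loop.integral e3
    simp only [map_add] at h1 h2
    rw [h1, ← h2]
    ring
  rw [hgen x, hgen a, ha1, _root_.mul_one]

/-- The coefficient F(ζ, a) is entire in ζ. For ζ = 1/λ the growth condition reads λ² F(ζ, a) =
O(λ²), so the coefficient is bounded at infinity and Liouville's theorem applies. -/
theorem exists_eq_mul_integral_of_mem {F : C(ℂ × Loop s, ℂ)} (hF : F ∈ AdditiveSpace s)
    (h0 : ∀ ζ x, Loop.integral x = 0 → F (ζ, x) = 0) :
    ∃ c : ℂ, ∀ ζ x, F (ζ, x) = c * Loop.integral x := by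
  obtain ⟨hF1, hF2⟩ := mem_additiveSpace.1 hF
  let a : Loop s := Loop.ofTest TestFn.one
  have ha : Loop.integral a = 1 := (Loop.integral_ofTest _).trans TestFn.integral_one
  have h1 : ∀ ζ x, F (ζ, x) = F (ζ, a) * Loop.integral x := fun ζ x =>
    (hF2 ζ).exists_eq_mul_integral (hF1.1.snd ζ) (h0 ζ) ha x
  have hd : Differentiable ℂ fun ζ => F (ζ, a) := by simpa using hF1.1.2 (0, a) (1, 0)
  have hb : Bornology.IsBounded (range fun ζ => F (ζ, a)) := by
    obtain ⟨C, hC⟩ := (hF1.2 1 a).bound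
    obtain ⟨r, hr, hrC⟩ := Metric.mem_nhdsWithin_iff.1 hC
    obtain ⟨M, hM⟩ := ((isCompact_closedBall (0 : ℂ) (2 / r)).image
      hd.continuous).isBounded.exists_norm_le
    refine isBounded_iff_forall_norm_le.2 ⟨max C M, ?_⟩
    rintro _ ⟨ζ, rfl⟩
    by_cases hζ : ‖ζ‖ ≤ 2 / r
    · exact (hM _ ⟨ζ, mem_closedBall_zero_iff.2 hζ, rfl⟩).trans (le_max_right _ _)
    · rw [not_le] at hζ
      have hpos : 0 < ‖ζ‖ := lt_trans (by positivity) hζ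
      have hne : ζ ≠ 0 := norm_pos_iff.1 hpos
      have hmem : ζ⁻¹ ∈ Metric.ball (0 : ℂ) r ∩ {0}ᶜ := by
        refine ⟨?_, inv_ne_zero hne⟩
        rw [mem_ball_zero_iff, norm_inv, inv_lt_comm₀ hpos hr]
        refine lt_trans ?_ hζ
        rw [inv_eq_one_div]
        exact div_lt_div_of_pos_right one_lt_two hr
      have h2 := hrC hmem
      rw [mem_ofPred_eq, one_div, inv_inv, h1, map_smul, ha, smul_eq_mul, _root_.mul_one,
        norm_mul, norm_pow] at h2
      refine le_trans (le_of_mul_le_mul_right h2 ?_) (le_max_left _ _)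
      exact pow_pos (norm_pos_iff.2 (inv_ne_zero hne)) 2
  exact ⟨F (0, a), fun ζ x => by rw [h1, hd.apply_eq_apply_of_bounded hb ζ 0]⟩

/-- The function `c ∫ x`. -/
def integralFn (c : ℂ) : C(ℂ × Loop s, ℂ) :=
  ⟨fun p => c * Loop.integral p.2, continuous_const.mul
    (Loop.continuous_integral.comp continuous_snd)⟩

theorem integralFn_mem (c : ℂ) : (integralFn c : C(ℂ × Loop s, ℂ)) ∈ AdditiveSpace s := by
  refine mem_additiveSpace.2 ⟨⟨⟨map_continuous _, fun x v => ?_⟩, fun ζ y => ?_⟩, fun ζ x y _ => ?_⟩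
  · have : (fun t : ℂ => integralFn c (x + t • v)) =
        fun t => c * (Loop.integral x.2 + t * Loop.integral v.2) := funext fun t =>
      congrArg (c * ·) (show Loop.integral (x.2 + t • v.2) = _ by
        rw [map_add, map_smul, smul_eq_mul])
    rw [this]
    fun_prop
  · have : (fun t : ℂ => integralFn c (ζ / t, t ^ 2 • y)) =
        fun t => c * Loop.integral y * t ^ 2 := funext fun t =>
      (congrArg (c * ·) (show Loop.integral (t ^ 2 • y) = _ by
        rw [map_smul, smul_eq_mul])).trans (by ring)
    rw [this]
    exact isBigO_const_mul_self _ _ _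
  · change c * Loop.integral (x + y) = c * Loop.integral x + c * Loop.integral y
    rw [map_add, mul_add]

end Kernel

end LoopSpaces

end

/-! ### The theorem -/

open LoopSpaces in
theorem theorem1p1 (s : SmoothnessClass) :
    ∃ T : AdditiveSpace s.pred →L[ℂ] InvariantSpace s,
      -- the map `F̃ ↦ F`, `F(ζ, y) = F̃(ζ, ẏ)`, is well defined, continuous, linear, and graded
      (∀ (F : AdditiveSpace s.pred) (ζ : ℂ) (y : Loop s), (T F).1 (ζ, y) = F.1 (ζ, y.deriv)) ∧
      (∀ (m : ℕ) (F : AdditiveSpace s.pred), IsPosthomogeneous m F.1 →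
        IsPosthomogeneous m (T F).1) ∧
      -- it has a continuous linear graded right inverse
      (∃ R : InvariantSpace s →L[ℂ] AdditiveSpace s.pred,
        (∀ F : InvariantSpace s, T (R F) = F) ∧
        (∀ (m : ℕ) (F : InvariantSpace s), IsPosthomogeneous m F.1 →
          IsPosthomogeneous m (R F).1)) ∧
      -- its kernel consists exactly of the functions `const · ∫ x`
      (∀ G : ℂ × Loop s.pred → ℂ,
        (∃ F : AdditiveSpace s.pred, T F = 0 ∧ ⇑F.1 = G) ↔
          ∃ c : ℂ, ∀ (ζ : ℂ) (x : Loop s.pred), G (ζ, x) = c * Distr.integral x.toDistr) := by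
  let T : AdditiveSpace s.pred →L[ℂ] InvariantSpace s :=
    (pullback Loop.derivCLM).restrict fun F hF => pullback_derivCLM_mem hF
  obtain ⟨R, hR, hRF⟩ := exists_rightInverse s
  have hadm : ∀ F : InvariantSpace s, IsAdmissible F.1 := fun F =>
    (mem_additiveSpace.1 F.2.1).1
  refine ⟨T, fun F ζ y => rfl, fun m F hF => ?_, ⟨R.restrict fun F hF => (hRF F hF).1,
    fun F => ?_, fun m F hF => hR.2 F.1 m (hadm F) hF⟩, fun G => ⟨?_, ?_⟩⟩
  · exact (preservesClasses_pullback Loop.derivCLM).2 F.1 m (mem_additiveSpace.1 F.2).1 hF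
  · exact Subtype.ext (ContinuousMap.ext fun p => (hRF F.1 F.2).2 p.1 p.2)
  · rintro ⟨F, hF, rfl⟩
    refine exists_eq_mul_integral_of_mem F.2 fun ζ x hx => ?_
    -- Every x of integral zero is the derivative of its primitive, so F̃ vanishes on all such x.
    have := congrArg (fun K : InvariantSpace s => K.1 (ζ, Loop.primitive x)) hF
    have h1 : F.1 (ζ, (Loop.primitive x).deriv) = 0 := this
    rwa [Loop.deriv_primitive hx] at h1
  · rintro ⟨c, hc⟩
    refine ⟨⟨integralFn c, integralFn_mem c⟩, Subtype.ext (ContinuousMap.ext fun p => ?_),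
      funext fun p => (hc p.1 p.2).symm⟩
    change c * Loop.integral p.2.deriv = 0
    rw [Loop.integral_deriv, mul_zero]
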